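/- Let $T>0$. For $\varepsilon>0$ consider on $[0,T]\times\mathbb{R}^3$ the system $$\partial_t u^\varepsilon+\nabla p^\varepsilon=\Delta u^\varepsilon-(u^\varepsilon\cdot\nabla)u^\varepsilon-\tfrac12(\operatorname{div}u^\varepsilon)u^\varepsilon,\qquad \partial_t\theta^\varepsilon+u^\varepsilon\cdot\nabla\theta^\varepsilon=\Delta\theta^\varepsilon-\tfrac12(\operatorname{div}u^\varepsilon)\theta^\varepsilon,\qquad \varepsilon\,\partial_tp^\varepsilon+\operatorname{div}u^\varepsilon=0,$$ with initial data $(u_0^\varepsilon,\theta_0^\varepsilon,p_0^\varepsilon)\in L^2(\mathbb{R}^3)$, where $u^\varepsilon$ is $\mathbb{R}^3$-valued and $\theta^\varepsilon,p^\varepsilon$ are real-valued. A finite energy weak solution is a triple with $u^\varepsilon,\theta^\varepsilon\in L^\infty(0,T;L^2(\mathbb{R}^3))\cap L^2(0,T;\dot H^1(\mathbb{R}^3))$ and $p^\varepsilon\in L^\infty(0,T;L^2(\mathbb{R}^3))$ that satisfies the three equations in the weak sense, against smooth test functions with compact support in $[0,T)\times\mathbb{R}^3$ and with the initial data included, and such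 that, for almost every $t\in(0,T)$, $$\int_{\mathbb{R}^3}\tfrac12\big(|u^\varepsilon|^2+|\theta^\varepsilon|^2+\varepsilon|p^\varepsilon|^2\big)(t,x)\,dx+\int_0^t\!\!\int_{\mathbb{R}^3}\big(|\nabla u^\varepsilon|^2+|\nabla\theta^\varepsilon|^2\big)\,dx\,ds\le\int_{\mathbb{R}^3}\tfrac12\big(|u_0^\varepsilon|^2+|\theta_0^\varepsilon|^2+\varepsilon|p_0^\varepsilon|^2\big)\,dx .$$ Let $P$ be the Leray projector, that is, the orthogonal projection of $L^2(\mathbb{R}^3;\mathbb{R}^3)$ onto the divergence-free vector fields, applied at (almost) each time. Suppose that, for all sufficiently small $\varepsilon>0$, $(u^\varepsilon,\theta^\varepsilon,p^\varepsilon)$ is such a finite energy weak solution, and that, as $\varepsilon\downarrow0$, $u_0^\varepsilon\to u_0$, $\theta_0^\varepsilon\to\theta_0$ and $\sqrt\varepsilon\,p_0^\varepsilon\to0$ strongly in $L^2(\mathbb{R}^3)$, for some $u_0,\theta_0\in L^2(\mathbb{R}^3)$. We call $(u,\theta)$, with $u,\theta\in L^\infty(0,T;L^2(\mathbb{R}^3))\cap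 L^2(0,T;\dot H^1(\mathbb{R}^3))$, a limit profile along a sequence $\varepsilon_k\downarrow0$ (or along the whole family $\varepsilon\downarrow0$) if $u^\varepsilon\to u$ and $\theta^\varepsilon\to\theta$ in $\mathcal D'((0,T)\times\mathbb{R}^3)$ along it. Then: 1. Every sequence $\varepsilon_k\downarrow0$ has a subsequence along which a limit profile exists. 2. If $(u,\theta)$ is a limit profile along a sequence $\varepsilon_k\downarrow0$, or along the whole family $\varepsilon\downarrow0$, then along it $$Pu^\varepsilon\to Pu\quad\text{strongly in }L^2(0,T;L^2_{loc}(\mathbb{R}^3)),$$ $$\theta^\varepsilon\to\theta\quad\text{strongly in }L^2(0,T;L^2_{loc}(\mathbb{R}^3)),$$ $$\nabla\theta^\varepsilon\rightharpoonup\nabla\theta\quad\text{weakly in }L^2((0,T)\times\mathbb{R}^3),$$ and also $\nabla u^\varepsilon\rightharpoonup\nabla u$ weakly in $L^2((0,T)\times\mathbb{R}^3)$, i.e. $u$ is the weak limit of $u^\varepsilon$ in $L^2(0,T;\dot H^1(\mathbb{R}^3))$. -/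

import Mathlib

open MeasureTheory Filter Topology Set TopologicalSpace
open scoped ENNReal NNReal Distributions

noncomputable section

namespace NSF

/-- The physical space `ℝ³`, with the Euclidean norm. -/
abbrev E3 : Type := EuclideanSpace ℝ (Fin 3)

/-- Space-time points `(t, x)`. -/
abbrev ST : Type := ℝ × E3

/-- The open slab `(0,T) × ℝ³`. -/
def slab (T : ℝ) : Opens ST := ⟨Ioo 0 T ×ˢ univ, isOpen_Ioo.prod isOpen_univ⟩

/-- The open set `(-∞,T) × ℝ³`. The restrictions to `t ≥ 0` of the test functions on it are the
test functions on `[0,T) × ℝ³`, which need not vanish at `t = 0`. -/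
def past (T : ℝ) : Opens ST := ⟨Iio T ×ˢ univ, isOpen_Iio.prod isOpen_univ⟩

/-- Lebesgue measure on `(0,T) × ℝ³`. -/
def stMeasure (T : ℝ) : Measure ST := volume.restrict (slab T : Set ST)

section Fields

variable {F : Type*} [NormedAddCommGroup F] [InnerProductSpace ℝ F]

/-- The time derivative of a (smooth) space-time field. -/
def timeDeriv (φ : ST → F) (z : ST) : F := fderiv ℝ φ z (1, 0)

/-- The `i`-th spatial derivative of a (smooth) space-time field. -/
def spaceDeriv (i : Fin 3) (φ : ST → F) (z : ST) : F :=
  fderiv ℝ φ z (0, EuclideanSpace.single i 1)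

/-- `f ∈ L^∞(0,T; L²(ℝ³))`. -/
def MemLinftyL2 (T : ℝ) (f : ST → F) : Prop :=
  AEStronglyMeasurable f (stMeasure T) ∧
    ∃ C : ℝ≥0, ∀ᵐ t ∂(volume.restrict (Ioo 0 T)),
      eLpNorm (fun x : E3 => f (t, x)) 2 volume ≤ C

/-- `G = (∂₁ f, ∂₂ f, ∂₃ f)` in the sense of distributions on `(0,T) × ℝ³`. -/
def HasWeakGrad (T : ℝ) (f : ST → F) (G : Fin 3 → ST → F) : Prop :=
  ∀ (i : Fin 3) (ψ : 𝓓(slab T, ℝ)),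
    ∫ z, spaceDeriv i ψ z • f z ∂(stMeasure T) = - ∫ z, ψ z • G i z ∂(stMeasure T)

/-- `f ∈ L^∞(0,T; L²(ℝ³)) ∩ L²(0,T; Ḣ¹(ℝ³))`, with weak spatial gradient `G`. -/
structure FiniteEnergyField (T : ℝ) (f : ST → F) (G : Fin 3 → ST → F) : Prop where
  bounded : MemLinftyL2 T f
  grad_memLp : ∀ i, MemLp (G i) 2 (stMeasure T)
  hasWeakGrad : HasWeakGrad T f G

/-- `f_ε → f` in `𝓓'((0,T) × ℝ³)`, along the filter `l` in `ε`. -/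
def TendstoDistrib (T : ℝ) (l : Filter ℝ) (f : ℝ → ST → F) (f₀ : ST → F) : Prop :=
  ∀ φ : 𝓓(slab T, F),
    Tendsto (fun ε => ∫ z, inner ℝ (f ε z) (φ z) ∂(stMeasure T)) l
      (𝓝 (∫ z, inner ℝ (f₀ z) (φ z) ∂(stMeasure T)))

/-- `f_ε ⇀ f` weakly in `L²((0,T) × ℝ³)`, along the filter `l` in `ε`. -/
def TendstoWeakL2 (T : ℝ) (l : Filter ℝ) (f : ℝ → ST → F) (f₀ : ST → F) : Prop :=
  (∀ᶠ ε in l, MemLp (f ε) 2 (stMeasure T)) ∧ MemLp f₀ 2 (stMeasure T) ∧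
    ∀ g : ST → F, MemLp g 2 (stMeasure T) →
      Tendsto (fun ε => ∫ z, inner ℝ (f ε z) (g z) ∂(stMeasure T)) l
        (𝓝 (∫ z, inner ℝ (f₀ z) (g z) ∂(stMeasure T)))

/-- `f_ε → f` strongly in `L²(0,T; L²_loc(ℝ³))`, along the filter `l` in `ε`: the norm of the
difference in `L²(0,T; L²(K))` tends to `0` for every compact `K`. The fields are given as
functions of time with values in functions on `ℝ³`. -/
def TendstoL2L2loc (T : ℝ) (l : Filter ℝ) (f : ℝ → ℝ → E3 → F) (f₀ : ℝ → E3 → F) : Prop :=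
  ∀ K : Set E3, IsCompact K →
    Tendsto (fun ε => ∫⁻ t in Ioo 0 T,
        (eLpNorm (fun x => f ε t x - f₀ t x) 2 (volume.restrict K)) ^ 2) l (𝓝 0)

end Fields

/-- The gradients of test functions, as a subspace of `L²(ℝ³; ℝ³)`. Its closure is the space of
gradient fields in `L²`, and its orthogonal complement consists of the `v ∈ L²(ℝ³; ℝ³)` with
`∫ v · ∇ψ = 0` for all test functions `ψ`, that is, with `div v = 0` as a distribution. -/
def gradients : Submodule ℝ (Lp E3 2 (volume : Measure E3)) :=
  Submodule.span ℝ {g | ∃ ψ : 𝓓((⊤ : Opens E3), ℝ), g =ᵐ[volume] fun x => gradient ψ x}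

/-- The space of divergence-free vector fields in `L²(ℝ³; ℝ³)`. -/
def divFree : Submodule ℝ (Lp E3 2 (volume : Measure E3)) := gradientsᗮ

instance : CompleteSpace divFree := Submodule.instOrthogonalCompleteSpace gradients

instance : divFree.HasOrthogonalProjection := Submodule.HasOrthogonalProjection.ofCompleteSpace _

/-- The Leray projector `P` of `L²(ℝ³; ℝ³)`: the orthogonal projection onto the divergence-free
vector fields (`P = I - ∇ Δ⁻¹ div`). -/
def leray : Lp E3 2 (volume : Measure E3) →L[ℝ] Lp E3 2 (volume : Measure E3) :=
  divFree.starProjection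

open Classical in
/-- The Leray projector applied at each time to a space-time vector field with values in
`L²(ℝ³; ℝ³)`. -/
def lerayField (u : ST → E3) (t : ℝ) : E3 → E3 :=
  if h : MemLp (fun x => u (t, x)) 2 (volume : Measure E3) then leray (h.toLp _) else 0

/-- `div u`, from the spatial derivatives `Du i = ∂ᵢ u` of `u`. -/
def divOf (Du : Fin 3 → ST → E3) (z : ST) : ℝ := ∑ i, Du i z i

/-- `(u · ∇) f`, from the spatial derivatives `Df i = ∂ᵢ f` of `f`. -/
def advect {F : Type*} [NormedAddCommGroup F] [NormedSpace ℝ F]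
    (u : ST → E3) (Df : Fin 3 → ST → F) (z : ST) : F := ∑ i, u z i • Df i z

/-- Finite energy weak solution on `[0,T] × ℝ³`, with initial data `(u₀, θ₀, p₀)`, of
`∂ₜu + ∇p = Δu - (u·∇)u - ½ (div u) u`, `∂ₜθ + u·∇θ = Δθ - ½ (div u) θ`, `ε ∂ₜp + div u = 0`.
The functions `Du i`, `Dθ i` are the weak derivatives `∂ᵢu`, `∂ᵢθ`. -/
structure IsWeakSolution (T ε : ℝ) (u₀ : E3 → E3) (θ₀ p₀ : E3 → ℝ)
    (u : ST → E3) (Du : Fin 3 → ST → E3) (θ : ST → ℝ) (Dθ : Fin 3 → ST → ℝ)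
    (p : ST → ℝ) : Prop where
  u₀_memLp : MemLp u₀ 2 volume
  θ₀_memLp : MemLp θ₀ 2 volume
  p₀_memLp : MemLp p₀ 2 volume
  u_mem : FiniteEnergyField T u Du
  θ_mem : FiniteEnergyField T θ Dθ
  p_mem : MemLinftyL2 T p
  momentum : ∀ φ : 𝓓(past T, E3),
    ∫ z, ((∑ i, inner ℝ (Du i z) (spaceDeriv i φ z))
        + inner ℝ (advect u Du z + ((1 / 2 : ℝ) * divOf Du z) • u z) (φ z)
        - p z * (∑ i, spaceDeriv i φ z i)
        - inner ℝ (u z) (timeDeriv φ z)) ∂(stMeasure T)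
      = ∫ x, inner ℝ (u₀ x) (φ (0, x))
  temperature : ∀ ψ : 𝓓(past T, ℝ),
    ∫ z, ((∑ i, Dθ i z * spaceDeriv i ψ z)
        + (advect u Dθ z + (1 / 2 : ℝ) * divOf Du z * θ z) * ψ z
        - θ z * timeDeriv ψ z) ∂(stMeasure T)
      = ∫ x, θ₀ x * ψ (0, x)
  pressure : ∀ ψ : 𝓓(past T, ℝ),
    ∫ z, (divOf Du z * ψ z - ε * p z * timeDeriv ψ z) ∂(stMeasure T)
      = ∫ x, ε * p₀ x * ψ (0, x)
  energy : ∀ᵐ t ∂(volume.restrict (Ioo 0 T)),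
    (∫ x, ((1 / 2 : ℝ) * ‖u (t, x)‖ ^ 2 + (1 / 2 : ℝ) * θ (t, x) ^ 2
        + ε / 2 * p (t, x) ^ 2))
      + ∫ z, (∑ i, (‖Du i z‖ ^ 2 + Dθ i z ^ 2)) ∂(stMeasure t)
    ≤ ∫ x, ((1 / 2 : ℝ) * ‖u₀ x‖ ^ 2 + (1 / 2 : ℝ) * θ₀ x ^ 2 + ε / 2 * p₀ x ^ 2)

/-- The assumptions on the initial data as `ε ↓ 0`: `u₀^ε → u₀`, `θ₀^ε → θ₀` and
`√ε p₀^ε → 0` strongly in `L²(ℝ³)`. -/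
structure InitialDataConv (u₀ε : ℝ → E3 → E3) (θ₀ε p₀ε : ℝ → E3 → ℝ)
    (u₀ : E3 → E3) (θ₀ : E3 → ℝ) : Prop where
  u₀_memLp : MemLp u₀ 2 volume
  θ₀_memLp : MemLp θ₀ 2 volume
  u_conv : Tendsto (fun ε => eLpNorm (fun x => u₀ε ε x - u₀ x) 2 volume) (𝓝[>] 0) (𝓝 0)
  θ_conv : Tendsto (fun ε => eLpNorm (fun x => θ₀ε ε x - θ₀ x) 2 volume) (𝓝[>] 0) (𝓝 0)
  p_conv : Tendsto (fun ε => eLpNorm (fun x => √ε * p₀ε ε x) 2 volume) (𝓝[>] 0) (𝓝 0)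

/-- `(u, θ)`, in `L^∞(0,T; L²) ∩ L²(0,T; Ḣ¹)` with weak gradients `Du`, `Dθ`, is the limit profile
of `(u^ε, θ^ε)` along the filter `l` in `ε`: the limit in the sense of distributions. -/
structure IsLimitProfile (T : ℝ) (l : Filter ℝ) (uε : ℝ → ST → E3) (θε : ℝ → ST → ℝ)
    (u : ST → E3) (Du : Fin 3 → ST → E3) (θ : ST → ℝ) (Dθ : Fin 3 → ST → ℝ) : Prop where
  u_mem : FiniteEnergyField T u Du
  θ_mem : FiniteEnergyField T θ Dθ
  u_tendsto : TendstoDistrib T l uε u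
  θ_tendsto : TendstoDistrib T l θε θ

end NSF

end

/-! The energy inequality bounds `u^ε` and `θ^ε` in `L^∞(0,T;L²)` and their gradients in space-time
`L²`, uniformly for small `ε` (`exists_uniform_bound`). Weak compactness of balls in `L²` then gives
subsequences, and both the `L^∞L²` bound and the weak gradient survive the weak limit
(`exists_subseq_finiteEnergyField`). For bounded fields, convergence in the sense of distributions
is weak `L²` convergence, also of the gradients. What remains is strong convergence, obtained by an
Aubin-Lions argument carried out by hand.

Compactness in space: the gradient bound makes the increments `f(·-h) - f` of size `O(|h|)` in `L²`,
so mollifying at a small scale costs little, uniformly in `ε`. On a compact set a mollification is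
controlled by finitely many of its values, up to a small multiple of the `L²` norm
(`exists_finset_lintegral_sq_le`). Hence it suffices that, for a fixed kernel and a fixed point, the
value of the mollified difference tends to `0` in `L²(0,T)` (`tendsto_lintegral_eLpNorm_restrict`).

Compactness in time: such a value is the pairing of the field with a fixed field `w` on space. The
equation bounds the time derivative of the pairing in `L²(0,T)`: each nonlinear term is a factor in
`L^∞L²` times a factor in `L²L²`, tested against a bounded `w`. A bounded derivative turns weak
convergence of the pairings into strong convergence (`tendsto_lintegral_sq_of_derivBound`).

For the velocity the pressure has no bound uniform in `ε`, but it does not see divergence-free test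
fields. As `P` is self-adjoint, a value of the mollified `Pu` is a pairing of `u` with
`P(k(y-·)eᵢ)`, which is divergence-free but in general neither smooth nor compactly supported.
Mollification repairs the first defect, and cutoffs at larger and larger radii, with a divergence
that tends to `0`, repair the second (`derivBound_velocity`). As `P` commutes with translations and
is a contraction, it does not increase the increments in space. -/

namespace NSF

/-! ### Cauchy-Schwarz and inner products in `L²`. -/

section Hilbert

variable {α : Type*} {m : MeasurableSpace α} {μ : Measure α}
  {F : Type*} [NormedAddCommGroup F] {G : Type*} [NormedAddCommGroup G]

theorem eLpNorm_two_sq (f : α → F) : eLpNorm f 2 μ ^ 2 = ∫⁻ x, ‖f x‖ₑ ^ 2 ∂μ := by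
  have := eLpNorm_nnreal_pow_eq_lintegral (μ := μ) (f := f) (p := 2) two_ne_zero
  norm_cast at this
  exact_mod_cast this

theorem lintegral_mul_le_sqrt {f g : α → ℝ≥0∞} (hf : AEMeasurable f μ) (hg : AEMeasurable g μ) :
    (∫⁻ x, f x * g x ∂μ) ^ 2 ≤ (∫⁻ x, f x ^ 2 ∂μ) * ∫⁻ x, g x ^ 2 ∂μ := by
  have h := ENNReal.lintegral_mul_le_Lp_mul_Lq μ Real.HolderConjugate.two_two hf hg
  have e : ∀ a : ℝ≥0∞, (a ^ (1 / 2 : ℝ)) ^ 2 = a := fun a => by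
    rw [← ENNReal.rpow_natCast, ← ENNReal.rpow_mul]; norm_num
  simp only [Pi.mul_apply, ENNReal.rpow_two] at h
  calc _ ≤ _ := pow_le_pow_left₀ zero_le h 2
    _ = _ := by rw [mul_pow, e, e]

theorem lintegral_enorm_mul_le {f : α → F} {g : α → G} (hf : AEStronglyMeasurable f μ)
    (hg : AEStronglyMeasurable g μ) :
    ∫⁻ x, ‖f x‖ₑ * ‖g x‖ₑ ∂μ ≤ eLpNorm f 2 μ * eLpNorm g 2 μ := by
  have h := lintegral_mul_le_sqrt hf.enorm hg.enorm
  rw [← eLpNorm_two_sq, ← eLpNorm_two_sq, ← mul_pow] at h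
  exact (ENNReal.pow_le_pow_left_iff two_ne_zero).1 h

variable [InnerProductSpace ℝ F]

theorem enorm_inner_le (a b : F) : ‖(inner ℝ a b : ℝ)‖ₑ ≤ ‖a‖ₑ * ‖b‖ₑ := by
  rw [← ofReal_norm, ← ofReal_norm, ← ofReal_norm, ← ENNReal.ofReal_mul (norm_nonneg _)]
  exact ENNReal.ofReal_le_ofReal (norm_inner_le_norm a b)

theorem enorm_integral_inner_le {f g : α → F} (hf : AEStronglyMeasurable f μ)
    (hg : AEStronglyMeasurable g μ) :
    ‖∫ x, inner ℝ (f x) (g x) ∂μ‖ₑ ≤ eLpNorm f 2 μ * eLpNorm g 2 μ :=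
  (enorm_integral_le_lintegral_enorm _).trans
    ((lintegral_mono fun _ => enorm_inner_le _ _).trans (lintegral_enorm_mul_le hf hg))

theorem integrable_inner {f g : α → F} (hf : MemLp f 2 μ) (hg : MemLp g 2 μ) :
    Integrable (fun x => (inner ℝ (f x) (g x) : ℝ)) μ := by
  refine ⟨hf.1.inner hg.1, ?_⟩
  refine lt_of_le_of_lt ((lintegral_mono fun _ => enorm_inner_le _ _).trans
    (lintegral_enorm_mul_le hf.1 hg.1)) ?_
  exact ENNReal.mul_lt_top hf.2 hg.2

theorem inner_toLp {f g : α → F} (hf : MemLp f 2 μ) (hg : MemLp g 2 μ) :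
    inner ℝ (hf.toLp f) (hg.toLp g) = ∫ x, (inner ℝ (f x) (g x) : ℝ) ∂μ := by
  rw [L2.inner_def]
  refine integral_congr_ae ?_
  filter_upwards [hf.coeFn_toLp, hg.coeFn_toLp] with x h1 h2
  rw [h1, h2]

theorem inner_integral_left {f : α → F} [CompleteSpace F] (hf : Integrable f μ) (c : F) :
    ∫ x, (inner ℝ (f x) c : ℝ) ∂μ = inner ℝ (∫ x, f x ∂μ) c := by
  simp_rw [real_inner_comm c]
  exact integral_inner hf c

end Hilbert

/-! ### Density of test functions and weak convergence. -/

section Test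

variable {E : Type*} [NormedAddCommGroup E] [NormedSpace ℝ E] [FiniteDimensional ℝ E]
  [MeasurableSpace E] [BorelSpace E] {μ : Measure E} [IsFiniteMeasureOnCompacts μ]
  {Ω : Opens E} {F : Type*} [NormedAddCommGroup F] [InnerProductSpace ℝ F]

omit [FiniteDimensional ℝ E] [IsFiniteMeasureOnCompacts μ] in
theorem memLp_test (φ : 𝓓(Ω, F)) (p : ℝ≥0∞) {ν : Measure E} [IsFiniteMeasureOnCompacts ν] :
    MemLp φ p ν :=
  φ.continuous.memLp_of_hasCompactSupport φ.hasCompactSupport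

/-- Test functions form a dense subspace of `L²(Ω)`. -/
theorem exists_test_eLpNorm_sub_le [CompleteSpace F] {f : E → F} (hf : MemLp f 2 (μ.restrict Ω))
    {δ : ℝ≥0∞} (hδ : 0 < δ) :
    ∃ φ : 𝓓(Ω, F), eLpNorm (f - ⇑φ) 2 (μ.restrict Ω) ≤ δ := by
  let L : 𝓓(Ω, F) →ₗ[ℝ] Lp F 2 (μ.restrict Ω) :=
    { toFun := fun φ => (memLp_test φ 2).toLp φ
      map_add' := fun φ ψ => rfl
      map_smul' := fun c φ => rfl }
  have hbot : (LinearMap.range L)ᗮ = ⊥ := by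
    rw [eq_bot_iff]
    intro v hv
    rw [Submodule.mem_orthogonal'] at hv
    have hvm : MemLp v 2 (μ.restrict Ω) := Lp.memLp v
    have hloc : LocallyIntegrableOn v Ω μ := by
      intro x hx
      obtain ⟨K, hK, hxK, hKΩ⟩ := exists_compact_subset Ω.isOpen hx
      refine ⟨K, mem_nhdsWithin_of_mem_nhds (mem_interior_iff_mem_nhds.1 hxK), ?_⟩
      have : IsFiniteMeasure (μ.restrict K) := ⟨by simpa using hK.measure_lt_top⟩
      have h2 : MemLp v 2 (μ.restrict K) := hvm.mono_measure (Measure.restrict_mono hKΩ le_rfl)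
      exact h2.integrable one_le_two
    -- A vector orthogonal to all test fields vanishes by the fundamental lemma of the calculus of
    -- variations. That lemma uses scalar test functions `g`, so each component along `c` is tested
    -- with the field `g • c`.
    have h0 := Ω.isOpen.ae_eq_zero_of_integral_contDiff_smul_eq_zero hloc (by
      intro g hg hgc hgΩ
      have hint : Integrable (fun x => g x • v x) (μ.restrict Ω) := by
        have := MemLp.smul (r := 1) (p := 2) (q := 2) hvm
          ((hg.continuous.memLp_of_hasCompactSupport (μ := μ) hgc).restrict Ω)
        exact memLp_one_iff_integrable.1 this
      have key : ∫ x in Ω, g x • v x ∂μ = 0 := by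
        refine ext_inner_right ℝ fun c => ?_
        rw [inner_zero_left, ← inner_integral_left hint c]
        let φ : 𝓓(Ω, F) := ⟨fun x => g x • c, hg.smul contDiff_const, hgc.smul_right,
          (closure_mono (Function.support_smul_subset_left _ _)).trans hgΩ⟩
        have := hv (L φ) ⟨φ, rfl⟩
        have e : v = hvm.toLp v := (Lp.toLp_coeFn v hvm).symm
        rw [e] at this
        have h3 := (inner_toLp hvm (memLp_test (ν := μ.restrict Ω) φ 2)).symm.trans this
        refine Eq.trans (integral_congr_ae (.of_forall fun x => ?_)) h3
        change inner ℝ (g x • v x) c = inner ℝ (v x) (g x • c)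
        rw [inner_smul_left, inner_smul_right]; rfl
      rw [← key, setIntegral_eq_integral_of_forall_compl_eq_zero]
      intro x hx
      have : g x = 0 := by
        by_contra h
        exact hx (hgΩ (subset_tsupport g h))
      simp [this])
    have : v =ᵐ[μ.restrict Ω] 0 := by
      rw [Filter.EventuallyEq, ae_restrict_iff' Ω.isOpen.measurableSet]
      exact h0
    exact (Lp.eq_zero_iff_ae_eq_zero).2 this
  have hd : Dense (LinearMap.range L : Set (Lp F 2 (μ.restrict Ω))) := by
    rw [Submodule.dense_iff_topologicalClosure_eq_top, Submodule.topologicalClosure_eq_top_iff]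
    exact hbot
  obtain ⟨_, hy, φ, rfl⟩ := hd.inter_open_nonempty _ (Metric.isOpen_eball (x := hf.toLp f) (ε := δ))
    ⟨_, Metric.mem_eball_self hδ⟩
  refine ⟨φ, ?_⟩
  rw [Metric.mem_eball, edist_comm] at hy
  have := Lp.edist_toLp_toLp f φ hf (memLp_test φ 2)
  exact (this.symm.trans_lt hy).le

/-- Converse of Cauchy-Schwarz on a dense set: pairing `f` with a test function close to `f` itself
recovers `‖f‖²`. It gives `L²` bounds on quantities known only through duality, such as increments
of a weakly differentiable field. -/
theorem eLpNorm_le_of_test [CompleteSpace F] {f : E → F} (hf : MemLp f 2 (μ.restrict Ω)) {A : ℝ≥0∞}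
    (h : ∀ φ : 𝓓(Ω, F), ‖∫ x in Ω, (inner ℝ (f x) (φ x) : ℝ) ∂μ‖ₑ
      ≤ A * eLpNorm (⇑φ) 2 (μ.restrict Ω)) :
    eLpNorm f 2 (μ.restrict Ω) ≤ A := by
  set N := eLpNorm f 2 (μ.restrict Ω) with hN
  rcases eq_or_ne A ∞ with rfl | hA
  · exact le_top
  rcases eq_or_ne N 0 with h0 | h0
  · rw [h0]; exact zero_le
  have hNt : N ≠ ∞ := hf.2.ne
  have key : N * N ≤ A * N := by
    refine ENNReal.le_of_forall_pos_le_add fun δ hδ _ => ?_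
    -- The approximation error enters once multiplied by `A`, through the norm of `φ`, and once
    -- multiplied by `N`, through the pairing with `f`.
    have hc : (0 : ℝ≥0∞) < δ / (A + N) :=
      ENNReal.div_pos (by simpa using hδ.ne') (by simp [hA, hNt])
    obtain ⟨φ, hφ⟩ := exists_test_eLpNorm_sub_le hf hc
    have hφm := memLp_test (ν := μ.restrict Ω) φ 2
    have e : ‖∫ x in Ω, (inner ℝ (f x) (f x) : ℝ) ∂μ‖ₑ = N * N := by
      rw [← inner_toLp hf hf, real_inner_self_eq_norm_sq, Lp.norm_toLp, ← pow_two, enorm_pow,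
        ← ofReal_norm, Real.norm_of_nonneg ENNReal.toReal_nonneg, ENNReal.ofReal_toReal hNt]
    have e2 : ∫ x in Ω, (inner ℝ (f x) (f x) : ℝ) ∂μ =
        ∫ x in Ω, (inner ℝ (f x) (φ x) : ℝ) ∂μ + ∫ x in Ω, (inner ℝ (f x) ((f - ⇑φ) x) : ℝ) ∂μ := by
      rw [← integral_add (integrable_inner hf hφm) (integrable_inner hf (hf.sub hφm))]
      simp [inner_sub_right]
    have hφn : eLpNorm (⇑φ) 2 (μ.restrict Ω) ≤ N + δ / (A + N) := by
      have : ⇑φ = f - (f - ⇑φ) := by simp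
      rw [this]
      exact (eLpNorm_sub_le hf.1 (hf.1.sub hφm.1) one_le_two).trans (by gcongr)
    rw [← e, e2]
    calc _ ≤ A * (N + δ / (A + N)) + N * (δ / (A + N)) := by
          refine (enorm_add_le _ _).trans (add_le_add ((h φ).trans (by gcongr)) ?_)
          exact (enorm_integral_inner_le hf.1 (hf.1.sub hφm.1)).trans (by gcongr)
      _ = A * N + (A + N) * (δ / (A + N)) := by ring
      _ ≤ A * N + δ := by gcongr; exact ENNReal.mul_div_le
  exact (ENNReal.mul_le_mul_iff_left h0 hNt).1 key

/-- A bounded sequence in `L²(Ω)` which converges in the sense of distributions converges weakly. -/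
theorem tendsto_integral_inner_of_test [CompleteSpace F] {ι : Type*} {l : Filter ι} {f : ι → E → F}
    {f₀ g : E → F} {C : ℝ≥0} (hf : ∀ᶠ i in l, MemLp (f i) 2 (μ.restrict Ω))
    (hC : ∀ᶠ i in l, eLpNorm (f i) 2 (μ.restrict Ω) ≤ C) (hf₀ : MemLp f₀ 2 (μ.restrict Ω))
    (h : ∀ φ : 𝓓(Ω, F), Tendsto (fun i => ∫ x in Ω, (inner ℝ (f i x) (φ x) : ℝ) ∂μ) l
      (𝓝 (∫ x in Ω, (inner ℝ (f₀ x) (φ x) : ℝ) ∂μ)))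
    (hg : MemLp g 2 (μ.restrict Ω)) :
    Tendsto (fun i => ∫ x in Ω, (inner ℝ (f i x) (g x) : ℝ) ∂μ) l
      (𝓝 (∫ x in Ω, (inner ℝ (f₀ x) (g x) : ℝ) ∂μ)) := by
  rw [EMetric.tendsto_nhds]
  intro ε hε
  set N := eLpNorm f₀ 2 (μ.restrict Ω)
  have hN : N ≠ ∞ := hf₀.2.ne
  have hc : (0 : ℝ≥0∞) < ε / 3 / (C + N + 1) := by
    refine ENNReal.div_pos (ENNReal.div_pos hε.ne' (by norm_num)).ne' (by simp [hN])
  obtain ⟨φ, hφ⟩ := exists_test_eLpNorm_sub_le hg hc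
  have hφm := memLp_test (ν := μ.restrict Ω) φ 2
  rcases eq_or_ne ε ∞ with rfl | hε'
  · exact .of_forall fun i => by simp [edist_lt_top]
  have h3 : 0 < ε / 3 := ENNReal.div_pos hε.ne' (by norm_num)
  filter_upwards [hf, hC, EMetric.tendsto_nhds.1 (h φ) _ h3] with i h1 h2 h4
  have sp : ∀ {u : E → F}, MemLp u 2 (μ.restrict Ω) →
      edist (∫ x in Ω, (inner ℝ (u x) (g x) : ℝ) ∂μ) (∫ x in Ω, (inner ℝ (u x) (φ x) : ℝ) ∂μ)
        ≤ eLpNorm u 2 (μ.restrict Ω) * (ε / 3 / (C + N + 1)) := by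
    intro u hu
    rw [edist_eq_enorm_sub, ← integral_sub (integrable_inner hu hg) (integrable_inner hu hφm)]
    simp_rw [← inner_sub_right]
    exact (enorm_integral_inner_le hu.1 (hg.1.sub hφm.1)).trans (by gcongr)
  have hs : ∀ {a : ℝ≥0∞}, a ≤ C + N + 1 → a * (ε / 3 / (C + N + 1)) ≤ ε / 3 := fun ha =>
    (mul_le_mul_left ha _).trans ENNReal.mul_div_le
  calc _ ≤ edist (∫ x in Ω, (inner ℝ (f i x) (g x) : ℝ) ∂μ) (∫ x in Ω, (inner ℝ (f i x) (φ x) : ℝ) ∂μ)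
        + edist (∫ x in Ω, (inner ℝ (f i x) (φ x) : ℝ) ∂μ) (∫ x in Ω, (inner ℝ (f₀ x) (φ x) : ℝ) ∂μ)
        + edist (∫ x in Ω, (inner ℝ (f₀ x) (φ x) : ℝ) ∂μ) (∫ x in Ω, (inner ℝ (f₀ x) (g x) : ℝ) ∂μ) :=
        edist_triangle4 _ _ _ _
    _ < ε / 3 + ε / 3 + ε / 3 := by
        have a1 := (sp h1).trans (hs (h2.trans (le_add_right (le_add_right le_rfl))))
        have a2 := (sp hf₀).trans (hs (le_add_right le_add_self))
        rw [edist_comm] at a2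
        have hne : ε / 3 ≠ ∞ := (ENNReal.div_lt_top hε' (by norm_num)).ne
        exact ENNReal.add_lt_add_of_lt_of_le (by exact (a2.trans_lt hne.lt_top).ne)
          (ENNReal.add_lt_add_of_le_of_lt (a1.trans_lt hne.lt_top).ne a1 h4) a2
    _ = ε := ENNReal.add_thirds ε

end Test

/-! ### Increments in space are controlled by the weak gradient. -/

section Translation

variable {T : ℝ} {F : Type*} [NormedAddCommGroup F] [InnerProductSpace ℝ F]

theorem stMeasure_eq_prod (T : ℝ) :
    stMeasure T = (volume.restrict (Ioo 0 T)).prod (volume : Measure E3) := by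
  have h := Measure.prod_restrict (μ := (volume : Measure ℝ)) (ν := (volume : Measure E3))
    (Ioo 0 T) univ
  rw [Measure.restrict_univ] at h
  exact h.symm

theorem continuous_spaceDeriv {φ : ST → F} (hφ : ContDiff ℝ (⊤ : ℕ∞) φ) (i : Fin 3) :
    Continuous (spaceDeriv i φ) :=
  (hφ.continuous_fderiv (by simp)).clm_apply continuous_const

theorem hasCompactSupport_spaceDeriv {φ : ST → F} (hφ : HasCompactSupport φ) (i : Fin 3) :
    HasCompactSupport (spaceDeriv i φ) :=
  hφ.fderiv_apply (𝕜 := ℝ) _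

theorem memLp_spaceDeriv {Ω : Opens ST} (φ : 𝓓(Ω, F)) (i : Fin 3) (p : ℝ≥0∞) (μ : Measure ST)
    [IsFiniteMeasureOnCompacts μ] : MemLp (spaceDeriv i φ) p μ :=
  (continuous_spaceDeriv φ.contDiff i).memLp_of_hasCompactSupport
    (hasCompactSupport_spaceDeriv φ.hasCompactSupport i)

instance : IsFiniteMeasureOnCompacts (stMeasure T) := by unfold stMeasure; infer_instance

theorem integrable_smul {α : Type*} {m : MeasurableSpace α} {μ : Measure α} {f : α → ℝ} {g : α → F}
    (hf : MemLp f 2 μ) (hg : MemLp g 2 μ) : Integrable (fun x => f x • g x) μ :=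
  memLp_one_iff_integrable.1 (MemLp.smul (r := 1) (p := 2) (q := 2) hg hf)

/-- The weak gradient, tested with vector valued test functions. -/
theorem HasWeakGrad.integral_inner [FiniteDimensional ℝ F] {f : ST → F} {G : Fin 3 → ST → F}
    (h : HasWeakGrad T f G) (hf : MemLp f 2 (stMeasure T)) (hG : ∀ i, MemLp (G i) 2 (stMeasure T))
    (i : Fin 3) (φ : 𝓓(slab T, F)) :
    ∫ z, (inner ℝ (f z) (spaceDeriv i φ z) : ℝ) ∂(stMeasure T)
      = - ∫ z, (inner ℝ (G i z) (φ z) : ℝ) ∂(stMeasure T) := by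
  have : CompleteSpace F := FiniteDimensional.complete ℝ F
  let b := stdOrthonormalBasis ℝ F
  -- Weak gradients are defined with scalar test functions, so the vector-valued one is expanded in
  -- an orthonormal basis.
  let ψ : Fin (Module.finrank ℝ F) → 𝓓(slab T, ℝ) := fun k =>
    ⟨fun z => inner ℝ (b k) (φ z), contDiff_const.inner ℝ φ.contDiff,
      φ.hasCompactSupport.comp_left (g := fun y => (inner ℝ (b k) y : ℝ)) (inner_zero_right _),
      (closure_mono fun z hz => by
        contrapose! hz
        simp only [Function.mem_support, not_not] at hz
        simp [hz]).trans φ.tsupport_subset⟩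
  have hψ : ∀ k z, ψ k z = inner ℝ (b k) (φ z) := fun _ _ => rfl
  have hdψ : ∀ k z, spaceDeriv i (ψ k) z = inner ℝ (b k) (spaceDeriv i φ z) := by
    intro k z
    have h1 : HasFDerivAt φ (fderiv ℝ φ z) z :=
      (φ.contDiff.differentiable (by simp) z).hasFDerivAt
    have h2 := ((innerSL ℝ (b k)).hasFDerivAt.comp z h1).fderiv
    change fderiv ℝ (ψ k) z _ = _
    change fderiv ℝ (ψ k) z = _ at h2
    rw [h2]; rfl
  have key : ∀ k, ∫ z, (inner ℝ (f z) (b k) * inner ℝ (b k) (spaceDeriv i φ z) : ℝ) ∂(stMeasure T)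
      = - ∫ z, (inner ℝ (G i z) (b k) * inner ℝ (b k) (φ z) : ℝ) ∂(stMeasure T) := by
    intro k
    have h1 := congrArg (fun v => (inner ℝ v (b k) : ℝ)) (h i (ψ k))
    simp only [inner_neg_left] at h1
    rw [← inner_integral_left (integrable_smul (memLp_spaceDeriv _ _ _ _) hf),
      ← inner_integral_left (integrable_smul (memLp_test _ _) (hG i))] at h1
    simp only [inner_smul_left, hdψ, hψ] at h1
    simpa [mul_comm] using h1
  have e : ∀ {u v : ST → F}, MemLp u 2 (stMeasure T) → MemLp v 2 (stMeasure T) →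
      ∫ z, (inner ℝ (u z) (v z) : ℝ) ∂(stMeasure T)
        = ∑ k, ∫ z, (inner ℝ (u z) (b k) * inner ℝ (b k) (v z) : ℝ) ∂(stMeasure T) := by
    intro u v hu hv
    rw [← integral_finsetSum]
    · simp_rw [b.sum_inner_mul_inner]
    · intro k _
      exact (hu.inner_const (b k)).integrable_mul (hv.const_inner (b k))
  rw [e hf (memLp_spaceDeriv _ _ _ _), e (hG i) (memLp_test _ _), ← Finset.sum_neg_distrib]
  exact Finset.sum_congr rfl fun k _ => key k

instance : (volume : Measure ST).IsAddRightInvariant :=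
  inferInstanceAs ((volume : Measure ℝ).prod (volume : Measure E3)).IsAddRightInvariant

theorem measurePreserving_space_add (T : ℝ) (h : E3) :
    MeasurePreserving (fun z : ST => z + (0, h)) (stMeasure T) (stMeasure T) := by
  have h1 := (measurePreserving_add_right (volume : Measure ST) (0, h)).restrict_preimage
    (slab T).isOpen.measurableSet
  have h2 : (fun z : ST => z + (0, h)) ⁻¹' (slab T : Set ST) = slab T := by
    ext ⟨t, x⟩; simp [slab]
  rwa [h2] at h1

/-- The translation in space of a test function on the slab. -/
noncomputable def spaceShift (h : E3) (φ : 𝓓(slab T, F)) : 𝓓(slab T, F) :=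
  ⟨fun z => φ (z + (0, h)), φ.contDiff.comp (contDiff_id.add contDiff_const),
    φ.hasCompactSupport.comp_homeomorph (Homeomorph.addRight ((0, h) : ST)), by
      intro z hz
      have := tsupport_comp_subset_preimage φ (f := fun z : ST => z + (0, h)) (by fun_prop) hz
      have := φ.tsupport_subset this
      obtain ⟨t, x⟩ := z
      simpa [slab] using this⟩

theorem spaceDeriv_sum (φ : ST → F) (z : ST) (h : E3) :
    fderiv ℝ φ z (0, h) = ∑ i, h i • spaceDeriv i φ z := by
  have : ((0, h) : ST) = ∑ i, h i • ((0, EuclideanSpace.single i 1) : ST) := by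
    ext i
    · simp [Prod.fst_sum]
    · fin_cases i <;> simp [Fin.sum_univ_three]
  conv_lhs => rw [this]
  rw [map_sum]
  exact Finset.sum_congr rfl fun i _ => by rw [map_smul]; rfl

theorem spaceDeriv_spaceShift (h : E3) (φ : 𝓓(slab T, F)) (i : Fin 3) (z : ST) :
    spaceDeriv i (spaceShift h φ) z = spaceDeriv i φ (z + (0, h)) := by
  change fderiv ℝ (fun z => φ (z + (0, h))) z _ = _
  rw [fderiv_comp_add_right]; rfl

/-- The shift acts on the smooth factor only, so the derivative passes under the integral although
`f` itself is merely in `L²`. -/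
theorem hasDerivAt_integral_spaceShift {f : ST → F} (hf : MemLp f 2 (stMeasure T)) (h : E3)
    (φ : 𝓓(slab T, F)) (s₀ : ℝ) :
    HasDerivAt (fun s : ℝ => ∫ z, (inner ℝ (f z) (spaceShift (s • h) φ z) : ℝ) ∂(stMeasure T))
      (∫ z, (inner ℝ (f z) (fderiv ℝ φ (z + (0, s₀ • h)) (0, h)) : ℝ) ∂(stMeasure T)) s₀ := by
  -- The compact set swept by the supports of all shifts with `|s - s₀| ≤ 1`; the dominating
  -- function lives on it.
  let K : Set ST := (fun p : ST × ℝ => p.1 - (0, p.2 • h)) '' (tsupport φ ×ˢ Icc (s₀ - 1) (s₀ + 1))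
  have hK : IsCompact K := (IsCompact.prod φ.hasCompactSupport isCompact_Icc).image (by fun_prop)
  obtain ⟨B, hB⟩ := (φ.contDiff.continuous_fderiv (by simp)).bounded_above_of_compact_support
    (φ.hasCompactSupport.fderiv ℝ)
  have hB0 : 0 ≤ B := (norm_nonneg _).trans (hB 0)
  have hcd : Continuous fun z : ST => fderiv ℝ φ (z + (0, s₀ • h)) (0, h) :=
    ((φ.contDiff.continuous_fderiv (by simp)).comp (by fun_prop)).clm_apply continuous_const
  have hind : MemLp (K.indicator fun _ : ST => B * ‖((0, h) : ST)‖) 2 (stMeasure T) :=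
    memLp_indicator_const _ hK.measurableSet _ (.inr hK.measure_lt_top.ne)
  refine (hasDerivAt_integral_of_dominated_loc_of_deriv_le
    (F' := fun s z => (inner ℝ (f z) (fderiv ℝ φ (z + (0, s • h)) (0, h)) : ℝ))
    (bound := fun z => ‖f z‖ * K.indicator (fun _ => B * ‖((0, h) : ST)‖) z)
    (Ioo_mem_nhds (sub_one_lt s₀) (lt_add_one s₀)) ?_ ?_ ?_ ?_ ?_ ?_).2
  · exact .of_forall fun s => (integrable_inner hf (memLp_test _ 2)).1
  · exact integrable_inner hf (memLp_test _ 2)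
  · exact hf.1.inner hcd.aestronglyMeasurable
  · refine .of_forall fun z s hs => (norm_inner_le_norm _ _).trans ?_
    gcongr
    by_cases hz : z + (0, s • h) ∈ tsupport φ
    · rw [indicator_of_mem]
      · exact (ContinuousLinearMap.le_opNorm _ _).trans (by gcongr; exact hB _)
      · exact ⟨(_, s), ⟨hz, Ioo_subset_Icc_self hs⟩, by simp⟩
    · have : fderiv ℝ φ (z + (0, s • h)) = 0 := by
        by_contra hne
        exact hz (support_fderiv_subset ℝ hne)
      rw [this]
      simpa using indicator_nonneg (s := K) (fun _ _ => mul_nonneg hB0 (norm_nonneg _)) z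
  · exact (hf.norm).integrable_mul hind
  · refine .of_forall fun z s _ => ?_
    have h1 : HasFDerivAt φ (fderiv ℝ φ (z + (0, s • h))) (z + (0, s • h)) :=
      (φ.contDiff.differentiable (by simp) _).hasFDerivAt
    have h2 : HasDerivAt (fun s : ℝ => z + ((0 : ℝ), s • h)) ((0 : ℝ), h) s := by
      have := ((hasDerivAt_id s).smul_const ((0 : ℝ), h)).const_add z
      simpa using this
    have h3 := h1.comp_hasDerivAt s h2
    have h4 := ((innerSL ℝ (f z)).hasFDerivAt.comp_hasDerivAt s h3)
    exact h4

/-- The `L²` norm of a translation increment is controlled by the gradient. -/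
theorem eLpNorm_translate_sub_le [FiniteDimensional ℝ F] {f : ST → F} {G : Fin 3 → ST → F}
    (hf : MemLp f 2 (stMeasure T)) (hG : ∀ i, MemLp (G i) 2 (stMeasure T))
    (hw : HasWeakGrad T f G) (h : E3) :
    eLpNorm (fun z => f (z.1, z.2 - h) - f z) 2 (stMeasure T)
      ≤ ‖h‖ₑ * ∑ i, eLpNorm (G i) 2 (stMeasure T) := by
  have : CompleteSpace F := FiniteDimensional.complete ℝ F
  have hmp := measurePreserving_space_add T (-h)
  have e1 : (fun z : ST => f (z.1, z.2 - h)) = f ∘ fun z => z + (0, -h) := by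
    ext ⟨t, x⟩; simp [sub_eq_add_neg]
  have hfs : MemLp (fun z : ST => f (z.1, z.2 - h)) 2 (stMeasure T) := by
    rw [e1]; exact hf.comp_measurePreserving hmp
  refine eLpNorm_le_of_test (Ω := slab T) (μ := volume) (hfs.sub hf) fun φ => ?_
  change ‖∫ z, inner ℝ (f (z.1, z.2 - h) - f z) (φ z) ∂(stMeasure T)‖ₑ
    ≤ _ * eLpNorm φ 2 (stMeasure T)
  -- A change of variables moves the translation from `f` to `φ`, so the tested increment is `Φ 1 -
  -- Φ 0`. The weak gradient turns `Φ'` into pairings with `G`, bounded independently of `s`, and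
  -- the mean value inequality concludes.
  set Φ : ℝ → ℝ := fun s => ∫ z, (inner ℝ (f z) (spaceShift (s • h) φ z) : ℝ) ∂(stMeasure T)
  have hφ2 : MemLp φ 2 (stMeasure T) := memLp_test _ _
  have e2 : ∫ z, inner ℝ (f (z.1, z.2 - h) - f z) (φ z) ∂(stMeasure T) = Φ 1 - Φ 0 := by
    simp_rw [inner_sub_left]
    rw [integral_sub (integrable_inner hfs hφ2) (integrable_inner hf hφ2)]
    congr 1
    · have := (measurePreserving_space_add T h).integral_comp
        (MeasurableEquiv.addRight ((0, h) : ST)).measurableEmbedding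
        (fun z => (inner ℝ (f (z.1, z.2 - h)) (φ z) : ℝ))
      rw [← this]
      simp [Φ, spaceShift]
    · refine integral_congr_ae (.of_forall fun z => ?_)
      change inner ℝ (f z) (φ z) = inner ℝ (f z) (φ (z + (0, (0 : ℝ) • h)))
      rw [zero_smul, ← Prod.zero_eq_mk, add_zero]
  set C : ℝ := ‖h‖ * ∑ i, (eLpNorm (G i) 2 (stMeasure T)).toReal * (eLpNorm φ 2 (stMeasure T)).toReal
  have hd := hasDerivAt_integral_spaceShift hf h φ
  have hbound : ∀ s : ℝ,
      ‖∫ z, (inner ℝ (f z) (fderiv ℝ φ (z + (0, s • h)) (0, h)) : ℝ) ∂(stMeasure T)‖ ≤ C := by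
    intro s
    have e3 : ∫ z, (inner ℝ (f z) (fderiv ℝ φ (z + (0, s • h)) (0, h)) : ℝ) ∂(stMeasure T)
        = ∑ i, h i * - ∫ z, (inner ℝ (G i z) (spaceShift (s • h) φ z) : ℝ) ∂(stMeasure T) := by
      simp_rw [← hw.integral_inner hf hG, spaceDeriv_spaceShift, ← integral_const_mul]
      rw [← integral_finsetSum]
      · simp_rw [spaceDeriv_sum, inner_sum, inner_smul_right]
      · intro i _
        refine Integrable.const_mul ?_ _
        simp_rw [← spaceDeriv_spaceShift]
        exact integrable_inner hf (memLp_spaceDeriv _ _ _ _)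
    rw [e3]
    simp only [C]
    rw [Finset.mul_sum]
    refine norm_sum_le_of_le _ fun i _ => ?_
    rw [norm_mul, norm_neg]
    gcongr
    · exact PiLp.norm_apply_le h i
    · have h1 := enorm_integral_inner_le (hG i).1
        (memLp_test (ν := stMeasure T) (spaceShift (s • h) φ) 2).1
      have h2 : eLpNorm (spaceShift (s • h) φ) 2 (stMeasure T) = eLpNorm φ 2 (stMeasure T) :=
        eLpNorm_comp_measurePreserving hφ2.1 (measurePreserving_space_add T (s • h))
      rw [h2] at h1
      have := ENNReal.toReal_mono (ENNReal.mul_ne_top (hG i).2.ne hφ2.2.ne) h1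
      rwa [ENNReal.toReal_mul, toReal_enorm] at this
  have hfin := Convex.norm_image_sub_le_of_norm_hasDerivWithin_le (s := univ) (x := (0 : ℝ))
    (y := (1 : ℝ)) (fun s _ => (hd s).hasDerivWithinAt) (fun s _ => hbound s) convex_univ
    trivial trivial
  rw [e2]
  have h4 : ‖Φ 1 - Φ 0‖ₑ ≤ ENNReal.ofReal C := by
    rw [← ofReal_norm]; exact ENNReal.ofReal_le_ofReal (by simpa only [sub_zero, norm_one, mul_one] using hfin)
  refine h4.trans_eq ?_
  simp only [C]
  rw [← Finset.sum_mul, ENNReal.ofReal_mul (norm_nonneg _), ofReal_norm,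
    ENNReal.ofReal_mul (Finset.sum_nonneg fun _ _ => ENNReal.toReal_nonneg),
    ENNReal.ofReal_sum_of_nonneg (fun _ _ => ENNReal.toReal_nonneg),
    ENNReal.ofReal_toReal hφ2.2.ne, mul_assoc]
  simp_rw [ENNReal.ofReal_toReal (hG _).2.ne]

end Translation

/-! ### Convolution estimates and local compactness in `L²(ℝ³)`. -/

section Mollification

set_option linter.unusedSectionVars false

variable {F : Type*} [NormedAddCommGroup F] [InnerProductSpace ℝ F]

theorem ENNReal_add_sq_le (a b : ℝ≥0∞) : (a + b) ^ 2 ≤ 2 * a ^ 2 + 2 * b ^ 2 := by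
  have h := ENNReal.rpow_add_le_mul_rpow_add_rpow a b (p := 2) one_le_two
  norm_num at h
  rwa [mul_add] at h

/-- Cauchy-Schwarz for the weight `|k|`, after the splitting `|k||g| = |k|^(1/2) · |k|^(1/2)|g|`. -/
theorem enorm_integral_smul_sq_le {α : Type*} {m : MeasurableSpace α} {μ : Measure α}
    {k : α → ℝ} {g : α → F} (hk : AEStronglyMeasurable k μ)
    (hg : AEStronglyMeasurable g μ) :
    ‖∫ y, k y • g y ∂μ‖ₑ ^ 2 ≤ (∫⁻ y, ‖k y‖ₑ ∂μ) * ∫⁻ y, ‖k y‖ₑ * ‖g y‖ₑ ^ 2 ∂μ := by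
  have e : ∀ a : ℝ≥0∞, (a ^ (1 / 2 : ℝ)) ^ 2 = a := fun a => by
    rw [← ENNReal.rpow_natCast, ← ENNReal.rpow_mul]; norm_num
  have h := lintegral_mul_le_sqrt (μ := μ) (f := fun y => ‖k y‖ₑ ^ (1 / 2 : ℝ))
    (g := fun y => ‖k y‖ₑ ^ (1 / 2 : ℝ) * ‖g y‖ₑ) (hk.enorm.pow_const _)
    ((hk.enorm.pow_const _).mul hg.enorm)
  simp only [← mul_assoc, ← pow_two, mul_pow, e] at h
  refine le_trans (pow_le_pow_left₀ zero_le ((enorm_integral_le_lintegral_enorm _).trans ?_) 2) h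
  exact lintegral_mono fun y => (enorm_smul _ _).le

/-- Weighted Cauchy-Schwarz for each `x`, then Tonelli. With `g x y = f (x - y)` it yields Young's
inequality, with `g x h = f (x - h) - f x` the mollification error. -/
theorem lintegral_enorm_integral_smul_sq_le {k : E3 → ℝ} {g : E3 → E3 → F} (hk : Continuous k)
    (hg : AEStronglyMeasurable (Function.uncurry g) (volume.prod volume)) :
    ∫⁻ x, ‖∫ y, k y • g x y‖ₑ ^ 2 ≤ (∫⁻ y, ‖k y‖ₑ) * ∫⁻ y, ‖k y‖ₑ * ∫⁻ x, ‖g x y‖ₑ ^ 2 := by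
  have h1 : AEMeasurable (Function.uncurry fun x y => ‖k y‖ₑ * ‖g x y‖ₑ ^ 2)
      ((volume : Measure E3).prod volume) :=
    (hk.comp continuous_snd).enorm.measurable.aemeasurable.mul (hg.enorm.pow_const 2)
  calc _ ≤ ∫⁻ x, (∫⁻ y, ‖k y‖ₑ) * ∫⁻ y, ‖k y‖ₑ * ‖g x y‖ₑ ^ 2 := by
        refine lintegral_mono_ae ?_
        filter_upwards [hg.prodMk_left] with x hx
        exact enorm_integral_smul_sq_le hk.aestronglyMeasurable hx
    _ = (∫⁻ y, ‖k y‖ₑ) * ∫⁻ y, ∫⁻ x, ‖k y‖ₑ * ‖g x y‖ₑ ^ 2 := by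
        rw [lintegral_const_mul'' (f := fun x => ∫⁻ y, ‖k y‖ₑ * ‖g x y‖ₑ ^ 2) _ h1.lintegral_prod_right',
          lintegral_lintegral_swap h1]
    _ = _ := by
        congr 1
        refine lintegral_congr_ae ?_
        filter_upwards [hg.prod_swap.prodMk_left] with y hy
        exact lintegral_const_mul'' _ (hy.enorm.pow_const 2)

/-- The convolution of `k` and `f` on `ℝ³`. -/
noncomputable def mollify (k : E3 → ℝ) (f : E3 → F) (x : E3) : F := ∫ y, k y • f (x - y)

theorem mollify_eq_convolution (k : E3 → ℝ) (f : E3 → F) :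
    mollify k f = convolution k f (ContinuousLinearMap.lsmul ℝ ℝ) volume := rfl

theorem mollify_eq_swap (k : E3 → ℝ) (f : E3 → F) (x : E3) :
    mollify k f x = ∫ z, k (x - z) • f z := by
  rw [mollify, ← integral_sub_left_eq_self _ volume x]
  simp

theorem quasiMeasurePreserving_sub : Measure.QuasiMeasurePreserving
    (fun p : E3 × E3 => p.1 - p.2) (volume.prod volume) volume :=
  quasiMeasurePreserving_sub_of_right_invariant _ _

theorem memLp_sub_left {f : E3 → F} {p : ℝ≥0∞} (hf : MemLp f p volume) (x : E3) :
    MemLp (fun y => f (x - y)) p volume :=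
  hf.comp_measurePreserving (Measure.measurePreserving_sub_left volume x)

theorem memLp_sub_right {f : E3 → F} {p : ℝ≥0∞} (hf : MemLp f p volume) (x : E3) :
    MemLp (fun y => f (y - x)) p volume :=
  hf.comp_measurePreserving (measurePreserving_sub_right volume x)

theorem eLpNorm_sub_left {f : E3 → F} (hf : AEStronglyMeasurable f volume) (x : E3) (p : ℝ≥0∞) :
    eLpNorm (fun y => f (x - y)) p volume = eLpNorm f p volume :=
  eLpNorm_comp_measurePreserving hf (Measure.measurePreserving_sub_left volume x)

theorem eLpNorm_sub_right {f : E3 → F} (hf : AEStronglyMeasurable f volume) (x : E3) (p : ℝ≥0∞) :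
    eLpNorm (fun y => f (y - x)) p volume = eLpNorm f p volume :=
  eLpNorm_comp_measurePreserving hf (measurePreserving_sub_right volume x)

theorem aestronglyMeasurable_mollify {k : E3 → ℝ} {f : E3 → F} (hk : Continuous k)
    (hf : AEStronglyMeasurable f volume) : AEStronglyMeasurable (mollify k f) volume :=
  AEStronglyMeasurable.integral_prod_right' (f := fun p : E3 × E3 => k p.2 • f (p.1 - p.2))
    ((hk.comp continuous_snd).aestronglyMeasurable.smul
      (hf.comp_quasiMeasurePreserving quasiMeasurePreserving_sub))

/-- Young's inequality. -/
theorem eLpNorm_mollify_le {k : E3 → ℝ} {f : E3 → F} (hk : Continuous k) (hf : MemLp f 2 volume) :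
    eLpNorm (mollify k f) 2 volume ≤ (∫⁻ y, ‖k y‖ₑ) * eLpNorm f 2 volume := by
  refine (ENNReal.pow_le_pow_left_iff two_ne_zero).1 ?_
  rw [eLpNorm_two_sq]
  refine (lintegral_enorm_integral_smul_sq_le (g := fun x y => f (x - y)) hk
    (hf.1.comp_quasiMeasurePreserving quasiMeasurePreserving_sub)).trans_eq ?_
  have : ∀ y, ∫⁻ x, ‖f (x - y)‖ₑ ^ 2 = eLpNorm f 2 volume ^ 2 := fun y => by
    rw [← eLpNorm_two_sq, eLpNorm_sub_right hf.1]
  simp_rw [this]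
  rw [lintegral_mul_const _ hk.enorm.measurable]
  ring

theorem enorm_mollify_le {k : E3 → ℝ} {f : E3 → F} (hk : MemLp k 2 volume)
    (hf : AEStronglyMeasurable f volume) (x : E3) :
    ‖mollify k f x‖ₑ ≤ eLpNorm k 2 volume * eLpNorm f 2 volume := by
  rw [mollify_eq_swap]
  refine (enorm_integral_le_lintegral_enorm _).trans ?_
  simp_rw [enorm_smul]
  refine (lintegral_enorm_mul_le (memLp_sub_left hk x).1 hf).trans_eq ?_
  rw [eLpNorm_sub_left hk.1]

/-- The modulus of continuity depends on `f` only through its norm: mollifications of a bounded set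
are equicontinuous. This is what allows finitely many points to control a compact set. -/
theorem enorm_mollify_sub_le {k : E3 → ℝ} {f : E3 → F} (hk : MemLp k 2 volume)
    (hf : MemLp f 2 volume) (x y : E3) :
    ‖mollify k f x - mollify k f y‖ₑ
      ≤ eLpNorm (fun w => k (w - (x - y)) - k w) 2 volume * eLpNorm f 2 volume := by
  have hs : AEStronglyMeasurable (fun w => k (w - (x - y)) - k w) volume :=
    (memLp_sub_right hk _).1.sub hk.1
  rw [mollify_eq_swap, mollify_eq_swap, ← integral_sub (integrable_smul (memLp_sub_left hk x) hf)
    (integrable_smul (memLp_sub_left hk y) hf)]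
  simp_rw [← sub_smul]
  refine (enorm_integral_le_lintegral_enorm _).trans ?_
  simp_rw [enorm_smul]
  refine (lintegral_enorm_mul_le ((memLp_sub_left hk x).1.sub (memLp_sub_left hk y).1)
    hf.1).trans_eq ?_
  rw [← eLpNorm_sub_left hs x]
  congr 1
  rw [← eLpNorm_neg]
  congr 1
  ext z
  simp only [Pi.neg_apply, neg_sub, Pi.sub_apply]
  congr 2
  abel

theorem tendsto_eLpNorm_translate_sub {f : E3 → F} (hf : MemLp f 2 volume) :
    Tendsto (fun h : E3 => eLpNorm (fun x => f (x - h) - f x) 2 volume) (𝓝 0) (𝓝 0) := by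
  let g : E3 → C(E3, E3) := fun h => ⟨fun x => x - h, by fun_prop⟩
  have hg : Continuous g := by
    refine ContinuousMap.continuous_of_continuous_uncurry _ ?_
    change Continuous fun p : E3 × E3 => p.2 - p.1
    fun_prop
  have hgm : ∀ h, MeasurePreserving (g h) volume volume := fun h =>
    measurePreserving_sub_right volume h
  have h1 := (continuous_const (y := hf.toLp f)).compMeasurePreservingLp hg hgm (by norm_num)
  have h2 := (h1.tendsto 0).edist (tendsto_const_nhds (x := hf.toLp f))
  have e0 : Lp.compMeasurePreserving (g 0) (hgm 0) (hf.toLp f) = hf.toLp f := by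
    rw [Lp.toLp_compMeasurePreserving]
    congr 1
    ext x
    simp [g]
  rw [e0, edist_self] at h2
  refine h2.congr fun h => ?_
  rw [Lp.toLp_compMeasurePreserving, Lp.edist_toLp_toLp]
  rfl

/-- The `L²` distance of a function to its mollification, in terms of translation increments. -/
theorem lintegral_mollify_sub_sq_le {k : E3 → ℝ} {f : E3 → F} (hk : Continuous k)
    (hk2 : MemLp k 2 volume) (hk0 : ∀ x, 0 ≤ k x) (hk1 : ∫ x, k x = 1) (hf : MemLp f 2 volume)
    [CompleteSpace F] :
    ∫⁻ x, ‖mollify k f x - f x‖ₑ ^ 2 ≤ ∫⁻ h, ‖k h‖ₑ * ∫⁻ x, ‖f (x - h) - f x‖ₑ ^ 2 := by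
  have hki : Integrable k := by
    by_contra h
    rw [integral_undef h] at hk1
    exact zero_ne_one hk1
  have h1 : ∫⁻ y, ‖k y‖ₑ = 1 := by
    rw [← ofReal_integral_norm_eq_lintegral_enorm hki]
    simp_rw [Real.norm_of_nonneg (hk0 _), hk1, ENNReal.ofReal_one]
  -- As `k` has integral `1`, the value `f x` is the average of the constant `f x`.
  have e : ∀ x, mollify k f x - f x = ∫ h, k h • (f (x - h) - f x) := by
    intro x
    simp_rw [smul_sub]
    rw [integral_sub (integrable_smul hk2 (memLp_sub_left hf x)) (hki.smul_const _),
      integral_smul_const, hk1, one_smul]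
    rfl
  simp_rw [e]
  refine (lintegral_enorm_integral_smul_sq_le (g := fun x h => f (x - h) - f x) hk
    ((hf.1.comp_quasiMeasurePreserving quasiMeasurePreserving_sub).sub
      (hf.1.comp_quasiMeasurePreserving Measure.quasiMeasurePreserving_fst))).trans_eq ?_
  rw [h1, one_mul]

/-- Local compactness in `L²`: up to translation increments and a small multiple of the norm, the
`L²(K)` norm is controlled by finitely many values of the mollification. -/
theorem exists_finset_lintegral_sq_le [CompleteSpace F] {k : E3 → ℝ} (hk : Continuous k)
    (hk2 : MemLp k 2 volume) (hk0 : ∀ x, 0 ≤ k x) (hk1 : ∫ x, k x = 1) {K : Set E3}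
    (hK : IsCompact K) {κ : ℝ≥0∞} (hκ : κ ≠ 0) :
    ∃ (s : Finset E3) (C : ℝ≥0∞), C ≠ ∞ ∧ ∀ f : E3 → F, MemLp f 2 volume →
      eLpNorm f 2 (volume.restrict K) ^ 2 ≤
        2 * (∫⁻ h, ‖k h‖ₑ * ∫⁻ x, ‖f (x - h) - f x‖ₑ ^ 2) + C * ∑ y ∈ s, ‖mollify k f y‖ₑ ^ 2
          + κ * eLpNorm f 2 volume ^ 2 := by
  have hKv : volume K ≠ ∞ := hK.measure_lt_top.ne
  -- The factor `4` comes from using `(a + b)² ≤ 2a² + 2b²` twice: to pass from `f` to its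
  -- mollification, and from there to its value at a nearby centre.
  obtain ⟨δ, hδ0, hδ⟩ : ∃ δ : ℝ≥0∞, 0 < δ ∧ 4 * volume K * δ ^ 2 ≤ κ := by
    have ht : Tendsto (fun δ : ℝ≥0∞ => 4 * volume K * δ ^ 2) (𝓝[>] 0) (𝓝 0) := by
      have h1 : Tendsto (fun δ : ℝ≥0∞ => 4 * volume K * δ ^ 2) (𝓝 0)
          (𝓝 (4 * volume K * 0 ^ 2)) :=
        ENNReal.Tendsto.const_mul (ENNReal.Tendsto.pow tendsto_id)
          (.inr (ENNReal.mul_ne_top (by norm_num) hKv))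
      simp only [ne_eq, OfNat.ofNat_ne_zero, not_false_eq_true, zero_pow, mul_zero] at h1
      exact h1.mono_left nhdsWithin_le_nhds
    obtain ⟨δ, h1, h2⟩ := ((ht.eventually_le_const (pos_iff_ne_zero.2 hκ)).and
      self_mem_nhdsWithin).exists
    exact ⟨δ, h2, h1⟩
  -- Continuity of translations in `L²`, applied to the kernel, gives a radius `r` at which
  -- mollifications oscillate by at most `δ‖f‖`; the centres of a finite cover of `K` by such balls
  -- are the points sought.
  obtain ⟨r, hr, hrδ⟩ := Metric.eventually_nhds_iff_ball.1
    ((tendsto_eLpNorm_translate_sub hk2).eventually_le_const hδ0)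
  obtain ⟨t, -, htK⟩ := hK.elim_nhds_subcover (fun x => Metric.ball x r)
    fun x _ => Metric.ball_mem_nhds x hr
  refine ⟨t, 4 * volume K, ENNReal.mul_ne_top (by norm_num) hKv, fun f hf => ?_⟩
  have hpt : ∀ x ∈ K, ‖mollify k f x‖ₑ ^ 2 ≤
      2 * ∑ y ∈ t, ‖mollify k f y‖ₑ ^ 2 + 2 * (δ * eLpNorm f 2 volume) ^ 2 := by
    intro x hx
    obtain ⟨y, hy, hxy⟩ := mem_iUnion₂.1 (htK hx)
    have h1 : ‖mollify k f x - mollify k f y‖ₑ ≤ δ * eLpNorm f 2 volume :=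
      (enorm_mollify_sub_le hk2 hf x y).trans (by
        gcongr
        exact hrδ _ (by simpa [dist_eq_norm] using hxy))
    calc _ ≤ (‖mollify k f y‖ₑ + ‖mollify k f x - mollify k f y‖ₑ) ^ 2 := by
          gcongr
          simpa using enorm_add_le (mollify k f y) (mollify k f x - mollify k f y)
      _ ≤ 2 * ‖mollify k f y‖ₑ ^ 2 + 2 * ‖mollify k f x - mollify k f y‖ₑ ^ 2 :=
          ENNReal_add_sq_le _ _
      _ ≤ _ := by
          gcongr
          exact Finset.single_le_sum (f := fun y => ‖mollify k f y‖ₑ ^ 2)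
            (fun _ _ => zero_le) hy
  have hint : ∫⁻ x in K, ‖mollify k f x‖ₑ ^ 2 ≤
      (2 * ∑ y ∈ t, ‖mollify k f y‖ₑ ^ 2 + 2 * (δ * eLpNorm f 2 volume) ^ 2) * volume K := by
    refine (setLIntegral_mono' hK.measurableSet hpt).trans_eq ?_
    rw [setLIntegral_const]
  have hm := aestronglyMeasurable_mollify hk hf.1
  rw [eLpNorm_two_sq]
  calc ∫⁻ x in K, ‖f x‖ₑ ^ 2
      ≤ ∫⁻ x in K, (2 * ‖mollify k f x - f x‖ₑ ^ 2 + 2 * ‖mollify k f x‖ₑ ^ 2) := by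
        refine lintegral_mono fun x => ?_
        refine le_trans ?_ (ENNReal_add_sq_le _ _)
        gcongr
        have := enorm_sub_le (a := mollify k f x - f x) (b := mollify k f x)
        simpa using this
    _ = 2 * (∫⁻ x in K, ‖mollify k f x - f x‖ₑ ^ 2) + 2 * ∫⁻ x in K, ‖mollify k f x‖ₑ ^ 2 := by
        rw [lintegral_add_right' _ ((hm.restrict.enorm.pow_const 2).const_mul 2),
          lintegral_const_mul' _ _ (by norm_num), lintegral_const_mul' _ _ (by norm_num)]
    _ ≤ 2 * (∫⁻ h, ‖k h‖ₑ * ∫⁻ x, ‖f (x - h) - f x‖ₑ ^ 2)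
        + 2 * ((2 * ∑ y ∈ t, ‖mollify k f y‖ₑ ^ 2 + 2 * (δ * eLpNorm f 2 volume) ^ 2)
          * volume K) := by
        exact add_le_add (mul_le_mul_right ((setLIntegral_le_lintegral _ _).trans
          (lintegral_mollify_sub_sq_le hk hk2 hk0 hk1 hf)) _) (mul_le_mul_right hint _)
    _ = 2 * (∫⁻ h, ‖k h‖ₑ * ∫⁻ x, ‖f (x - h) - f x‖ₑ ^ 2)
        + 4 * volume K * (∑ y ∈ t, ‖mollify k f y‖ₑ ^ 2)
        + (4 * volume K * δ ^ 2) * eLpNorm f 2 volume ^ 2 := by ring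
    _ ≤ _ := by gcongr

end Mollification

/-! ### Functions of time: bounded derivative and weak convergence imply strong convergence. -/

section OneDim

variable {T : ℝ}

/-- The mean zero mollifier differences are derivatives of bounded test functions. -/
theorem exists_primitive {k : ℝ → ℝ} {a b : ℝ} (hk : ContDiff ℝ (⊤ : ℕ∞) k)
    (hs : Function.support k ⊆ Icc a b) (h0 : ∫ x, k x = 0) :
    ∃ ψ : ℝ → ℝ, ContDiff ℝ (⊤ : ℕ∞) ψ ∧ Function.support ψ ⊆ Icc a b ∧ deriv ψ = k ∧
      ∀ x, ‖ψ x‖ₑ ≤ ∫⁻ x, ‖k x‖ₑ := by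
  have hd : ∀ x, HasDerivAt (fun x => ∫ y in a..x, k y) (k x) x := fun x =>
    intervalIntegral.integral_hasDerivAt_right (hk.continuous.intervalIntegrable _ _)
      (hk.continuous.stronglyMeasurableAtFilter _ _) hk.continuous.continuousAt
  have hderiv : deriv (fun x => ∫ y in a..x, k y) = k := funext fun x => (hd x).deriv
  have hz : ∀ y, y ∉ Icc a b → k y = 0 := fun y hy => by
    by_contra h; exact hy (hs h)
  refine ⟨fun x => ∫ y in a..x, k y, ?_, ?_, hderiv, ?_⟩
  · refine contDiff_infty_iff_deriv.2 ⟨fun x => (hd x).differentiableAt, ?_⟩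
    rwa [hderiv]
  · intro x hx
    by_contra hxn
    refine hx ?_
    rcases lt_or_ge x a with h | h
    · refine intervalIntegral.integral_zero_ae ?_
      -- On `(x, a]` the function `k` can be nonzero only at the endpoint `a`, a null set.
      have : ∀ᵐ y : ℝ, y ≠ a := by simp [ae_iff, measure_singleton]
      filter_upwards [this] with y hne hy
      rw [uIoc_of_ge h.le] at hy
      exact hz y fun h' => hne (le_antisymm hy.2 h'.1)
    -- Beyond `b` the primitive equals the full integral of `k`, which is zero.
    · have hb : b < x := by
        by_contra h'; exact hxn ⟨h, not_lt.1 h'⟩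
      change ∫ y in a..x, k y = 0
      rw [intervalIntegral.integral_of_le h, ← integral_Icc_eq_integral_Ioc,
        setIntegral_eq_integral_of_forall_compl_eq_zero, h0]
      exact fun y hy => hz y fun h' => hy ⟨h'.1, h'.2.trans hb.le⟩
  · intro x
    change ‖∫ y in a..x, k y‖ₑ ≤ _
    rw [← ofReal_norm, intervalIntegral.norm_intervalIntegral_eq, ofReal_norm]
    exact (enorm_integral_le_lintegral_enorm _).trans (setLIntegral_le_lintegral _ _)

/-- `|∫ g ψ'| ≤ A ‖ψ‖` for all test functions `ψ` on `(0,T)`: the derivative of `g` is in `L²`. -/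
def DerivBound (T : ℝ) (A : ℝ≥0) (g : ℝ → ℝ) : Prop :=
  ∀ ψ : ℝ → ℝ, ContDiff ℝ (⊤ : ℕ∞) ψ → HasCompactSupport ψ → tsupport ψ ⊆ Ioo 0 T →
    ‖∫ t in Ioo 0 T, deriv ψ t * g t‖ₑ ≤ A * eLpNorm ψ 2 (volume.restrict (Ioo 0 T))

/-- A mean zero `k` is `ψ'` with `|ψ| ≤ 2` supported in `[a,b]`, so `‖ψ‖² ≤ 4(b - a)`. Applied to
the difference of two averaging kernels, it says that averages of `g` around a point at comparable
or smaller scales differ by the square root of the scale. -/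
theorem DerivBound.enorm_integral_sq_le {A : ℝ≥0} {g : ℝ → ℝ} (hg : DerivBound T A g)
    {k : ℝ → ℝ} {a b : ℝ} (hk : ContDiff ℝ (⊤ : ℕ∞) k)
    (hs : Function.support k ⊆ Icc a b) (h0 : ∫ x, k x = 0) (h2 : ∫⁻ x, ‖k x‖ₑ ≤ 2)
    (hT : Icc a b ⊆ Ioo 0 T) :
    ‖∫ t in Ioo 0 T, k t * g t‖ₑ ^ 2 ≤ A ^ 2 * (4 * ENNReal.ofReal (b - a)) := by
  obtain ⟨ψ, hψ, hψs, hψk, hψb⟩ := exists_primitive hk hs h0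
  have hts : tsupport ψ ⊆ Icc a b := closure_minimal hψs isClosed_Icc
  have h1 := hg ψ hψ (HasCompactSupport.of_support_subset_isCompact isCompact_Icc hψs)
    (hts.trans hT)
  rw [hψk] at h1
  refine (pow_le_pow_left₀ zero_le h1 2).trans ?_
  rw [mul_pow, eLpNorm_two_sq]
  gcongr
  calc ∫⁻ x in Ioo 0 T, ‖ψ x‖ₑ ^ 2 ≤ ∫⁻ x, ‖ψ x‖ₑ ^ 2 := setLIntegral_le_lintegral _ _
    _ ≤ ∫⁻ x, (Icc a b).indicator (fun _ => 4) x := by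
        refine lintegral_mono fun x => ?_
        by_cases hx : x ∈ Icc a b
        · rw [indicator_of_mem hx]
          calc ‖ψ x‖ₑ ^ 2 ≤ 2 ^ 2 := by
                gcongr
                exact (hψb x).trans h2
            _ = 4 := by norm_num
        · have : ψ x = 0 := by
            by_contra h; exact hx (hψs h)
          simp [this]
    _ = _ := by rw [lintegral_indicator_const measurableSet_Icc, Real.volume_Icc]

/-- Functions with uniformly bounded derivative that tend to `0` weakly tend to `0` strongly. -/
theorem tendsto_lintegral_sq_of_derivBound {A M : ℝ≥0} {g : ℕ → ℝ → ℝ}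
    (hgm : ∀ n, AEStronglyMeasurable (g n) (volume.restrict (Ioo 0 T)))
    (hgb : ∀ n, ∀ᵐ t ∂(volume.restrict (Ioo 0 T)), ‖g n t‖ₑ ≤ M)
    (hgd : ∀ n, DerivBound T A (g n))
    (hw : ∀ k : ℝ → ℝ, Continuous k → HasCompactSupport k →
      Tendsto (fun n => ∫ t in Ioo 0 T, k t * g n t) atTop (𝓝 0)) :
    Tendsto (fun n => ∫⁻ t in Ioo 0 T, ‖g n t‖ₑ ^ 2) atTop (𝓝 0) := by
  let φ : ℕ → ContDiffBump (0 : ℝ) := fun m =>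
    ⟨1 / ((m : ℝ) + 1), 2 / ((m : ℝ) + 1), by positivity, by gcongr; norm_num⟩
  have hφout : ∀ m, (φ m).rOut = 2 / ((m : ℝ) + 1) := fun _ => rfl
  have hφ0 : Tendsto (fun m => (φ m).rOut) atTop (𝓝 0) := by
    have := (tendsto_one_div_add_atTop_nhds_zero_nat (𝕜 := ℝ)).const_mul 2
    simpa [hφout, div_eq_mul_inv] using this
  set ρ : ℕ → ℝ → ℝ := fun m => (φ m).normed volume
  have hρs : ∀ m, ContDiff ℝ (⊤ : ℕ∞) (ρ m) := fun m => (φ m).contDiff_normed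
  have hρ1 : ∀ m, ∫⁻ x, ‖ρ m x‖ₑ = 1 := fun m => by
    rw [← ofReal_integral_norm_eq_lintegral_enorm (φ m).integrable_normed]
    have : ∀ x, ‖(φ m).normed volume x‖ = (φ m).normed volume x := fun x => Real.norm_of_nonneg ((φ m).nonneg_normed _)
    simp_rw [this]
    rw [(φ m).integral_normed, ENNReal.ofReal_one]
  have hli : ∀ n, LocallyIntegrable ((Ioo 0 T).indicator (g n)) := fun n => by
    refine Integrable.locallyIntegrable ((integrable_indicator_iff measurableSet_Ioo).2 ?_)
    refine (MemLp.of_bound (hgm n) M ?_ : MemLp _ 1 _).integrable le_rfl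
    filter_upwards [hgb n] with t ht
    exact_mod_cast ht
  -- Lebesgue differentiation: at almost every time, for all `n` at once, averages at shrinking
  -- scales recover `g n t`.
  have hconv : ∀ᵐ t, ∀ n, Tendsto (fun m => ∫ s in Ioo 0 T, ρ m (t - s) * g n s) atTop
      (𝓝 ((Ioo 0 T).indicator (g n) t)) := by
    rw [ae_all_iff]
    intro n
    filter_upwards [ContDiffBump.ae_convolution_tendsto_right_of_locallyIntegrable (K := 2) hφ0
      (.of_forall fun m => by simp [φ, div_eq_mul_inv]) (hli n)] with t ht
    refine ht.congr fun m => ?_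
    rw [convolution_lsmul_swap, ← integral_indicator measurableSet_Ioo]
    refine integral_congr_ae (.of_forall fun s => ?_)
    by_cases hs : s ∈ Ioo 0 T <;> simp [hs, ρ]
  have hpt : ∀ᵐ t ∂(volume.restrict (Ioo 0 T)), Tendsto (fun n => ‖g n t‖ₑ ^ 2) atTop (𝓝 0) := by
    rw [ae_restrict_iff' measurableSet_Ioo]
    filter_upwards [hconv] with t ht htT
    have hz : Tendsto (fun n => ‖g n t‖ₑ) atTop (𝓝 0) := by
      rw [ENNReal.tendsto_nhds_zero]
      intro ε hε
      have hε2 : 0 < (ε / 2) ^ 2 := ENNReal.pow_pos (ENNReal.half_pos hε.ne') 2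
      have hsm : Tendsto (fun m => (A : ℝ≥0∞) ^ 2 * (4 * ENNReal.ofReal (2 * (φ m).rOut))) atTop
          (𝓝 0) := by
        have h1 := ENNReal.tendsto_ofReal (hφ0.const_mul 2)
        have h2 := ENNReal.Tendsto.const_mul (a := (A : ℝ≥0∞) ^ 2)
          (ENNReal.Tendsto.const_mul (a := 4) h1 (.inr (by norm_num))) (.inr (by simp))
        simpa using h2
      have hin : ∀ᶠ m in atTop, (φ m).rOut < min t (T - t) :=
        hφ0.eventually_lt_const (lt_min htT.1 (sub_pos.2 htT.2))
      -- One scale `m` for all `n`: averaging costs at most `ε / 2`, and the window of width `2 *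
      -- rOut` around `t` stays inside `(0,T)`.
      obtain ⟨m, hm1, hm2⟩ := ((hsm.eventually_le_const hε2).and hin).exists
      obtain ⟨hm3, hm4⟩ := lt_min_iff.1 hm2
      have hle : ∀ n, ‖g n t - ∫ s in Ioo 0 T, ρ m (t - s) * g n s‖ₑ ≤ ε / 2 := by
        intro n
        -- The averages at scales `m'` and `m` are compared through the mean zero kernel `ρ m' - ρ
        -- m`, of `L¹` norm at most `2`; then `m' → ∞`.
        have hl := ((ht n).sub_const (∫ s in Ioo 0 T, ρ m (t - s) * g n s)).enorm
        rw [indicator_of_mem htT] at hl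
        refine le_of_tendsto hl ?_
        filter_upwards [hφ0.eventually_le_const (φ m).rOut_pos] with m' hm'
        refine (ENNReal.pow_le_pow_left_iff two_ne_zero).1 (le_trans ?_ hm1)
        have hint : ∀ j, Integrable (fun s => ρ j (t - s) * g n s)
            (volume.restrict (Ioo 0 T)) := fun j => by
          have hb : MemLp (fun s => ρ j (t - s)) 2 (volume.restrict (Ioo 0 T)) := by
            refine (Continuous.memLp_of_hasCompactSupport ((hρs j).continuous.comp (by fun_prop))
              ?_).restrict _
            exact (φ j).hasCompactSupport_normed.comp_homeomorph (Homeomorph.subLeft t)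
          have hg2 : MemLp (g n) 2 (volume.restrict (Ioo 0 T)) := by
            refine MemLp.of_bound (hgm n) M ?_
            filter_upwards [hgb n] with t ht
            exact_mod_cast ht
          exact integrable_smul hb hg2
        rw [← integral_sub (hint m') (hint m)]
        simp_rw [← sub_mul]
        have hsub : ∀ j, ContDiff ℝ (⊤ : ℕ∞) fun s => ρ j (t - s) := fun j =>
          (hρs j).comp (contDiff_const.sub contDiff_id)
        have hsupp : ∀ j, (φ j).rOut ≤ (φ m).rOut → ∀ s, ρ j (t - s) ≠ 0 →
            s ∈ Icc (t - (φ m).rOut) (t + (φ m).rOut) := by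
          intro j hj s hs
          have : t - s ∈ Metric.ball (0 : ℝ) (φ j).rOut := by
            rw [← (φ j).support_normed_eq (μ := volume)]; exact hs
          rw [Metric.mem_ball, Real.dist_eq, sub_zero, abs_lt] at this
          constructor <;> linarith [this.1, this.2]
        have := (hgd n).enorm_integral_sq_le (k := fun s => ρ m' (t - s) - ρ m (t - s))
          (a := t - (φ m).rOut) (b := t + (φ m).rOut)
          ((hsub m').sub (hsub m)) ?_ ?_ ?_ ?_
        · refine this.trans_eq ?_
          congr 3
          ring
        · intro s hs
          by_cases h1 : ρ m' (t - s) = 0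
          · refine hsupp m le_rfl s fun h2 => hs ?_
            simp [h1, h2]
          · exact hsupp m' hm' s h1
        · rw [integral_sub ((φ m').integrable_normed.comp_sub_left t)
            ((φ m).integrable_normed.comp_sub_left t), integral_sub_left_eq_self (ρ m') volume t,
            integral_sub_left_eq_self (ρ m) volume t, (φ m').integral_normed,
            (φ m).integral_normed, sub_self]
        · calc _ ≤ ∫⁻ s, (‖ρ m' (t - s)‖ₑ + ‖ρ m (t - s)‖ₑ) :=
                lintegral_mono fun s => enorm_sub_le
            _ = 2 := by
                rw [lintegral_add_left (hsub m').continuous.enorm.measurable,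
                  lintegral_sub_left_eq_self (fun s => ‖ρ m' s‖ₑ),
                  lintegral_sub_left_eq_self (fun s => ‖ρ m s‖ₑ), hρ1, hρ1, one_add_one_eq_two]
        · intro s hs
          constructor <;> linarith [hs.1, hs.2]
      -- At the fixed scale `m` the average is an integral against a fixed function of time, so weak
      -- convergence sends it to `0`.
      have hw' := (hw (fun s => ρ m (t - s)) ((hρs m).continuous.comp (by fun_prop))
        ((φ m).hasCompactSupport_normed.comp_homeomorph (Homeomorph.subLeft t))).enorm
      rw [enorm_zero] at hw'
      filter_upwards [hw'.eventually_le_const (ENNReal.half_pos hε.ne')] with n hn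
      calc ‖g n t‖ₑ ≤ ‖g n t - ∫ s in Ioo 0 T, ρ m (t - s) * g n s‖ₑ
            + ‖∫ s in Ioo 0 T, ρ m (t - s) * g n s‖ₑ := by
            simpa using enorm_add_le (g n t - ∫ s in Ioo 0 T, ρ m (t - s) * g n s)
              (∫ s in Ioo 0 T, ρ m (t - s) * g n s)
        _ ≤ ε / 2 + ε / 2 := add_le_add (hle n) hn
        _ = ε := ENNReal.add_halves ε
    have := ENNReal.Tendsto.pow (n := 2) hz
    simpa using this
  have := tendsto_lintegral_of_dominated_convergence' (μ := volume.restrict (Ioo 0 T))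
    (F := fun n t => ‖g n t‖ₑ ^ 2) (f := fun _ => 0) (fun _ => (M : ℝ≥0∞) ^ 2)
    (fun n => (hgm n).enorm.pow_const 2)
    (fun n => by
      filter_upwards [hgb n] with t ht
      gcongr)
    (by
      rw [lintegral_const]
      exact ENNReal.mul_ne_top (by simp) (by simp)) hpt
  simpa using this

end OneDim

/-! ### The space-time compactness criterion. -/

section Compactness

set_option linter.unusedSectionVars false

variable {T : ℝ} {F : Type*} [NormedAddCommGroup F] [InnerProductSpace ℝ F]

/-- A sequence of functions of time with values in `L²(ℝ³)` whose translation increments are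
uniformly small and whose mollifications tend to `0` tends to `0` in `L²(0,T;L²_loc)`. -/
theorem tendsto_lintegral_eLpNorm_restrict [CompleteSpace F] {w : ℕ → ℝ → E3 → F} {M A : ℝ≥0}
    {D : ℕ → ℝ → E3 → ℝ≥0∞}
    (hw : ∀ n, ∀ᵐ t ∂(volume.restrict (Ioo 0 T)),
      MemLp (w n t) 2 volume ∧ eLpNorm (w n t) 2 volume ≤ M)
    (hD : ∀ n, ∀ᵐ t ∂(volume.restrict (Ioo 0 T)), ∀ h,
      ∫⁻ x, ‖w n t (x - h) - w n t x‖ₑ ^ 2 ≤ D n t h)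
    (hDm : ∀ n, AEMeasurable (Function.uncurry (D n)) ((volume.restrict (Ioo 0 T)).prod volume))
    (hDA : ∀ n h, ∫⁻ t in Ioo 0 T, D n t h ≤ A * ‖h‖ₑ ^ 2)
    (hpt : ∀ k : E3 → ℝ, ContDiff ℝ (⊤ : ℕ∞) k → HasCompactSupport k → ∀ y,
      (∀ n, AEStronglyMeasurable (fun t => mollify k (w n t) y) (volume.restrict (Ioo 0 T))) ∧
      Tendsto (fun n => ∫⁻ t in Ioo 0 T, ‖mollify k (w n t) y‖ₑ ^ 2) atTop (𝓝 0))
    {K : Set E3} (hK : IsCompact K) :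
    Tendsto (fun n => ∫⁻ t in Ioo 0 T, (eLpNorm (w n t) 2 (volume.restrict K)) ^ 2) atTop (𝓝 0) := by
  rw [ENNReal.tendsto_nhds_zero]
  intro ε hε
  have hε3 : 0 < ε / 3 := ENNReal.div_pos hε.ne' (by norm_num)
  -- The radius `δ` of the kernel makes the increment term small and `κ` the norm term. Both are
  -- fixed before `n`, since the points `s` and the constant `C` depend on them.
  obtain ⟨δ, hδ0, hδ⟩ : ∃ δ : ℝ, 0 < δ ∧ 2 * (A * ENNReal.ofReal δ ^ 2) ≤ ε / 3 := by
    have h1 : Tendsto (fun δ : ℝ => 2 * (A * ENNReal.ofReal δ ^ 2)) (𝓝[>] 0) (𝓝 0) := by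
      have h2 : Tendsto (fun δ : ℝ => ENNReal.ofReal δ) (𝓝 0) (𝓝 (ENNReal.ofReal 0)) :=
        ENNReal.tendsto_ofReal tendsto_id
      have h3 := ENNReal.Tendsto.const_mul (a := 2) (ENNReal.Tendsto.const_mul (a := A)
        (ENNReal.Tendsto.pow (n := 2) h2) (.inr (by simp))) (.inr (by norm_num))
      simp only [ENNReal.ofReal_zero, ne_eq, OfNat.ofNat_ne_zero, not_false_eq_true, zero_pow,
        mul_zero] at h3
      exact h3.mono_left nhdsWithin_le_nhds
    obtain ⟨δ, h3, h4⟩ := ((h1.eventually_le_const hε3).and self_mem_nhdsWithin).exists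
    exact ⟨δ, h4, h3⟩
  obtain ⟨κ, hκ0, hκ⟩ : ∃ κ : ℝ≥0∞, 0 < κ ∧ κ * ((M : ℝ≥0∞) ^ 2 * ENNReal.ofReal T) ≤ ε / 3 := by
    refine ⟨ε / 3 / ((M : ℝ≥0∞) ^ 2 * ENNReal.ofReal T + 1), ENNReal.div_pos hε3.ne'
      (by finiteness), ?_⟩
    rw [mul_comm]
    exact (mul_le_mul_left le_self_add _).trans ENNReal.mul_div_le
  let φ : ContDiffBump (0 : E3) := ⟨δ / 2, δ, by positivity, by linarith⟩
  set k : E3 → ℝ := φ.normed volume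
  have hk : ContDiff ℝ (⊤ : ℕ∞) k := φ.contDiff_normed
  have hkc : HasCompactSupport k := φ.hasCompactSupport_normed
  have hk1 : ∫⁻ h, ‖k h‖ₑ = 1 := by
    rw [← ofReal_integral_norm_eq_lintegral_enorm φ.integrable_normed]
    have : ∀ x, ‖φ.normed volume x‖ = φ.normed volume x :=
      fun x => Real.norm_of_nonneg (φ.nonneg_normed _)
    simp_rw [this]
    rw [φ.integral_normed, ENNReal.ofReal_one]
  obtain ⟨s, C, hC, hs⟩ := exists_finset_lintegral_sq_le (F := F) hk.continuous
    (hk.continuous.memLp_of_hasCompactSupport hkc) (fun x => φ.nonneg_normed x)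
    φ.integral_normed hK hκ0.ne'
  have hfin : Tendsto (fun n => C * ∑ y ∈ s, ∫⁻ t in Ioo 0 T, ‖mollify k (w n t) y‖ₑ ^ 2) atTop
      (𝓝 0) := by
    have h1 := tendsto_finsetSum s fun y _ => (hpt k hk hkc y).2
    have h2 := ENNReal.Tendsto.const_mul (a := C) h1 (.inr hC)
    simpa using h2
  filter_upwards [hfin.eventually_le_const hε3] with n hn
  have hm1 : AEMeasurable (Function.uncurry fun t h => ‖k h‖ₑ * D n t h)
      ((volume.restrict (Ioo 0 T)).prod volume) :=
    (hk.continuous.comp continuous_snd).enorm.measurable.aemeasurable.mul (hDm n)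
  have hm1' : AEMeasurable (fun t => 2 * ∫⁻ h, ‖k h‖ₑ * D n t h) (volume.restrict (Ioo 0 T)) :=
    hm1.lintegral_prod_right'.const_mul 2
  have hm2 : ∀ y ∈ s, AEMeasurable (fun t => ‖mollify k (w n t) y‖ₑ ^ 2)
      (volume.restrict (Ioo 0 T)) := fun y _ => ((hpt k hk hkc y).1 n).enorm.pow_const 2
  have hm2' : AEMeasurable (fun t => C * ∑ y ∈ s, ‖mollify k (w n t) y‖ₑ ^ 2)
      (volume.restrict (Ioo 0 T)) := by
    simpa using (Finset.aemeasurable_sum s hm2).const_mul C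
  have hI : ∫⁻ t in Ioo 0 T, 2 * ∫⁻ h, ‖k h‖ₑ * D n t h ≤ ε / 3 := by
    rw [lintegral_const_mul' _ _ (by norm_num), lintegral_lintegral_swap hm1]
    refine le_trans ?_ hδ
    gcongr
    calc ∫⁻ h, ∫⁻ t in Ioo 0 T, ‖k h‖ₑ * D n t h
        ≤ ∫⁻ h, ‖k h‖ₑ * (A * ENNReal.ofReal δ ^ 2) := by
          refine lintegral_mono fun h => ?_
          rw [lintegral_const_mul' _ _ enorm_ne_top]
          rcases eq_or_ne (k h) 0 with h0 | h0
          · simp [h0]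
          · have hb : h ∈ Metric.ball (0 : E3) φ.rOut := by
              rw [← φ.support_normed_eq (μ := volume)]; exact h0
            gcongr
            refine (hDA n h).trans ?_
            gcongr
            rw [← ofReal_norm]
            exact ENNReal.ofReal_le_ofReal (mem_ball_zero_iff.1 hb).le
      _ = A * ENNReal.ofReal δ ^ 2 := by
          rw [lintegral_mul_const _ hk.continuous.enorm.measurable, hk1, one_mul]
  calc ∫⁻ t in Ioo 0 T, (eLpNorm (w n t) 2 (volume.restrict K)) ^ 2
      ≤ ∫⁻ t in Ioo 0 T, (2 * (∫⁻ h, ‖k h‖ₑ * D n t h) + C * ∑ y ∈ s, ‖mollify k (w n t) y‖ₑ ^ 2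
          + κ * M ^ 2) := by
        -- Only the majorant `D` has to be jointly measurable in `(t, h)`, not the increments of
        -- `w`. This matters for the Leray projection, which is defined time by time; there `D` is
        -- the increment of the unprojected field.
        refine lintegral_mono_ae ?_
        filter_upwards [hw n, hD n] with t h1 h2
        refine (hs _ h1.1).trans ?_
        gcongr with h
        · exact h2 h
        · exact h1.2
    _ = (∫⁻ t in Ioo 0 T, 2 * ∫⁻ h, ‖k h‖ₑ * D n t h)
        + C * ∑ y ∈ s, (∫⁻ t in Ioo 0 T, ‖mollify k (w n t) y‖ₑ ^ 2)
        + κ * (M ^ 2 * ENNReal.ofReal T) := by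
        rw [lintegral_add_right _ measurable_const, lintegral_add_left' hm1', lintegral_const,
          lintegral_const_mul' _ _ hC, lintegral_finsetSum' _ hm2]
        simp [mul_assoc]
    _ ≤ ε / 3 + ε / 3 + ε / 3 := by gcongr
    _ = ε := ENNReal.add_thirds ε

/-- The squared `L²(ℝ³)` norm of the increment in space at time `t`. -/
noncomputable def increment (f : ST → F) (t : ℝ) (h : E3) : ℝ≥0∞ :=
  ∫⁻ x, ‖f (t, x - h) - f (t, x)‖ₑ ^ 2

/-- As `f` is only almost everywhere strongly measurable, the shear `(h, t, x) ↦ (t, x - h)` must be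
quasi-measure-preserving. It is measure preserving for each fixed `h`, and `q0` permutes the
variables so that `h` comes first. -/
theorem aemeasurable_increment {f : ST → F} (hf : AEStronglyMeasurable f (stMeasure T)) :
    AEMeasurable (Function.uncurry (increment f)) ((volume.restrict (Ioo 0 T)).prod volume) := by
  rw [stMeasure_eq_prod] at hf
  have q0 : MeasurePreserving (fun p : (ℝ × E3) × E3 => (p.1.2, (p.1.1, p.2)))
      (((volume.restrict (Ioo 0 T)).prod volume).prod volume)
      ((volume : Measure E3).prod ((volume.restrict (Ioo 0 T)).prod volume)) :=
    (measurePreserving_prodAssoc (volume : Measure E3) (volume.restrict (Ioo 0 T))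
      (volume : Measure E3)).comp
      ((Measure.measurePreserving_swap (μ := volume.restrict (Ioo 0 T))
        (ν := (volume : Measure E3))).prod (MeasurePreserving.id (volume : Measure E3)))
  have q1 : Measure.QuasiMeasurePreserving (fun p : E3 × ℝ × E3 => (p.2.1, p.2.2 - p.1))
      ((volume : Measure E3).prod ((volume.restrict (Ioo 0 T)).prod volume))
      ((volume.restrict (Ioo 0 T)).prod volume) :=
    QuasiMeasurePreserving.prod_of_right (by fun_prop) (.of_forall fun h =>
      ((MeasurePreserving.id (volume.restrict (Ioo 0 T))).prod
        (measurePreserving_sub_right (volume : Measure E3) h)).quasiMeasurePreserving)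
  have q2 : Measure.QuasiMeasurePreserving (fun p : E3 × ℝ × E3 => p.2)
      ((volume : Measure E3).prod ((volume.restrict (Ioo 0 T)).prod volume))
      ((volume.restrict (Ioo 0 T)).prod volume) := Measure.quasiMeasurePreserving_snd
  replace q1 := q1.comp q0.quasiMeasurePreserving
  replace q2 := q2.comp q0.quasiMeasurePreserving
  exact (((hf.comp_quasiMeasurePreserving q1).sub
    (hf.comp_quasiMeasurePreserving q2)).enorm.pow_const 2).lintegral_prod_right'

theorem lintegral_slab {f : ST → ℝ≥0∞} (hf : AEMeasurable f (stMeasure T)) :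
    ∫⁻ z, f z ∂(stMeasure T) = ∫⁻ t in Ioo 0 T, ∫⁻ x, f (t, x) := by
  rw [stMeasure_eq_prod] at hf ⊢
  exact lintegral_prod _ hf

theorem lintegral_increment_le [FiniteDimensional ℝ F] {f : ST → F} {G : Fin 3 → ST → F}
    (hf : MemLp f 2 (stMeasure T)) (hG : ∀ i, MemLp (G i) 2 (stMeasure T))
    (hw : HasWeakGrad T f G) (h : E3) :
    ∫⁻ t in Ioo 0 T, increment f t h ≤ (∑ i, eLpNorm (G i) 2 (stMeasure T)) ^ 2 * ‖h‖ₑ ^ 2 := by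
  have h1 := eLpNorm_translate_sub_le hf hG hw h
  have hm : AEStronglyMeasurable (fun z : ST => f (z.1, z.2 - h) - f z) (stMeasure T) := by
    have e1 : (fun z : ST => f (z.1, z.2 - h)) = f ∘ fun z => z + (0, -h) := by
      ext ⟨t, x⟩; simp [sub_eq_add_neg]
    refine AEStronglyMeasurable.sub ?_ hf.1
    rw [e1]
    exact hf.1.comp_measurePreserving (measurePreserving_space_add T (-h))
  calc _ = eLpNorm (fun z : ST => f (z.1, z.2 - h) - f z) 2 (stMeasure T) ^ 2 := by
        rw [eLpNorm_two_sq, lintegral_slab (hm.enorm.pow_const 2)]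
        rfl
    _ ≤ _ := by
        rw [mul_comm, ← mul_pow]
        gcongr

end Compactness

/-! ### Pairings in space as functions of time, and the bound on their derivatives. -/

section Pairing

set_option linter.unusedSectionVars false

variable {T : ℝ} {F : Type*} [NormedAddCommGroup F] [InnerProductSpace ℝ F]

/-- Lebesgue measure on the time interval. -/
noncomputable abbrev timeMeasure (T : ℝ) : Measure ℝ := volume.restrict (Ioo 0 T)

/-- The pairing of a space-time field with a field on `ℝ³`, as a function of time. -/
noncomputable def pairing (f : ST → F) (w : E3 → F) (t : ℝ) : ℝ := ∫ x, inner ℝ (f (t, x)) (w x)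

theorem aestronglyMeasurable_fst {f : ℝ → F} (hf : AEStronglyMeasurable f (timeMeasure T)) :
    AEStronglyMeasurable (fun z : ST => f z.1) (stMeasure T) := by
  rw [stMeasure_eq_prod]; exact hf.comp_fst

theorem aestronglyMeasurable_snd {f : E3 → F} (hf : AEStronglyMeasurable f volume) :
    AEStronglyMeasurable (fun z : ST => f z.2) (stMeasure T) := by
  rw [stMeasure_eq_prod]; exact hf.comp_snd

/-- The supremum in time falls on `f` and the `L²` norm in time on `ψ`. In this way every term of
the equation is bounded linearly in the `L²` norm of the time test function. -/
theorem eLpNorm_smul_time_le {f : ST → F} {M : ℝ≥0∞} (hf : AEStronglyMeasurable f (stMeasure T))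
    (hM : ∀ᵐ t ∂(timeMeasure T), eLpNorm (fun x : E3 => f (t, x)) 2 volume ≤ M) {ψ : ℝ → ℝ}
    (hψ : AEStronglyMeasurable ψ (timeMeasure T)) :
    eLpNorm (fun z : ST => ψ z.1 • f z) 2 (stMeasure T) ≤ M * eLpNorm ψ 2 (timeMeasure T) := by
  refine (ENNReal.pow_le_pow_left_iff two_ne_zero).1 ?_
  have hm : AEMeasurable (fun z : ST => ‖ψ z.1 • f z‖ₑ ^ 2) (stMeasure T) :=
    ((aestronglyMeasurable_fst hψ).smul hf).enorm.pow_const 2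
  rw [eLpNorm_two_sq, lintegral_slab hm, mul_pow, eLpNorm_two_sq (f := ψ), ← lintegral_const_mul'' _ (hψ.enorm.pow_const 2)]
  refine lintegral_mono_ae ?_
  filter_upwards [hM] with t ht
  simp_rw [enorm_smul, mul_pow]
  rw [lintegral_const_mul' _ _ (by finiteness), ← eLpNorm_two_sq, mul_comm]
  gcongr

theorem memLp_slab {f : ST → F} {M : ℝ≥0} (hf : AEStronglyMeasurable f (stMeasure T))
    (hM : ∀ᵐ t ∂(timeMeasure T), eLpNorm (fun x : E3 => f (t, x)) 2 volume ≤ M) :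
    MemLp f 2 (stMeasure T) := by
  refine ⟨hf, ?_⟩
  have h := eLpNorm_smul_time_le hf hM (ψ := fun _ => 1) aestronglyMeasurable_const
  simp only [one_smul] at h
  exact h.trans_lt (ENNReal.mul_lt_top (by simp) (memLp_const _).2)

theorem eLpNorm_tensor_le {w : E3 → F} (hw : AEStronglyMeasurable w volume) {ψ : ℝ → ℝ}
    (hψ : AEStronglyMeasurable ψ (timeMeasure T)) :
    eLpNorm (fun z : ST => ψ z.1 • w z.2) 2 (stMeasure T)
      ≤ eLpNorm w 2 volume * eLpNorm ψ 2 (timeMeasure T) :=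
  eLpNorm_smul_time_le (aestronglyMeasurable_snd hw) (.of_forall fun _ => le_rfl) hψ

theorem memLp_tensor {w : E3 → F} (hw : MemLp w 2 volume) {ψ : ℝ → ℝ}
    (hψ : MemLp ψ 2 (timeMeasure T)) :
    MemLp (fun z : ST => ψ z.1 • w z.2) 2 (stMeasure T) :=
  ⟨(aestronglyMeasurable_fst hψ.1).smul (aestronglyMeasurable_snd hw.1),
    (eLpNorm_tensor_le hw.1 hψ.1).trans_lt (ENNReal.mul_lt_top hw.2 hψ.2)⟩

theorem memLp_section {f : ST → F} {M : ℝ≥0} (hf : AEStronglyMeasurable f (stMeasure T))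
    (hM : ∀ᵐ t ∂(timeMeasure T), eLpNorm (fun x : E3 => f (t, x)) 2 volume ≤ M) :
    ∀ᵐ t ∂(timeMeasure T), MemLp (fun x : E3 => f (t, x)) 2 volume := by
  rw [stMeasure_eq_prod] at hf
  filter_upwards [hf.prodMk_left, hM] with t h1 h2
  exact ⟨h1, h2.trans_lt (by simp)⟩

theorem aestronglyMeasurable_pairing {f : ST → F} {w : E3 → F}
    (hf : AEStronglyMeasurable f (stMeasure T)) (hw : AEStronglyMeasurable w volume) :
    AEStronglyMeasurable (pairing f w) (timeMeasure T) := by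
  have h := hf.inner (𝕜 := ℝ) (aestronglyMeasurable_snd (T := T) hw)
  rw [stMeasure_eq_prod] at h
  exact h.integral_prod_right'

theorem enorm_pairing_le {f : ST → F} {w : E3 → F} {t : ℝ}
    (hf : AEStronglyMeasurable (fun x => f (t, x)) volume) (hw : AEStronglyMeasurable w volume) :
    ‖pairing f w t‖ₑ ≤ eLpNorm (fun x => f (t, x)) 2 volume * eLpNorm w 2 volume :=
  enorm_integral_inner_le hf hw

theorem integral_mul_pairing {f : ST → F} {w : E3 → F} (hf : MemLp f 2 (stMeasure T))
    (hw : MemLp w 2 volume) {k : ℝ → ℝ} (hk : MemLp k 2 (timeMeasure T)) :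
    ∫ t in Ioo 0 T, k t * pairing f w t
      = ∫ z, (inner ℝ (f z) (k z.1 • w z.2) : ℝ) ∂(stMeasure T) := by
  have hi := integrable_inner hf (memLp_tensor hw hk)
  rw [stMeasure_eq_prod] at hi ⊢
  rw [integral_prod _ hi]
  refine integral_congr_ae (.of_forall fun t => ?_)
  simp only [pairing]
  rw [← integral_const_mul]
  simp_rw [inner_smul_right]

/-- The tensor product of a test function in time and a test function in space. -/
noncomputable def tensorTest {ψ : ℝ → ℝ} {w : E3 → F} (hψ : ContDiff ℝ (⊤ : ℕ∞) ψ)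
    (hψc : HasCompactSupport ψ) (hψT : tsupport ψ ⊆ Ioo 0 T) (hw : ContDiff ℝ (⊤ : ℕ∞) w)
    (hwc : HasCompactSupport w) : 𝓓(past T, F) :=
  have hsub : tsupport (fun z : ST => ψ z.1 • w z.2) ⊆ tsupport ψ ×ˢ tsupport w :=
    closure_minimal (fun z hz => ⟨subset_tsupport _ fun h => hz (by simp [h]),
      subset_tsupport _ fun h => hz (by simp [h])⟩)
      ((isClosed_tsupport _).prod (isClosed_tsupport _))
  ⟨fun z => ψ z.1 • w z.2, (hψ.comp contDiff_fst).smul (hw.comp contDiff_snd),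
    (IsCompact.prod hψc hwc).of_isClosed_subset (isClosed_tsupport _) hsub,
    fun z hz => ⟨(hψT (hsub hz).1).2, trivial⟩⟩

/-- The `i`-th partial derivative on `ℝ³`. -/
noncomputable def partialDeriv (i : Fin 3) (w : E3 → F) (x : E3) : F :=
  fderiv ℝ w x (EuclideanSpace.single i 1)

theorem hasFDerivAt_tensor {ψ : ℝ → ℝ} {w : E3 → F} (hψ : ContDiff ℝ (⊤ : ℕ∞) ψ)
    (hw : ContDiff ℝ (⊤ : ℕ∞) w) (z : ST) :
    HasFDerivAt (fun z : ST => ψ z.1 • w z.2)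
      (ψ z.1 • (fderiv ℝ w z.2).comp (ContinuousLinearMap.snd ℝ ℝ E3) +
        ((fderiv ℝ ψ z.1).comp (ContinuousLinearMap.fst ℝ ℝ E3)).smulRight (w z.2)) z :=
  ((hψ.differentiable (by simp) z.1).hasFDerivAt.comp z hasFDerivAt_fst).smul
    ((hw.differentiable (by simp) z.2).hasFDerivAt.comp z hasFDerivAt_snd)

theorem spaceDeriv_tensor {ψ : ℝ → ℝ} {w : E3 → F} (hψ : ContDiff ℝ (⊤ : ℕ∞) ψ)
    (hw : ContDiff ℝ (⊤ : ℕ∞) w) (i : Fin 3) (z : ST) :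
    spaceDeriv i (fun z : ST => ψ z.1 • w z.2) z = ψ z.1 • partialDeriv i w z.2 := by
  rw [spaceDeriv, (hasFDerivAt_tensor hψ hw z).fderiv]
  simp [partialDeriv]

theorem timeDeriv_tensor {ψ : ℝ → ℝ} {w : E3 → F} (hψ : ContDiff ℝ (⊤ : ℕ∞) ψ)
    (hw : ContDiff ℝ (⊤ : ℕ∞) w) (z : ST) :
    timeDeriv (fun z : ST => ψ z.1 • w z.2) z = deriv ψ z.1 • w z.2 := by
  rw [timeDeriv, (hasFDerivAt_tensor hψ hw z).fderiv]
  simp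

theorem continuous_partialDeriv {w : E3 → F} (hw : ContDiff ℝ (⊤ : ℕ∞) w) (i : Fin 3) :
    Continuous (partialDeriv i w) :=
  (hw.continuous_fderiv (by simp)).clm_apply continuous_const

theorem hasCompactSupport_partialDeriv {w : E3 → F} (hw : HasCompactSupport w) (i : Fin 3) :
    HasCompactSupport (partialDeriv i w) :=
  hw.fderiv_apply (𝕜 := ℝ) _

/-- Uniform bounds of a field in `L^∞(0,T;L²)` and of its gradient in `L²`. -/
structure BoundedBy (T : ℝ) (M : ℝ≥0) (f : ST → F) (Df : Fin 3 → ST → F) : Prop where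
  meas : AEStronglyMeasurable f (stMeasure T)
  bound : ∀ᵐ t ∂(timeMeasure T), eLpNorm (fun x : E3 => f (t, x)) 2 volume ≤ M
  grad_memLp : ∀ i, MemLp (Df i) 2 (stMeasure T)
  grad_bound : ∀ i, eLpNorm (Df i) 2 (stMeasure T) ≤ M

theorem BoundedBy.memLp {M : ℝ≥0} {f : ST → F} {Df : Fin 3 → ST → F} (h : BoundedBy T M f Df) :
    MemLp f 2 (stMeasure T) := memLp_slab h.meas h.bound

/-- The time factor `s` is attached to the undifferentiated fields `a` and `b`, so that each product
can be integrated by Cauchy-Schwarz: an `L^∞L²` field times `ψ` on one side, a gradient in `L²` on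
the other. -/
theorem enorm_nonlinear_le (a : E3) (Da : Fin 3 → E3) (b : F) (Db : Fin 3 → F) (s : ℝ) (c : F) :
    ‖(inner ℝ (∑ i, a i • Db i + ((1 / 2 : ℝ) * ∑ i, Da i i) • b) (s • c) : ℝ)‖ₑ
      ≤ ‖c‖ₑ * ∑ i, (‖s • a‖ₑ * ‖Db i‖ₑ + ‖s • b‖ₑ * ‖Da i‖ₑ) := by
  have hcomp : ∀ (a : E3) i, ‖a i‖ₑ ≤ ‖a‖ₑ := fun a i => by
    rw [← ofReal_norm, ← ofReal_norm]; exact ENNReal.ofReal_le_ofReal (PiLp.norm_apply_le a i)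
  have hhalf : ‖(1 / 2 : ℝ)‖ₑ ≤ 1 := by
    rw [← ofReal_norm]
    exact ENNReal.ofReal_le_one.2 (by norm_num)
  rw [inner_smul_right, enorm_mul]
  refine (mul_le_mul_right (enorm_inner_le _ _) _).trans ?_
  rw [← mul_assoc, mul_comm]
  gcongr
  calc ‖s‖ₑ * ‖∑ i, a i • Db i + ((1 / 2 : ℝ) * ∑ i, Da i i) • b‖ₑ
      ≤ ‖s‖ₑ * (∑ i, ‖a‖ₑ * ‖Db i‖ₑ + (∑ i, ‖Da i‖ₑ) * ‖b‖ₑ) := by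
        gcongr
        refine (enorm_add_le _ _).trans (add_le_add ?_ ?_)
        · refine (enorm_sum_le _ _).trans (Finset.sum_le_sum fun i _ => ?_)
          rw [enorm_smul]
          gcongr
          exact hcomp _ _
        · rw [enorm_smul, enorm_mul]
          gcongr
          refine (mul_le_mul_left hhalf _).trans ?_
          rw [one_mul]
          exact (enorm_sum_le _ _).trans (Finset.sum_le_sum fun i _ => hcomp _ _)
    _ = _ := by
        simp_rw [enorm_smul]
        rw [Finset.sum_add_distrib, mul_add, Finset.mul_sum, Finset.sum_mul, Finset.mul_sum]
        congr 1
        · exact Finset.sum_congr rfl fun i _ => by ring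
        · exact Finset.sum_congr rfl fun i _ => by ring

/-- The bound on the time derivative that follows from a transport-diffusion equation with a
source `r`. -/
theorem enorm_integral_timeDeriv_le {M : ℝ≥0} {u : ST → E3} {Du : Fin 3 → ST → E3} {f : ST → F}
    {Df : Fin 3 → ST → F} (hu : BoundedBy T M u Du) (hf : BoundedBy T M f Df) {ψ : ℝ → ℝ}
    {w : E3 → F} (hψ : MemLp ψ 2 (timeMeasure T)) (hψ' : MemLp (deriv ψ) 2 (timeMeasure T))
    (hw : MemLp w 2 volume) (hw' : ∀ i, MemLp (partialDeriv i w) 2 volume) {W R : ℝ≥0∞}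
    (hWt : W ≠ ∞) (hRt : R ≠ ∞) (hW : ∀ x, ‖w x‖ₑ ≤ W) {r : ST → ℝ}
    (hr : AEStronglyMeasurable r (stMeasure T)) (hR : ∫⁻ z, ‖r z‖ₑ ∂(stMeasure T) ≤ R)
    (heq : ∫ z, ((∑ i, inner ℝ (Df i z) (ψ z.1 • partialDeriv i w z.2))
        + inner ℝ (advect u Df z + ((1 / 2 : ℝ) * divOf Du z) • f z) (ψ z.1 • w z.2)
        - r z - inner ℝ (f z) (deriv ψ z.1 • w z.2)) ∂(stMeasure T) = 0) :
    ‖∫ t in Ioo 0 T, deriv ψ t * pairing f w t‖ₑ ≤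
      (M * ∑ i, eLpNorm (partialDeriv i w) 2 volume + 6 * W * M ^ 2) * eLpNorm ψ 2 (timeMeasure T)
        + R := by
  rw [integral_mul_pairing hf.memLp hw hψ']
  set a : ST → ℝ := fun z => ∑ i, inner ℝ (Df i z) (ψ z.1 • partialDeriv i w z.2)
  set b : ST → ℝ := fun z =>
    inner ℝ (advect u Df z + ((1 / 2 : ℝ) * divOf Du z) • f z) (ψ z.1 • w z.2)
  have hψ2 : eLpNorm ψ 2 (timeMeasure T) ≠ ∞ := hψ.2.ne
  -- The `6` counts three indices with two products each.
  have hb : ∫⁻ z, ‖b z‖ₑ ∂(stMeasure T) ≤ 6 * W * M ^ 2 * eLpNorm ψ 2 (timeMeasure T) := by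
    have hsu := (aestronglyMeasurable_fst hψ.1).smul hu.meas
    have hsf := (aestronglyMeasurable_fst hψ.1).smul hf.meas
    calc _ ≤ ∫⁻ z, W * ∑ i, (‖ψ z.1 • u z‖ₑ * ‖Df i z‖ₑ + ‖ψ z.1 • f z‖ₑ * ‖Du i z‖ₑ)
          ∂(stMeasure T) := lintegral_mono fun z =>
          (enorm_nonlinear_le _ _ _ _ _ _).trans (by gcongr; exact hW _)
      _ = W * ∑ i, ((∫⁻ z, ‖ψ z.1 • u z‖ₑ * ‖Df i z‖ₑ ∂(stMeasure T))
            + ∫⁻ z, ‖ψ z.1 • f z‖ₑ * ‖Du i z‖ₑ ∂(stMeasure T)) := by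
          rw [lintegral_const_mul' _ _ hWt, lintegral_finsetSum']
          · congr 1
            refine Finset.sum_congr rfl fun i _ => ?_
            exact lintegral_add_left' (hsu.enorm.mul (hf.grad_memLp i).1.enorm) _
          · exact fun i _ => (hsu.enorm.mul (hf.grad_memLp i).1.enorm).add
              (hsf.enorm.mul (hu.grad_memLp i).1.enorm)
      _ ≤ W * ∑ _i : Fin 3, ((M * eLpNorm ψ 2 (timeMeasure T)) * M
            + (M * eLpNorm ψ 2 (timeMeasure T)) * M) := by
          gcongr with i
          · exact (lintegral_enorm_mul_le hsu (hf.grad_memLp i).1).trans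
              (mul_le_mul' (eLpNorm_smul_time_le hu.meas hu.bound hψ.1) (hf.grad_bound i))
          · exact (lintegral_enorm_mul_le hsf (hu.grad_memLp i).1).trans
              (mul_le_mul' (eLpNorm_smul_time_le hf.meas hf.bound hψ.1) (hu.grad_bound i))
      _ = _ := by
          rw [Finset.sum_const, Finset.card_univ, Fintype.card_fin, nsmul_eq_mul]
          push_cast
          ring
  have hai : ∀ i, Integrable (fun z => (inner ℝ (Df i z) (ψ z.1 • partialDeriv i w z.2) : ℝ))
      (stMeasure T) := fun i => integrable_inner (hf.grad_memLp i) (memLp_tensor (hw' i) hψ)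
  have haint : Integrable a (stMeasure T) := integrable_finsetSum _ fun i _ => hai i
  have hbint : Integrable b (stMeasure T) := by
    refine ⟨?_, hb.trans_lt (by finiteness)⟩
    refine AEStronglyMeasurable.inner (AEStronglyMeasurable.add ?_ ?_)
      ((aestronglyMeasurable_fst hψ.1).smul (aestronglyMeasurable_snd hw.1))
    · refine Finset.aestronglyMeasurable_fun_sum _ fun i _ => ?_
      exact ((EuclideanSpace.proj (𝕜 := ℝ) i).continuous.comp_aestronglyMeasurable hu.meas).smul
        (hf.grad_memLp i).1
    · refine AEStronglyMeasurable.smul (AEStronglyMeasurable.const_mul ?_ _) hf.meas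
      refine Finset.aestronglyMeasurable_fun_sum _ fun i _ => ?_
      exact (EuclideanSpace.proj (𝕜 := ℝ) i).continuous.comp_aestronglyMeasurable
        (hu.grad_memLp i).1
  have hrint : Integrable r (stMeasure T) := ⟨hr, hR.trans_lt hRt.lt_top⟩
  have hcint := integrable_inner hf.memLp (memLp_tensor hw hψ')
  have hsplit : ∫ z, (inner ℝ (f z) (deriv ψ z.1 • w z.2) : ℝ) ∂(stMeasure T)
      = ∫ z, a z ∂(stMeasure T) + ∫ z, b z ∂(stMeasure T) - ∫ z, r z ∂(stMeasure T) := by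
    change ∫ z, ((a + b - r) z - inner ℝ (f z) (deriv ψ z.1 • w z.2)) ∂(stMeasure T) = 0 at heq
    rw [integral_sub ((haint.add hbint).sub hrint) hcint, integral_sub' (haint.add hbint) hrint,
      integral_add' haint hbint] at heq
    linarith
  have ha : ‖∫ z, a z ∂(stMeasure T)‖ₑ ≤
      M * (∑ i, eLpNorm (partialDeriv i w) 2 volume) * eLpNorm ψ 2 (timeMeasure T) := by
    rw [integral_finsetSum _ fun i _ => hai i, mul_assoc, Finset.sum_mul, Finset.mul_sum]
    refine (enorm_sum_le _ _).trans (Finset.sum_le_sum fun i _ => ?_)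
    exact (enorm_integral_inner_le (hf.grad_memLp i).1 (memLp_tensor (hw' i) hψ).1).trans
      (mul_le_mul' (hf.grad_bound i) (eLpNorm_tensor_le (hw' i).1 hψ.1))
  rw [hsplit]
  refine enorm_sub_le.trans (add_le_add ((enorm_add_le _ _).trans ?_)
    ((enorm_integral_le_lintegral_enorm _).trans hR))
  rw [add_mul]
  exact add_le_add ha ((enorm_integral_le_lintegral_enorm _).trans hb)

end Pairing

/-! ### The equations tested with products of a time function and a space function. -/

section Equations

variable {T ε : ℝ} {u₀ : E3 → E3} {θ₀ p₀ : E3 → ℝ} {u : ST → E3} {Du : Fin 3 → ST → E3}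
  {θ : ST → ℝ} {Dθ : Fin 3 → ST → ℝ} {p : ST → ℝ}

/-- Removes the initial data from the weak formulation: the time factor is supported in the open
interval. -/
theorem tensorTest_zero {F : Type*} [NormedAddCommGroup F] [InnerProductSpace ℝ F] {ψ : ℝ → ℝ}
    (hψT : tsupport ψ ⊆ Ioo 0 T) (c : F) : ψ 0 • c = 0 := by
  rw [image_eq_zero_of_notMem_tsupport fun h => lt_irrefl _ (hψT h).1, zero_smul]

theorem memLp_time {ψ : ℝ → ℝ} (hψ : Continuous ψ) (hψc : HasCompactSupport ψ) :
    MemLp ψ 2 (timeMeasure T) := (hψ.memLp_of_hasCompactSupport hψc).restrict _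

/-- The time derivative of the temperature, tested with a fixed test function. -/
theorem IsWeakSolution.derivBound_temperature
    (hs : IsWeakSolution T ε u₀ θ₀ p₀ u Du θ Dθ p) {M : ℝ≥0} (hu : BoundedBy T M u Du)
    (hθ : BoundedBy T M θ Dθ) {w : E3 → ℝ} (hw : ContDiff ℝ (⊤ : ℕ∞) w)
    (hwc : HasCompactSupport w) {W : ℝ≥0∞} (hWt : W ≠ ∞) (hW : ∀ x, ‖w x‖ₑ ≤ W) {A : ℝ≥0}
    (hA : M * ∑ i, eLpNorm (partialDeriv i w) 2 volume + 6 * W * M ^ 2 ≤ A) :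
    DerivBound T A (pairing θ w) := by
  intro ψ hψ hψc hψT
  have heq := hs.temperature (tensorTest hψ hψc hψT hw hwc)
  change ∫ z, ((∑ i, Dθ i z * spaceDeriv i (fun z : ST => ψ z.1 • w z.2) z)
        + (advect u Dθ z + (1 / 2 : ℝ) * divOf Du z * θ z) * (ψ z.1 • w z.2)
        - θ z * timeDeriv (fun z : ST => ψ z.1 • w z.2) z) ∂(stMeasure T)
      = ∫ x, θ₀ x * (ψ 0 • w x) at heq
  simp only [spaceDeriv_tensor hψ hw, timeDeriv_tensor hψ hw, tensorTest_zero hψT, mul_zero,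
    integral_zero] at heq
  have h := enorm_integral_timeDeriv_le hu hθ (memLp_time hψ.continuous hψc)
    (memLp_time (hψ.continuous_deriv (by simp)) hψc.deriv)
    (hw.continuous.memLp_of_hasCompactSupport hwc)
    (fun i => (continuous_partialDeriv hw i).memLp_of_hasCompactSupport
      (hasCompactSupport_partialDeriv hwc i)) hWt (R := 0) (by simp) hW (r := fun _ => 0)
    aestronglyMeasurable_const (by simp) (by
      refine Eq.trans (integral_congr_ae (.of_forall fun z => ?_)) heq
      simp only [RCLike.inner_apply, conj_trivial, smul_eq_mul, sub_zero]
      simp only [mul_comm])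
  rw [add_zero] at h
  exact h.trans (by gcongr)

/-- The time derivative of the velocity, tested with a fixed test field. -/
theorem IsWeakSolution.enorm_integral_velocity_le
    (hs : IsWeakSolution T ε u₀ θ₀ p₀ u Du θ Dθ p) {M Mp : ℝ≥0} (hu : BoundedBy T M u Du)
    (hp : ∀ᵐ t ∂(timeMeasure T), eLpNorm (fun x : E3 => p (t, x)) 2 volume ≤ Mp)
    {w : E3 → E3} (hw : ContDiff ℝ (⊤ : ℕ∞) w)
    (hwc : HasCompactSupport w) {W : ℝ≥0∞} (hWt : W ≠ ∞) (hW : ∀ x, ‖w x‖ₑ ≤ W)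
    {ψ : ℝ → ℝ} (hψ : ContDiff ℝ (⊤ : ℕ∞) ψ) (hψc : HasCompactSupport ψ)
    (hψT : tsupport ψ ⊆ Ioo 0 T) :
    ‖∫ t in Ioo 0 T, deriv ψ t * pairing u w t‖ₑ ≤
      (M * ∑ i, eLpNorm (partialDeriv i w) 2 volume + 6 * W * M ^ 2) * eLpNorm ψ 2 (timeMeasure T)
        + Mp * eLpNorm ψ 2 (timeMeasure T) *
          (eLpNorm (fun x => ∑ i, partialDeriv i w x i) 2 volume
            * eLpNorm (fun _ => (1 : ℝ)) 2 (timeMeasure T)) := by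
  have heq := hs.momentum (tensorTest hψ hψc hψT hw hwc)
  change ∫ z, ((∑ i, inner ℝ (Du i z) (spaceDeriv i (fun z : ST => ψ z.1 • w z.2) z))
        + inner ℝ (advect u Du z + ((1 / 2 : ℝ) * divOf Du z) • u z) (ψ z.1 • w z.2)
        - p z * (∑ i, spaceDeriv i (fun z : ST => ψ z.1 • w z.2) z i)
        - inner ℝ (u z) (timeDeriv (fun z : ST => ψ z.1 • w z.2) z)) ∂(stMeasure T)
      = ∫ x, inner ℝ (u₀ x) (ψ 0 • w x) at heq
  simp only [spaceDeriv_tensor hψ hw, timeDeriv_tensor hψ hw, tensorTest_zero hψT, inner_zero_right,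
    integral_zero] at heq
  have hψ2 : MemLp ψ 2 (timeMeasure T) := memLp_time hψ.continuous hψc
  have hw' : ∀ i, MemLp (partialDeriv i w) 2 volume := fun i =>
    (continuous_partialDeriv hw i).memLp_of_hasCompactSupport (hasCompactSupport_partialDeriv hwc i)
  have hdiv : MemLp (fun x => ∑ i, partialDeriv i w x i) 2 volume :=
    memLp_finsetSum _ fun i _ => (EuclideanSpace.proj (𝕜 := ℝ) i).comp_memLp' (hw' i)
  have h1 : MemLp (fun _ => (1 : ℝ)) 2 (timeMeasure T) := memLp_const _
  have hsp : AEStronglyMeasurable (fun z : ST => ψ z.1 • p z) (stMeasure T) :=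
    (aestronglyMeasurable_fst hψ2.1).smul hs.p_mem.1
  have hd1 : MemLp (fun z : ST => (1 : ℝ) • ∑ i, partialDeriv i w z.2 i) 2 (stMeasure T) :=
    memLp_tensor (ψ := fun _ => (1 : ℝ)) hdiv h1
  have hm : AEStronglyMeasurable (fun z : ST => (ψ z.1 • p z) *
    ((1 : ℝ) • ∑ i, partialDeriv i w z.2 i)) (stMeasure T) := hsp.mul hd1.1
  have e : ∀ z : ST, p z * ∑ i, (ψ z.1 • partialDeriv i w z.2) i
      = (ψ z.1 • p z) * ((1 : ℝ) • ∑ i, partialDeriv i w z.2 i) := fun z => by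
    simp only [PiLp.smul_apply, smul_eq_mul, one_mul, ← Finset.mul_sum]
    ring
  -- The pressure term is the source `r`. Its bound carries the `L²` norm of the divergence of `w`
  -- as a factor.
  refine enorm_integral_timeDeriv_le hu hu hψ2
    (memLp_time (hψ.continuous_deriv (by simp)) hψc.deriv)
    (hw.continuous.memLp_of_hasCompactSupport hwc) hw' hWt ?_ hW
    (r := fun z => p z * ∑ i, (ψ z.1 • partialDeriv i w z.2) i) ?_ ?_ heq
  · have := hdiv.2.ne
    have := h1.2.ne
    have := hψ2.2.ne
    finiteness
  · refine hm.congr (.of_forall fun z => ?_)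
    exact (e z).symm
  · simp only [e, enorm_mul]
    refine (lintegral_enorm_mul_le hsp hd1.1).trans ?_
    exact mul_le_mul' (eLpNorm_smul_time_le hs.p_mem.1 hp hψ2.1)
      (eLpNorm_tensor_le (ψ := fun _ => (1 : ℝ)) hdiv.1 h1.1)

end Equations

/-! ### Smoothness and support of mollifications. -/

section MollifySmooth

variable {F : Type*} [NormedAddCommGroup F] [InnerProductSpace ℝ F]
  {k : E3 → ℝ} {g : E3 → F}

theorem contDiff_mollify (hk : ContDiff ℝ (⊤ : ℕ∞) k) (hkc : HasCompactSupport k)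
    (hg : LocallyIntegrable g) : ContDiff ℝ (⊤ : ℕ∞) (mollify k g) :=
  hkc.contDiff_convolution_left (ContinuousLinearMap.lsmul ℝ ℝ) hk hg

theorem hasCompactSupport_mollify (hkc : HasCompactSupport k) (hgc : HasCompactSupport g) :
    HasCompactSupport (mollify k g) :=
  hkc.convolution (ContinuousLinearMap.lsmul ℝ ℝ) hgc

theorem partialDeriv_mollify (hk : ContDiff ℝ (⊤ : ℕ∞) k) (hkc : HasCompactSupport k)
    (hg : LocallyIntegrable g) (i : Fin 3) :
    partialDeriv i (mollify k g) = mollify (partialDeriv i k) g := by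
  ext1 x
  have h := (hkc.hasFDerivAt_convolution_left (ContinuousLinearMap.lsmul ℝ ℝ : ℝ →L[ℝ] F →L[ℝ] F)
    (hk.of_le (by simp)) hg x).fderiv
  have hex := (hkc.fderiv ℝ).convolutionExists_left (μ := volume)
    ((ContinuousLinearMap.lsmul ℝ ℝ : ℝ →L[ℝ] F →L[ℝ] F).precompL E3)
    (hk.continuous_fderiv (by simp)) hg x
  change fderiv ℝ (mollify k g) x _ = _
  rw [mollify_eq_convolution, h, convolution_def, ContinuousLinearMap.integral_apply hex.integrable]
  rfl

end MollifySmooth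

/-! ### Cutoffs and approximation in `L²(ℝ³)`. -/

section Cutoff

/-- Smooth cutoffs of larger and larger balls. -/
theorem exists_cutoff : ∃ (χ : ℕ → E3 → ℝ) (C : ℝ), 0 ≤ C ∧
    (∀ n, ContDiff ℝ (⊤ : ℕ∞) (χ n)) ∧ (∀ n, HasCompactSupport (χ n)) ∧ (∀ n x, ‖χ n x‖ ≤ 1) ∧
    (∀ x, Tendsto (fun n => χ n x) atTop (𝓝 1)) ∧
    ∀ n x, ‖fderiv ℝ (χ n) x‖ ≤ C * (1 / ((n : ℝ) + 1)) := by
  let φ : ContDiffBump (0 : E3) := ⟨1, 2, one_pos, one_lt_two⟩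
  have hφ : ContDiff ℝ (⊤ : ℕ∞) φ := φ.contDiff
  obtain ⟨C, hC⟩ := (hφ.continuous_fderiv (by simp)).bounded_above_of_compact_support
    (φ.hasCompactSupport.fderiv ℝ)
  refine ⟨fun n x => φ ((1 / ((n : ℝ) + 1)) • x), C, (norm_nonneg _).trans (hC 0), fun n =>
    hφ.comp (contDiff_id.const_smul _), fun n =>
    φ.hasCompactSupport.comp_homeomorph (Homeomorph.smulOfNeZero (1 / ((n : ℝ) + 1))
      (by positivity)), fun n x => ?_, fun x => ?_, fun n x => ?_⟩
  · rw [Real.norm_of_nonneg φ.nonneg]; exact φ.le_one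
  · have h1 := (tendsto_one_div_add_atTop_nhds_zero_nat (𝕜 := ℝ)).smul_const x
    rw [zero_smul] at h1
    have h2 := (hφ.continuous.tendsto 0).comp h1
    rwa [φ.one_of_mem_closedBall (by simp [φ])] at h2
  · have h1 : HasFDerivAt (fun x : E3 => (1 / ((n : ℝ) + 1)) • x)
        ((1 / ((n : ℝ) + 1)) • ContinuousLinearMap.id ℝ E3) x :=
      ((1 / ((n : ℝ) + 1)) • ContinuousLinearMap.id ℝ E3).hasFDerivAt
    have h2 := (hφ.differentiable (by simp) ((1 / ((n : ℝ) + 1)) • x)).hasFDerivAt.comp x h1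
    change ‖fderiv ℝ (φ ∘ fun x : E3 => (1 / ((n : ℝ) + 1)) • x) x‖ ≤ _
    rw [h2.fderiv, ContinuousLinearMap.comp_smul, ContinuousLinearMap.comp_id, norm_smul,
      Real.norm_of_nonneg (by positivity), mul_comm]
    gcongr
    exact hC _

theorem tendsto_cutoff_smul {χ : ℕ → E3 → ℝ} (hc : ∀ n, Continuous (χ n))
    (h1 : ∀ n x, ‖χ n x‖ ≤ 1)
    (ht : ∀ x, Tendsto (fun n => χ n x) atTop (𝓝 1)) {v : E3 → E3} (hv : MemLp v 2 volume) :
    Tendsto (fun n => eLpNorm (fun x => χ n x • v x - v x) 2 volume) atTop (𝓝 0) := by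
  have hsq : Tendsto (fun n => ∫⁻ x, ‖χ n x • v x - v x‖ₑ ^ 2) atTop (𝓝 0) := by
    have := tendsto_lintegral_of_dominated_convergence' (μ := (volume : Measure E3))
      (F := fun n x => ‖χ n x • v x - v x‖ₑ ^ 2) (f := fun _ => 0) (fun x => (2 * ‖v x‖ₑ) ^ 2)
      (fun n => (((hc n).aestronglyMeasurable.smul hv.1).sub hv.1).enorm.pow_const 2)
      (fun n => .of_forall fun x => by
        refine pow_le_pow_left₀ zero_le ?_ 2
        refine enorm_sub_le.trans ?_
        rw [two_mul, enorm_smul]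
        gcongr
        refine mul_le_of_le_one_left zero_le ?_
        rw [← ofReal_norm]
        exact ENNReal.ofReal_le_one.2 (h1 n x))
      (by
        simp_rw [mul_pow]
        rw [lintegral_const_mul' _ _ (by norm_num), ← eLpNorm_two_sq]
        have := hv.2.ne
        finiteness)
      (.of_forall fun x => by
        have h2 := ((ht x).smul_const (v x)).sub_const (v x)
        rw [one_smul, sub_self] at h2
        have := ENNReal.Tendsto.pow (n := 2) h2.enorm
        simpa using this)
    simpa using this
  simp_rw [← eLpNorm_two_sq] at hsq
  have h2 := (ENNReal.continuous_rpow_const (y := 1 / 2)).tendsto 0 |>.comp hsq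
  have e : ∀ a : ℝ≥0∞, (a ^ 2) ^ (1 / 2 : ℝ) = a := fun a => by
    rw [← ENNReal.rpow_natCast, ← ENNReal.rpow_mul]; norm_num
  simpa [Function.comp_def, e, -one_div] using h2

/-- Mollifications converge in `L²`. -/
theorem exists_eLpNorm_mollify_sub_le {F : Type*} [NormedAddCommGroup F] [InnerProductSpace ℝ F]
    [CompleteSpace F] {v : E3 → F} (hv : MemLp v 2 volume) {δ : ℝ≥0∞} (hδ : 0 < δ) :
    ∃ k : E3 → ℝ, ContDiff ℝ (⊤ : ℕ∞) k ∧ HasCompactSupport k ∧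
      eLpNorm (mollify k v - v) 2 volume ≤ δ := by
  obtain ⟨r, hr, hrδ⟩ := Metric.eventually_nhds_iff_ball.1
    ((tendsto_eLpNorm_translate_sub hv).eventually_le_const hδ)
  let φ : ContDiffBump (0 : E3) := ⟨r / 2, r, by positivity, by linarith⟩
  have hk : ContDiff ℝ (⊤ : ℕ∞) (φ.normed volume) := φ.contDiff_normed
  have hk1 : ∫⁻ h, ‖φ.normed volume h‖ₑ = 1 := by
    rw [← ofReal_integral_norm_eq_lintegral_enorm φ.integrable_normed]
    have : ∀ x, ‖φ.normed volume x‖ = φ.normed volume x :=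
      fun x => Real.norm_of_nonneg (φ.nonneg_normed _)
    simp_rw [this]
    rw [φ.integral_normed, ENNReal.ofReal_one]
  refine ⟨φ.normed volume, hk, φ.hasCompactSupport_normed, ?_⟩
  refine (ENNReal.pow_le_pow_left_iff two_ne_zero).1 ?_
  rw [eLpNorm_two_sq]
  refine (lintegral_mollify_sub_sq_le hk.continuous
    (hk.continuous.memLp_of_hasCompactSupport φ.hasCompactSupport_normed)
    (fun x => φ.nonneg_normed x) φ.integral_normed hv).trans ?_
  calc _ ≤ ∫⁻ h, ‖φ.normed volume h‖ₑ * δ ^ 2 := by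
        refine lintegral_mono fun h => ?_
        rcases eq_or_ne (φ.normed volume h) 0 with h0 | h0
        · simp [h0]
        · have hb : h ∈ Metric.ball (0 : E3) φ.rOut := by
            rw [← φ.support_normed_eq (μ := volume)]; exact h0
          gcongr
          rw [← eLpNorm_two_sq]
          gcongr
          exact hrδ h hb
    _ = δ ^ 2 := by rw [lintegral_mul_const _ hk.continuous.enorm.measurable, hk1, one_mul]

end Cutoff

/-! ### The Leray projector, translations and mollification. -/

section Leray

/-- Orthogonality to a span is tested on its generators; the gradient is traded for the derivative,
which is easier to compute with. -/
theorem mem_divFree_iff {v : Lp E3 2 (volume : Measure E3)} :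
    v ∈ divFree ↔ ∀ ψ : E3 → ℝ, ContDiff ℝ (⊤ : ℕ∞) ψ → HasCompactSupport ψ →
      ∫ x, fderiv ℝ ψ x (v x) = 0 := by
  have key : ∀ (ψ : E3 → ℝ) (g : Lp E3 2 (volume : Measure E3)),
      g =ᵐ[volume] (fun x => gradient ψ x) → (inner ℝ g v : ℝ) = ∫ x, fderiv ℝ ψ x (v x) := by
    intro ψ g hg
    rw [L2.inner_def]
    refine integral_congr_ae ?_
    filter_upwards [hg] with x hx
    rw [hx, inner_gradient_left]
  rw [divFree, Submodule.mem_orthogonal]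
  constructor
  · intro h ψ hψ hψc
    have hgc : Continuous (fun x => gradient ψ x) :=
      (InnerProductSpace.toDual ℝ E3).symm.continuous.comp (hψ.continuous_fderiv (by simp))
    have hgs : HasCompactSupport (fun x => gradient ψ x) :=
      (hψc.fderiv ℝ).comp_left (g := (InnerProductSpace.toDual ℝ E3).symm) (map_zero _)
    have hm : MemLp (fun x => gradient ψ x) 2 (volume : Measure E3) :=
      hgc.memLp_of_hasCompactSupport hgs
    rw [← key ψ (hm.toLp _) hm.coeFn_toLp]
    exact h _ (Submodule.subset_span ⟨⟨ψ, hψ, hψc, fun _ _ => trivial⟩, hm.coeFn_toLp⟩)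
  · intro h u hu
    induction hu using Submodule.span_induction with
    | mem g hg =>
      obtain ⟨ψ, hψ⟩ := hg
      rw [key ψ g hψ]
      exact h ψ ψ.contDiff ψ.hasCompactSupport
    | zero => exact inner_zero_left _
    | add a b _ _ ha hb => rw [inner_add_left, ha, hb, add_zero]
    | smul c a _ ha => rw [inner_smul_left, ha, mul_zero]

/-- Translation by `h` on `L²(ℝ³; ℝ³)`. -/
noncomputable def translation (h : E3) :
    Lp E3 2 (volume : Measure E3) →ₗᵢ[ℝ] Lp E3 2 (volume : Measure E3) :=
  Lp.compMeasurePreservingₗᵢ ℝ (fun x => x - h) (measurePreserving_sub_right volume h)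

theorem coeFn_translation (h : E3) (v : Lp E3 2 (volume : Measure E3)) :
    translation h v =ᵐ[volume] fun x => v (x - h) :=
  Lp.coeFn_compMeasurePreserving v (measurePreserving_sub_right volume h)

theorem translation_neg (h : E3) (v : Lp E3 2 (volume : Measure E3)) :
    translation h (translation (-h) v) = v := by
  refine Lp.ext ?_
  filter_upwards [coeFn_translation h (translation (-h) v),
    (measurePreserving_sub_right volume h).quasiMeasurePreserving.ae (coeFn_translation (-h) v)]
    with x h1 h2
  rw [h1, h2]
  simp

theorem translation_mem_divFree (h : E3) {v : Lp E3 2 (volume : Measure E3)} (hv : v ∈ divFree) :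
    translation h v ∈ divFree := by
  rw [mem_divFree_iff] at hv ⊢
  intro ψ hψ hψc
  have h1 := hv (fun x => ψ (x + h)) (hψ.comp (contDiff_id.add contDiff_const))
    (hψc.comp_homeomorph (Homeomorph.addRight h))
  simp_rw [fderiv_comp_add_right] at h1
  rw [← h1, ← integral_sub_right_eq_self (fun x => fderiv ℝ ψ (x + h) (v x)) h]
  refine integral_congr_ae ?_
  filter_upwards [coeFn_translation h v] with x hx
  rw [hx, sub_add_cancel]

/-- Translations are isometries that preserve the divergence-free fields, and so do their inverses.
The translate of the projection therefore lies in the subspace, with residual orthogonal to it,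
which characterizes the projection of the translate. -/
theorem leray_translation (h : E3) (v : Lp E3 2 (volume : Measure E3)) :
    leray (translation h v) = translation h (leray v) := by
  refine Submodule.eq_starProjection_of_mem_of_inner_eq_zero
    (translation_mem_divFree h (Submodule.starProjection_apply_mem _ _)) fun w hw => ?_
  rw [← map_sub, ← translation_neg h w, LinearIsometry.inner_map_map]
  exact Submodule.starProjection_inner_eq_zero _ _ (translation_mem_divFree (-h) hw)

/-- The Leray projector does not increase translation increments. -/
theorem lintegral_leray_increment_le {f g : E3 → E3} (hf : MemLp f 2 volume)
    (hg : g =ᵐ[volume] leray (hf.toLp f)) (h : E3) :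
    ∫⁻ x, ‖g (x - h) - g x‖ₑ ^ 2 ≤ ∫⁻ x, ‖f (x - h) - f x‖ₑ ^ 2 := by
  set v := hf.toLp f
  have e : ∀ {a : E3 → E3} {b : Lp E3 2 (volume : Measure E3)}, a =ᵐ[volume] b →
      ∫⁻ x, ‖a (x - h) - a x‖ₑ ^ 2 = ‖translation h b - b‖ₑ ^ 2 := by
    intro a b hab
    rw [Lp.enorm_def, eLpNorm_two_sq]
    refine lintegral_congr_ae ?_
    filter_upwards [hab, (measurePreserving_sub_right volume h).quasiMeasurePreserving.ae hab,
      coeFn_translation h b, Lp.coeFn_sub (translation h b) b] with x h1 h2 h3 h4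
    rw [h4, Pi.sub_apply, h3, h1, h2]
  rw [e hg, e hf.coeFn_toLp.symm, ← leray_translation, ← map_sub]
  gcongr
  rw [← ofReal_norm, ← ofReal_norm]
  exact ENNReal.ofReal_le_ofReal (Submodule.norm_starProjection_apply_le _ _)

/-- The divergence of the mollification of a truncated divergence-free field. -/
theorem divergence_mollify_cutoff {v : Lp E3 2 (volume : Measure E3)} (hv : v ∈ divFree)
    {k χ : E3 → ℝ} (hk : ContDiff ℝ (⊤ : ℕ∞) k) (hkc : HasCompactSupport k)
    (hχ : ContDiff ℝ (⊤ : ℕ∞) χ) (hχ1 : ∀ x, ‖χ x‖ ≤ 1)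
    (hχv' : MemLp (fun z => fderiv ℝ χ z (v z)) 2 volume) (x : E3) :
    ∑ i, mollify (partialDeriv i k) (fun z => χ z • v z) x i
      = mollify k (fun z => fderiv ℝ χ z (v z)) x := by
  have hvm : MemLp v 2 (volume : Measure E3) := Lp.memLp v
  have hχv : MemLp (fun z => χ z • v z) 2 (volume : Measure E3) :=
    MemLp.of_le hvm (hχ.continuous.aestronglyMeasurable.smul hvm.1) (.of_forall fun z => by
      rw [norm_smul]; exact mul_le_of_le_one_left (norm_nonneg _) (hχ1 z))
  have hki : ∀ i, MemLp (partialDeriv i k) 2 (volume : Measure E3) := fun i =>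
    (continuous_partialDeriv hk i).memLp_of_hasCompactSupport (hasCompactSupport_partialDeriv hkc i)
  have hint : ∀ i, Integrable (fun z => partialDeriv i k (x - z) • χ z • v z) := fun i =>
    integrable_smul (memLp_sub_left (hki i) x) hχv
  -- The divergence-free condition is tested with `z ↦ k (x - z) * χ z`. The two terms of the
  -- product rule are the two sides of the claim, with the sign coming from `x - z`.
  have hψ : ContDiff ℝ (⊤ : ℕ∞) fun z => k (x - z) * χ z :=
    (hk.comp (contDiff_const.sub contDiff_id)).mul hχ
  have hψc : HasCompactSupport fun z => k (x - z) * χ z :=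
    (hkc.comp_homeomorph (Homeomorph.subLeft x)).mul_right
  have h0 := mem_divFree_iff.1 hv _ hψ hψc
  have hd : ∀ z y, fderiv ℝ (fun z => k (x - z) * χ z) z y
      = k (x - z) * fderiv ℝ χ z y - ∑ i, (partialDeriv i k (x - z) • χ z • y) i := by
    intro z y
    have h1 : HasFDerivAt (fun z => k (x - z)) (-(fderiv ℝ k (x - z))) z := by
      have := (hk.differentiable (by simp) (x - z)).hasFDerivAt.comp z
        ((hasFDerivAt_id z).const_sub x)
      rwa [ContinuousLinearMap.comp_neg, ContinuousLinearMap.comp_id] at this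
    have h2 := (h1.mul (hχ.differentiable (by simp) z).hasFDerivAt).fderiv
    change fderiv ℝ ((fun z => k (x - z)) * χ) z y = _
    rw [h2]
    have hy : y = ∑ i, y i • EuclideanSpace.single i (1 : ℝ) := by
      ext j
      simp [Finset.sum_apply, Pi.single_apply]
    have h3 : fderiv ℝ k (x - z) y = ∑ i, y i * partialDeriv i k (x - z) := by
      conv_lhs => rw [hy]
      rw [map_sum]
      exact Finset.sum_congr rfl fun i _ => by rw [map_smul]; rfl
    simp only [add_apply, smul_apply, smul_eq_mul,
      neg_apply, PiLp.smul_apply, h3]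
    rw [mul_neg, ← sub_eq_add_neg, Finset.mul_sum]
    congr 1
    exact Finset.sum_congr rfl fun i _ => by ring
  have hproj : ∀ i, mollify (partialDeriv i k) (fun z => χ z • v z) x i
      = ∫ z, (partialDeriv i k (x - z) • χ z • v z) i := fun i => by
    rw [mollify_eq_swap]
    exact ((EuclideanSpace.proj (𝕜 := ℝ) i).integral_comp_comm (hint i)).symm
  have hinti : ∀ i, Integrable (fun z => (partialDeriv i k (x - z) • χ z • v z) i) := fun i =>
    (EuclideanSpace.proj (𝕜 := ℝ) i).integrable_comp (hint i)
  simp_rw [hproj]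
  rw [← integral_finsetSum _ fun i _ => hinti i, mollify_eq_swap]
  simp_rw [hd] at h0
  have hsum : Integrable (fun z => ∑ i, (partialDeriv i k (x - z) • χ z • v z) i) :=
    integrable_finsetSum _ fun i _ => hinti i
  have hfd : Integrable (fun z => k (x - z) * fderiv ℝ χ z (v z)) :=
    integrable_smul (memLp_sub_left (hk.continuous.memLp_of_hasCompactSupport hkc) x) hχv'
  rw [integral_sub hfd hsum] at h0
  exact (sub_eq_zero.1 h0).symm

end Leray

/-! ### The velocity tested with divergence-free fields. -/

section VelocityDerivative

variable {T ε : ℝ} {u₀ : E3 → E3} {θ₀ p₀ : E3 → ℝ} {u : ST → E3} {Du : Fin 3 → ST → E3}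
  {θ : ST → ℝ} {Dθ : Fin 3 → ST → ℝ} {p : ST → ℝ}

/-- Strong convergence of the spatial fields gives convergence of the pairings. -/
theorem tendsto_integral_mul_pairing {F : Type*} [NormedAddCommGroup F] [InnerProductSpace ℝ F]
    {f : ST → F} (hf : MemLp f 2 (stMeasure T)) {w : ℕ → E3 → F} {w₀ : E3 → F}
    (hw : ∀ n, MemLp (w n) 2 volume) (hw₀ : MemLp w₀ 2 volume)
    (ht : Tendsto (fun n => eLpNorm (w n - w₀) 2 volume) atTop (𝓝 0)) {k : ℝ → ℝ}
    (hk : MemLp k 2 (timeMeasure T)) :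
    Tendsto (fun n => ∫ t in Ioo 0 T, k t * pairing f (w n) t) atTop
      (𝓝 (∫ t in Ioo 0 T, k t * pairing f w₀ t)) := by
  rw [tendsto_iff_edist_tendsto_0]
  have hb : Tendsto (fun n => eLpNorm f 2 (stMeasure T) *
      (eLpNorm (w n - w₀) 2 volume * eLpNorm k 2 (timeMeasure T))) atTop (𝓝 0) := by
    have := ENNReal.Tendsto.const_mul (a := eLpNorm f 2 (stMeasure T))
      (ENNReal.Tendsto.mul_const (b := eLpNorm k 2 (timeMeasure T)) ht (.inr hk.2.ne))
      (.inr hf.2.ne)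
    simpa using this
  refine tendsto_of_tendsto_of_tendsto_of_le_of_le tendsto_const_nhds hb (fun _ => zero_le)
    fun n => ?_
  change edist _ _ ≤ _
  rw [edist_eq_enorm_sub, integral_mul_pairing hf (hw n) hk, integral_mul_pairing hf hw₀ hk,
    ← integral_sub (integrable_inner hf (memLp_tensor (hw n) hk))
      (integrable_inner hf (memLp_tensor hw₀ hk))]
  simp_rw [← inner_sub_right, ← smul_sub]
  have hd := memLp_tensor ((hw n).sub hw₀) hk
  exact (enorm_integral_inner_le hf.1 hd.1).trans
    (mul_le_mul_right (eLpNorm_tensor_le ((hw n).sub hw₀).1 hk.1) _)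

/-- The time derivative of the velocity, tested with a mollified divergence-free field: the
pressure does not contribute. -/
theorem IsWeakSolution.derivBound_velocity
    (hs : IsWeakSolution T ε u₀ θ₀ p₀ u Du θ Dθ p) {M : ℝ≥0} (hu : BoundedBy T M u Du)
    {v : Lp E3 2 (volume : Measure E3)} (hv : v ∈ divFree)
    {k : E3 → ℝ} (hk : ContDiff ℝ (⊤ : ℕ∞) k) (hkc : HasCompactSupport k) {A : ℝ≥0}
    (hA : M * ∑ i, (∫⁻ x, ‖partialDeriv i k x‖ₑ) * eLpNorm v 2 volume
      + 6 * (eLpNorm k 2 volume * eLpNorm v 2 volume) * M ^ 2 ≤ A) :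
    DerivBound T A (pairing u (mollify k v)) := by
  intro ψ hψ hψc hψT
  -- The bound `Mp` belongs to this one solution and may blow up as `ε ↓ 0`; it must not enter `A`.
  obtain ⟨Mp, hMp⟩ := hs.p_mem.2
  obtain ⟨χ, C, hC0, hχ, hχc, hχ1, hχt, hχd⟩ := exists_cutoff
  have hvm : MemLp v 2 (volume : Measure E3) := Lp.memLp v
  have hk2 : MemLp k 2 (volume : Measure E3) := hk.continuous.memLp_of_hasCompactSupport hkc
  have hkL1 : ∫⁻ x, ‖k x‖ₑ ≠ ∞ := (hk.continuous.integrable_of_hasCompactSupport hkc).2.ne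
  have hχle : ∀ n, eLpNorm (fun x => χ n x • v x) 2 volume ≤ eLpNorm v 2 volume := fun n =>
    eLpNorm_mono fun z => by
      rw [norm_smul]; exact mul_le_of_le_one_left (norm_nonneg _) (hχ1 n z)
  have hχv : ∀ n, MemLp (fun x => χ n x • v x) 2 (volume : Measure E3) := fun n =>
    ⟨(hχ n).continuous.aestronglyMeasurable.smul hvm.1, (hχle n).trans_lt hvm.2⟩
  have hχli : ∀ n, LocallyIntegrable (fun x => χ n x • v x) (volume : Measure E3) := fun n =>
    (hχv n).locallyIntegrable one_le_two
  have hDle : ∀ n, ∀ᵐ x ∂(volume : Measure E3),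
      ‖fderiv ℝ (χ n) x (v x)‖ ≤ (C * (1 / ((n : ℝ) + 1))) * ‖v x‖ := fun n => .of_forall fun x =>
    (ContinuousLinearMap.le_opNorm _ _).trans (by gcongr; exact hχd n x)
  have hDm : ∀ n, MemLp (fun x => fderiv ℝ (χ n) x (v x)) 2 (volume : Measure E3) := fun n =>
    MemLp.of_le_mul hvm ((isBoundedBilinearMap_apply.continuous.comp_aestronglyMeasurable
      (((hχ n).continuous_fderiv (by simp)).aestronglyMeasurable.prodMk hvm.1))) (hDle n)
  have hwm : ∀ n, MemLp (mollify k fun x => χ n x • v x) 2 (volume : Measure E3) := fun n =>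
    ⟨aestronglyMeasurable_mollify hk.continuous (hχv n).1,
      (eLpNorm_mollify_le hk.continuous (hχv n)).trans_lt
        (ENNReal.mul_lt_top hkL1.lt_top (hχv n).2)⟩
  have hw0 : MemLp (mollify k v) 2 (volume : Measure E3) :=
    ⟨aestronglyMeasurable_mollify hk.continuous hvm.1,
      (eLpNorm_mollify_le hk.continuous hvm).trans_lt (ENNReal.mul_lt_top hkL1.lt_top hvm.2)⟩
  have hwt : Tendsto (fun n => eLpNorm ((mollify k fun x => χ n x • v x) - mollify k v) 2 volume)
      atTop (𝓝 0) := by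
    have h1 := ENNReal.Tendsto.const_mul (a := ∫⁻ x, ‖k x‖ₑ) (tendsto_cutoff_smul
      (fun n => (hχ n).continuous) hχ1 hχt hvm) (.inr hkL1)
    rw [mul_zero] at h1
    refine tendsto_of_tendsto_of_tendsto_of_le_of_le tendsto_const_nhds h1 (fun _ => zero_le)
      fun n => ?_
    have e : (mollify k fun x => χ n x • v x) - mollify k v
        = mollify k fun x => χ n x • v x - v x := by
      ext1 x
      simp only [Pi.sub_apply, mollify]
      rw [← integral_sub (integrable_smul hk2 (memLp_sub_left (hχv n) x))
        (integrable_smul hk2 (memLp_sub_left hvm x))]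
      simp_rw [← smul_sub]
    change eLpNorm ((mollify k fun x => χ n x • v x) - mollify k v) 2 volume ≤ _
    rw [e]
    exact eLpNorm_mollify_le hk.continuous ((hχv n).sub hvm)
  have hψ2 : MemLp ψ 2 (timeMeasure T) := memLp_time hψ.continuous hψc
  have hψ2' : MemLp (deriv ψ) 2 (timeMeasure T) :=
    memLp_time (hψ.continuous_deriv (by simp)) hψc.deriv
  have h1 : eLpNorm (fun _ => (1 : ℝ)) 2 (timeMeasure T) ≠ ∞ := (memLp_const _).2.ne
  -- The field `mollify k v` need not have compact support, so `mollify k (χ n • v)` is tested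
  -- instead. Its divergence is the mollification of `∇χ n · v`, of `L²` norm `O(1/n)`; `c n` is the
  -- resulting pressure contribution.
  set c : ℕ → ℝ≥0∞ := fun n => Mp * eLpNorm ψ 2 (timeMeasure T) *
    ((∫⁻ x, ‖k x‖ₑ) * (ENNReal.ofReal (C * (1 / ((n : ℝ) + 1))) * eLpNorm v 2 volume)
      * eLpNorm (fun _ => (1 : ℝ)) 2 (timeMeasure T))
  have hc : Tendsto c atTop (𝓝 0) := by
    have h2 := ENNReal.tendsto_ofReal ((tendsto_one_div_add_atTop_nhds_zero_nat (𝕜 := ℝ)).const_mul C)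
    rw [mul_zero, ENNReal.ofReal_zero] at h2
    have h3 := ENNReal.Tendsto.const_mul (a := Mp * eLpNorm ψ 2 (timeMeasure T))
      (ENNReal.Tendsto.mul_const (b := eLpNorm (fun _ => (1 : ℝ)) 2 (timeMeasure T))
        (ENNReal.Tendsto.const_mul (a := ∫⁻ x, ‖k x‖ₑ)
          (ENNReal.Tendsto.mul_const (b := eLpNorm v 2 volume) h2 (.inr hvm.2.ne)) (.inr hkL1))
        (.inr h1)) (.inr (ENNReal.mul_ne_top (by simp) hψ2.2.ne))
    simpa only [zero_mul, mul_zero] using h3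
  have hbound : ∀ n, ‖∫ t in Ioo 0 T, deriv ψ t * pairing u (mollify k fun x => χ n x • v x) t‖ₑ
      ≤ A * eLpNorm ψ 2 (timeMeasure T) + c n := by
    intro n
    have hsupp : HasCompactSupport fun x => χ n x • v x := (hχc n).smul_right
    refine (hs.enorm_integral_velocity_le hu hMp (contDiff_mollify hk hkc (hχli n))
      (hasCompactSupport_mollify hkc hsupp)
      (W := eLpNorm k 2 volume * eLpNorm v 2 volume) (ENNReal.mul_ne_top hk2.2.ne hvm.2.ne)
      (fun x => (enorm_mollify_le hk2 (hχv n).1 x).trans (mul_le_mul_right (hχle n) _))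
      hψ hψc hψT).trans ?_
    simp_rw [partialDeriv_mollify hk hkc (hχli n),
      divergence_mollify_cutoff hv hk hkc (hχ n) (hχ1 n) (hDm n)]
    refine add_le_add (mul_le_mul_left (le_trans ?_ hA) _) ?_
    · gcongr with i
      exact (eLpNorm_mollify_le (continuous_partialDeriv hk i) (hχv n)).trans
        (mul_le_mul_right (hχle n) _)
    · simp only [c]
      gcongr
      exact (eLpNorm_mollify_le hk.continuous (hDm n)).trans
        (mul_le_mul_right (eLpNorm_le_mul_eLpNorm_of_ae_le_mul (hDle n) 2) _)
  -- In the limit `n → ∞`, at fixed `ψ` and fixed solution, the pressure contribution disappears.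
  have hl := (tendsto_integral_mul_pairing hu.memLp hwm hw0 hwt hψ2').enorm
  have hr : Tendsto (fun n => A * eLpNorm ψ 2 (timeMeasure T) + c n) atTop
      (𝓝 (A * eLpNorm ψ 2 (timeMeasure T) + 0)) := tendsto_const_nhds.add hc
  rw [add_zero] at hr
  exact le_of_tendsto_of_tendsto' hl hr hbound

end VelocityDerivative

/-! ### Uniform bounds from the energy inequality. -/

section Energy

variable {T ε : ℝ} {u₀ : E3 → E3} {θ₀ p₀ : E3 → ℝ} {u : ST → E3} {Du : Fin 3 → ST → E3}
  {θ : ST → ℝ} {Dθ : Fin 3 → ST → ℝ} {p : ST → ℝ}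

theorem MemLinftyL2.section_memLp {F : Type*} [NormedAddCommGroup F] [InnerProductSpace ℝ F]
    {f : ST → F} (hf : MemLinftyL2 T f) :
    ∀ᵐ t ∂(timeMeasure T), MemLp (fun x : E3 => f (t, x)) 2 volume := by
  obtain ⟨C, hC⟩ := hf.2
  exact memLp_section hf.1 hC

theorem ofReal_mul_norm_sq {F : Type*} [NormedAddCommGroup F] {c : ℝ} (hc : 0 ≤ c) (a : F) :
    ENNReal.ofReal (c * ‖a‖ ^ 2) = ENNReal.ofReal c * ‖a‖ₑ ^ 2 := by
  rw [ENNReal.ofReal_mul hc, ENNReal.ofReal_pow (norm_nonneg _), ofReal_norm]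

theorem stMeasure_mono {s t : ℝ} (h : s ≤ t) : stMeasure s ≤ stMeasure t :=
  Measure.restrict_mono (prod_mono (Ioo_subset_Ioo_right h) le_rfl) le_rfl

/-- A bound on almost all shorter slabs is a bound on the slab. -/
theorem lintegral_slab_le_of_ae {f : ST → ℝ≥0∞} {C : ℝ≥0∞}
    (h : ∀ᵐ t ∂(timeMeasure T), ∫⁻ z, f z ∂(stMeasure t) ≤ C) :
    ∫⁻ z, f z ∂(stMeasure T) ≤ C := by
  rcases le_or_gt T 0 with hT | hT
  · have : stMeasure T = 0 := by simp [stMeasure_eq_prod, Ioo_eq_empty (not_lt.2 hT)]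
    simp [this]
  have hlt : ∀ s < T, ∫⁻ z, f z ∂(stMeasure s) ≤ C := by
    intro s hs
    -- The bound holds at almost every time, hence at some `t` beyond `s`, and the slab up to `s` is
    -- contained in the slab up to `t`.
    have hne : (timeMeasure T) (Ioo (max s 0) T) ≠ 0 := by
      rw [timeMeasure, Measure.restrict_apply measurableSet_Ioo, inter_eq_left.2
        (Ioo_subset_Ioo_left (le_max_right _ _)), Real.volume_Ioo]
      simp [hs, hT]
    obtain ⟨t, ht, h2⟩ := (frequently_ae_mem_iff.2 hne).and_eventually h |>.exists
    exact (lintegral_mono' (stMeasure_mono ((le_max_left s 0).trans ht.1.le)) le_rfl).trans h2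
  have hU : (slab T : Set ST) = ⋃ n : ℕ, (slab (T - 1 / ((n : ℝ) + 1)) : Set ST) := by
    ext ⟨t, x⟩
    simp only [slab, Opens.coe_mk, mem_prod, mem_Ioo, mem_univ, and_true, mem_iUnion]
    constructor
    · rintro ⟨h1, h2⟩
      obtain ⟨n, hn⟩ := exists_nat_one_div_lt (sub_pos.2 h2)
      exact ⟨n, h1, by linarith⟩
    · rintro ⟨n, h1, h2⟩
      have : (0 : ℝ) < 1 / ((n : ℝ) + 1) := by positivity
      exact ⟨h1, by linarith⟩
  have hdir : Directed (· ⊆ ·) fun n : ℕ => (slab (T - 1 / ((n : ℝ) + 1)) : Set ST) := by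
    refine directed_of_isDirected_le fun m n hmn => prod_mono (Ioo_subset_Ioo_right ?_) le_rfl
    have : 1 / ((n : ℝ) + 1) ≤ 1 / ((m : ℝ) + 1) := by gcongr
    linarith
  rw [stMeasure, hU, setLIntegral_iUnion_of_directed _ hdir]
  refine iSup_le fun n => hlt _ ?_
  have : (0 : ℝ) < 1 / ((n : ℝ) + 1) := by positivity
  linarith

/-- The consequences of the energy inequality. -/
theorem IsWeakSolution.energy_bounds (hs : IsWeakSolution T ε u₀ θ₀ p₀ u Du θ Dθ p) (hε : 0 < ε)
    {E : ℝ≥0∞} (hE : eLpNorm u₀ 2 volume ^ 2 + eLpNorm θ₀ 2 volume ^ 2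
      + eLpNorm (fun x => √ε * p₀ x) 2 volume ^ 2 ≤ E) :
    (∀ᵐ t ∂(timeMeasure T), eLpNorm (fun x : E3 => u (t, x)) 2 volume ^ 2 ≤ 2 * E ∧
      eLpNorm (fun x : E3 => θ (t, x)) 2 volume ^ 2 ≤ 2 * E) ∧
    ∀ i, eLpNorm (Du i) 2 (stMeasure T) ^ 2 ≤ E ∧ eLpNorm (Dθ i) 2 (stMeasure T) ^ 2 ≤ E := by
  have hE0 : ENNReal.ofReal (∫ x, ((1 / 2 : ℝ) * ‖u₀ x‖ ^ 2 + (1 / 2 : ℝ) * θ₀ x ^ 2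
      + ε / 2 * p₀ x ^ 2)) ≤ E := by
    refine le_trans ?_ hE
    have h1 : ∀ x, ENNReal.ofReal ((1 / 2 : ℝ) * ‖u₀ x‖ ^ 2 + (1 / 2 : ℝ) * θ₀ x ^ 2
        + ε / 2 * p₀ x ^ 2) ≤ ‖u₀ x‖ₑ ^ 2 + ‖θ₀ x‖ₑ ^ 2 + ‖√ε * p₀ x‖ₑ ^ 2 := by
      intro x
      have e1 : ‖u₀ x‖ₑ ^ 2 + ‖θ₀ x‖ₑ ^ 2 + ‖√ε * p₀ x‖ₑ ^ 2
          = ENNReal.ofReal (‖u₀ x‖ ^ 2 + θ₀ x ^ 2 + ε * p₀ x ^ 2) := by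
        rw [ENNReal.ofReal_add (by positivity) (by positivity),
          ENNReal.ofReal_add (by positivity) (by positivity), ENNReal.ofReal_pow (norm_nonneg _),
          ofReal_norm, ← sq_abs (θ₀ x), ENNReal.ofReal_pow (abs_nonneg _), ← Real.norm_eq_abs,
          ofReal_norm]
        congr 1
        rw [← ofReal_norm, ← ENNReal.ofReal_pow (norm_nonneg _), Real.norm_eq_abs, sq_abs, mul_pow,
          Real.sq_sqrt hε.le]
      rw [e1]
      refine ENNReal.ofReal_le_ofReal ?_
      have h1 := sq_nonneg ‖u₀ x‖
      have h2 := sq_nonneg (θ₀ x)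
      have h3 := mul_nonneg hε.le (sq_nonneg (p₀ x))
      linarith
    have hI : Integrable (fun x => (1 / 2 : ℝ) * ‖u₀ x‖ ^ 2 + (1 / 2 : ℝ) * θ₀ x ^ 2
        + ε / 2 * p₀ x ^ 2) volume :=
      (((hs.u₀_memLp.integrable_norm_pow (by norm_num)).const_mul _).add
        (hs.θ₀_memLp.integrable_sq.const_mul _)).add (hs.p₀_memLp.integrable_sq.const_mul _)
    rw [ofReal_integral_eq_lintegral_ofReal hI (.of_forall fun x => by positivity)]
    refine (lintegral_mono h1).trans_eq ?_
    have hp : AEStronglyMeasurable (fun x => √ε * p₀ x) volume := hs.p₀_memLp.1.const_mul _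
    rw [lintegral_add_right' _ (hp.enorm.pow_const 2),
      lintegral_add_right' _ (hs.θ₀_memLp.1.enorm.pow_const 2),
      eLpNorm_two_sq, eLpNorm_two_sq, eLpNorm_two_sq]
  have hJ : ∀ t ≤ T, ∀ i, Integrable (fun z => ‖Du i z‖ ^ 2 + Dθ i z ^ 2) (stMeasure t) :=
    fun t ht i => (((hs.u_mem.grad_memLp i).mono_measure (stMeasure_mono ht)).integrable_norm_pow
      (by norm_num)).add ((hs.θ_mem.grad_memLp i).mono_measure (stMeasure_mono ht)).integrable_sq
  have hmain : ∀ᵐ t ∂(timeMeasure T),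
      (∫⁻ x, ENNReal.ofReal ((1 / 2 : ℝ) * ‖u (t, x)‖ ^ 2 + (1 / 2 : ℝ) * θ (t, x) ^ 2
        + ε / 2 * p (t, x) ^ 2) ≤ E) ∧
      ∫⁻ z, ENNReal.ofReal (∑ i, (‖Du i z‖ ^ 2 + Dθ i z ^ 2)) ∂(stMeasure t) ≤ E := by
    filter_upwards [hs.energy, hs.u_mem.bounded.section_memLp, hs.θ_mem.bounded.section_memLp,
      hs.p_mem.section_memLp, ae_restrict_mem measurableSet_Ioo] with t ht hu hθ hp htT
    -- Integrability is essential here: a Bochner integral of a nonintegrable function is `0` by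
    -- default, and the inequality would then carry no information.
    have hI : Integrable (fun x => (1 / 2 : ℝ) * ‖u (t, x)‖ ^ 2 + (1 / 2 : ℝ) * θ (t, x) ^ 2
        + ε / 2 * p (t, x) ^ 2) volume :=
      (((hu.integrable_norm_pow (by norm_num)).const_mul _).add (hθ.integrable_sq.const_mul _)).add
        (hp.integrable_sq.const_mul _)
    have hI0 : ∀ x, 0 ≤ (1 / 2 : ℝ) * ‖u (t, x)‖ ^ 2 + (1 / 2 : ℝ) * θ (t, x) ^ 2
        + ε / 2 * p (t, x) ^ 2 := fun x => by positivity
    have hJ0 : ∀ z, 0 ≤ ∑ i, (‖Du i z‖ ^ 2 + Dθ i z ^ 2) := fun z => by positivity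
    have hJi := integrable_finsetSum (Finset.univ : Finset (Fin 3)) fun i _ => hJ t htT.2.le i
    rw [← ofReal_integral_eq_lintegral_ofReal hI (.of_forall hI0),
      ← ofReal_integral_eq_lintegral_ofReal hJi (.of_forall hJ0)]
    have a1 := integral_nonneg_of_ae (μ := (volume : Measure E3)) (.of_forall hI0)
    have a2 := integral_nonneg_of_ae (μ := stMeasure t) (.of_forall hJ0)
    exact ⟨(ENNReal.ofReal_le_ofReal (by linarith)).trans hE0,
      (ENNReal.ofReal_le_ofReal (by linarith)).trans hE0⟩
  have hhalf : (2 : ℝ≥0∞) * ENNReal.ofReal (1 / 2) = 1 := by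
    rw [← ENNReal.ofReal_ofNat, ← ENNReal.ofReal_mul (by norm_num)]; norm_num
  constructor
  · filter_upwards [hmain] with t ht
    have key : ∀ g : E3 → ℝ, (∀ x, g x ^ 2 ≤ ‖u (t, x)‖ ^ 2 + θ (t, x) ^ 2) →
        ∫⁻ x, ‖g x‖ₑ ^ 2 ≤ 2 * E := by
      intro g hg
      calc ∫⁻ x, ‖g x‖ₑ ^ 2
          = 2 * ∫⁻ x, ENNReal.ofReal (1 / 2) * ‖g x‖ₑ ^ 2 := by
            rw [lintegral_const_mul' _ _ (by finiteness), ← mul_assoc, hhalf, one_mul]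
        _ ≤ 2 * E := by
            refine mul_le_mul_right (le_trans (lintegral_mono fun x => ?_) ht.1) _
            rw [← ofReal_mul_norm_sq (by norm_num)]
            refine ENNReal.ofReal_le_ofReal ?_
            have h3 := mul_nonneg hε.le (sq_nonneg (p (t, x)))
            have := hg x
            rw [Real.norm_eq_abs, sq_abs]
            linarith
    rw [eLpNorm_two_sq, eLpNorm_two_sq]
    refine ⟨?_, key _ fun x => by linarith [sq_nonneg ‖u (t, x)‖]⟩
    have := key (fun x => ‖u (t, x)‖) fun x => by linarith [sq_nonneg (θ (t, x))]
    simpa only [enorm_norm] using this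
  · intro i
    have hS : ∀ z, ‖Du i z‖ ^ 2 + Dθ i z ^ 2 ≤ ∑ i, (‖Du i z‖ ^ 2 + Dθ i z ^ 2) := fun z =>
      Finset.single_le_sum (f := fun i => ‖Du i z‖ ^ 2 + Dθ i z ^ 2) (fun i _ => by positivity)
        (Finset.mem_univ i)
    rw [eLpNorm_two_sq, eLpNorm_two_sq]
    constructor
    · refine lintegral_slab_le_of_ae ?_
      filter_upwards [hmain] with t ht
      refine le_trans (lintegral_mono fun z => ?_) ht.2
      rw [← ofReal_norm, ← ENNReal.ofReal_pow (norm_nonneg _)]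
      exact ENNReal.ofReal_le_ofReal (by linarith [hS z, sq_nonneg (Dθ i z)])
    · refine lintegral_slab_le_of_ae ?_
      filter_upwards [hmain] with t ht
      refine le_trans (lintegral_mono fun z => ?_) ht.2
      rw [← ofReal_norm, ← ENNReal.ofReal_pow (norm_nonneg _), Real.norm_eq_abs, sq_abs]
      exact ENNReal.ofReal_le_ofReal (by linarith [hS z, sq_nonneg ‖Du i z‖])

/-- The solutions are uniformly bounded for small `ε`. -/
theorem exists_uniform_bound {u₀ε : ℝ → E3 → E3} {θ₀ε p₀ε : ℝ → E3 → ℝ}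
    {uε : ℝ → ST → E3} {Duε : ℝ → Fin 3 → ST → E3}
    {θε : ℝ → ST → ℝ} {Dθε : ℝ → Fin 3 → ST → ℝ} {pε : ℝ → ST → ℝ}
    (hsol : ∀ᶠ ε in 𝓝[>] (0 : ℝ), IsWeakSolution T ε (u₀ε ε) (θ₀ε ε) (p₀ε ε)
      (uε ε) (Duε ε) (θε ε) (Dθε ε) (pε ε))
    (hID : InitialDataConv u₀ε θ₀ε p₀ε u₀ θ₀) :
    ∃ M : ℝ≥0, ∀ᶠ ε in 𝓝[>] (0 : ℝ), BoundedBy T M (uε ε) (Duε ε) ∧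
      BoundedBy T M (θε ε) (Dθε ε) := by
  -- For small `ε` the data `u₀ε`, `θ₀ε` and `√ε p₀ε` are within distance `1` of `u₀`, `θ₀` and `0`.
  set E : ℝ≥0∞ := (1 + eLpNorm u₀ 2 volume) ^ 2 + (1 + eLpNorm θ₀ 2 volume) ^ 2 + 1 ^ 2
  have hEt : E ≠ ∞ := by
    have := hID.u₀_memLp.2.ne
    have := hID.θ₀_memLp.2.ne
    finiteness
  refine ⟨(2 * E + 1).toNNReal, ?_⟩
  have hM : ((2 * E + 1).toNNReal : ℝ≥0∞) = 2 * E + 1 := ENNReal.coe_toNNReal (by finiteness)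
  -- The bound `2 * E + 1` avoids the square root, by the cases `a ≤ 1` and `a ≤ a²`.
  have hle : ∀ a : ℝ≥0∞, a ^ 2 ≤ 2 * E → a ≤ 2 * E + 1 := by
    intro a ha
    rcases le_or_gt a 1 with h | h
    · exact h.trans le_add_self
    · exact (le_self_pow₀ h.le two_ne_zero).trans (ha.trans le_self_add)
  have hE2 : E ≤ 2 * E := le_mul_of_one_le_left zero_le one_le_two
  filter_upwards [hsol, self_mem_nhdsWithin, hID.u_conv.eventually_le_const one_pos,
    hID.θ_conv.eventually_le_const one_pos, hID.p_conv.eventually_le_const one_pos]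
    with ε hs hε h1 h2 h3
  have tri : ∀ {G : Type} [NormedAddCommGroup G] {a b : E3 → G}, MemLp a 2 volume →
      MemLp b 2 volume → eLpNorm (fun x => a x - b x) 2 volume ≤ 1 →
      eLpNorm a 2 volume ≤ 1 + eLpNorm b 2 volume := by
    intro G _ a b ha hb hab
    calc eLpNorm a 2 volume = eLpNorm ((fun x => a x - b x) + b) 2 volume := by
          congr 1; ext x; simp
      _ ≤ _ := (eLpNorm_add_le (ha.1.sub hb.1) hb.1 one_le_two).trans (by gcongr; exact hab)
  obtain ⟨hb, hg⟩ := hs.energy_bounds hε (E := E) (by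
    simp only [E]
    gcongr
    · exact tri hs.u₀_memLp hID.u₀_memLp h1
    · exact tri hs.θ₀_memLp hID.θ₀_memLp h2)
  refine ⟨⟨hs.u_mem.bounded.1, ?_, hs.u_mem.grad_memLp, fun i => ?_⟩,
    ⟨hs.θ_mem.bounded.1, ?_, hs.θ_mem.grad_memLp, fun i => ?_⟩⟩
  · filter_upwards [hb] with t ht
    rw [hM]; exact hle _ ht.1
  · rw [hM]; exact hle _ ((hg i).1.trans hE2)
  · filter_upwards [hb] with t ht
    rw [hM]; exact hle _ ht.2
  · rw [hM]; exact hle _ ((hg i).2.trans hE2)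

end Energy

/-! ### From convergence of distributions to weak convergence of fields and gradients. -/

section WeakConvergence

set_option linter.unusedSectionVars false

variable {T : ℝ} {M : ℝ≥0} {F : Type*} [NormedAddCommGroup F] [InnerProductSpace ℝ F]
  {f g : ST → F} {Df Dg : Fin 3 → ST → F}

theorem BoundedBy.mono {N : ℝ≥0} (h : BoundedBy T M f Df) (hMN : M ≤ N) : BoundedBy T N f Df :=
  have hMN' : (M : ℝ≥0∞) ≤ N := by exact_mod_cast hMN
  ⟨h.meas, h.bound.mono fun _ ht => ht.trans hMN', h.grad_memLp, fun i =>
    (h.grad_bound i).trans hMN'⟩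

theorem FiniteEnergyField.exists_boundedBy (h : FiniteEnergyField T f Df) :
    ∃ N : ℝ≥0, BoundedBy T N f Df := by
  obtain ⟨C, hC⟩ := h.bounded.2
  have hG : ∀ i, eLpNorm (Df i) 2 (stMeasure T) ≠ ∞ := fun i => (h.grad_memLp i).2.ne
  refine ⟨C + ∑ i, (eLpNorm (Df i) 2 (stMeasure T)).toNNReal, h.bounded.1, ?_, h.grad_memLp,
    fun i => ?_⟩
  · filter_upwards [hC] with t ht
    push_cast
    exact ht.trans le_self_add
  · push_cast
    refine le_trans ?_ le_add_self
    simp_rw [ENNReal.coe_toNNReal (hG _)]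
    exact Finset.single_le_sum (f := fun i => eLpNorm (Df i) 2 (stMeasure T))
      (fun _ _ => zero_le) (Finset.mem_univ i)

theorem BoundedBy.sub (hf : BoundedBy T M f Df) (hg : BoundedBy T M g Dg) :
    BoundedBy T (M + M) (fun z => f z - g z) (fun i z => Df i z - Dg i z) := by
  refine ⟨hf.meas.sub hg.meas, ?_, fun i => (hf.grad_memLp i).sub (hg.grad_memLp i), fun i => ?_⟩
  · filter_upwards [hf.bound, hg.bound, memLp_section hf.meas hf.bound,
      memLp_section hg.meas hg.bound] with t h1 h2 h3 h4
    push_cast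
    exact (eLpNorm_sub_le h3.1 h4.1 one_le_two).trans (add_le_add h1 h2)
  · push_cast
    exact (eLpNorm_sub_le (hf.grad_memLp i).1 (hg.grad_memLp i).1 one_le_two).trans
      (add_le_add (hf.grad_bound i) (hg.grad_bound i))

theorem HasWeakGrad.sub (hf : HasWeakGrad T f Df) (hg : HasWeakGrad T g Dg)
    (hfm : MemLp f 2 (stMeasure T)) (hgm : MemLp g 2 (stMeasure T))
    (hDf : ∀ i, MemLp (Df i) 2 (stMeasure T)) (hDg : ∀ i, MemLp (Dg i) 2 (stMeasure T)) :
    HasWeakGrad T (fun z => f z - g z) (fun i z => Df i z - Dg i z) := by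
  intro i ψ
  simp_rw [smul_sub]
  rw [integral_sub (integrable_smul (memLp_spaceDeriv ψ i 2 _) hfm)
    (integrable_smul (memLp_spaceDeriv ψ i 2 _) hgm),
    integral_sub (integrable_smul (memLp_test ψ 2) (hDf i))
    (integrable_smul (memLp_test ψ 2) (hDg i)), hf i ψ, hg i ψ]
  abel

theorem BoundedBy.eLpNorm_le (h : BoundedBy T M f Df) :
    eLpNorm f 2 (stMeasure T)
      ≤ (M * (eLpNorm (fun _ => (1 : ℝ)) 2 (timeMeasure T)).toNNReal : ℝ≥0) := by
  have h1 := eLpNorm_smul_time_le h.meas h.bound (ψ := fun _ => 1) aestronglyMeasurable_const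
  simp only [one_smul] at h1
  rwa [ENNReal.coe_mul, ENNReal.coe_toNNReal (memLp_const _).2.ne]

variable {ι : Type*} {l : Filter ι} {fs : ι → ST → F} {Dfs : ι → Fin 3 → ST → F}

/-- Convergence in the sense of distributions of bounded fields is weak convergence. -/
theorem tendsto_integral_inner_of_boundedBy [CompleteSpace F]
    (hfs : ∀ᶠ n in l, BoundedBy T M (fs n) (Dfs n)) (hf : MemLp f 2 (stMeasure T))
    (h : ∀ φ : 𝓓(slab T, F), Tendsto (fun n => ∫ z, (inner ℝ (fs n z) (φ z) : ℝ) ∂(stMeasure T)) l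
      (𝓝 (∫ z, (inner ℝ (f z) (φ z) : ℝ) ∂(stMeasure T))))
    (hg : MemLp g 2 (stMeasure T)) :
    Tendsto (fun n => ∫ z, (inner ℝ (fs n z) (g z) : ℝ) ∂(stMeasure T)) l
      (𝓝 (∫ z, (inner ℝ (f z) (g z) : ℝ) ∂(stMeasure T))) :=
  tendsto_integral_inner_of_test (μ := (volume : Measure ST)) (Ω := slab T)
    (hfs.mono fun _ hn => hn.memLp) (hfs.mono fun _ hn => hn.eLpNorm_le) hf h hg

/-- Under convergence in the sense of distributions of bounded fields, the gradients converge
weakly. -/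
theorem tendsto_integral_inner_grad [FiniteDimensional ℝ F]
    (hfs : ∀ᶠ n in l, BoundedBy T M (fs n) (Dfs n))
    (hws : ∀ᶠ n in l, HasWeakGrad T (fs n) (Dfs n)) (hf : MemLp f 2 (stMeasure T))
    (hDf : ∀ i, MemLp (Df i) 2 (stMeasure T)) (hw : HasWeakGrad T f Df)
    (h : ∀ φ : 𝓓(slab T, F), Tendsto (fun n => ∫ z, (inner ℝ (fs n z) (φ z) : ℝ) ∂(stMeasure T)) l
      (𝓝 (∫ z, (inner ℝ (f z) (φ z) : ℝ) ∂(stMeasure T)))) (i : Fin 3)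
    (hg : MemLp g 2 (stMeasure T)) :
    Tendsto (fun n => ∫ z, (inner ℝ (Dfs n i z) (g z) : ℝ) ∂(stMeasure T)) l
      (𝓝 (∫ z, (inner ℝ (Df i z) (g z) : ℝ) ∂(stMeasure T))) := by
  have := FiniteDimensional.complete ℝ F
  refine tendsto_integral_inner_of_test (μ := (volume : Measure ST)) (Ω := slab T)
    (hfs.mono fun _ hn => hn.grad_memLp i) (hfs.mono fun _ hn => hn.grad_bound i) (hDf i)
    (fun φ => ?_) hg
  have h1 := (tendsto_integral_inner_of_boundedBy hfs hf h (memLp_spaceDeriv φ i 2 _)).neg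
  rw [hw.integral_inner hf hDf i φ, neg_neg] at h1
  refine h1.congr' ?_
  filter_upwards [hfs, hws] with n h2 h3
  rw [h3.integral_inner h2.memLp h2.grad_memLp i φ, neg_neg]
  rfl

end WeakConvergence

/-! ### Strong convergence in time of the pairings. -/

section PairingConvergence

variable {T : ℝ} {M A : ℝ≥0} {F : Type*} [NormedAddCommGroup F] [InnerProductSpace ℝ F]
  {f : ℕ → ST → F} {Df : ℕ → Fin 3 → ST → F} {f₀ : ST → F} {Df₀ : Fin 3 → ST → F}

theorem integral_mul_pairing_sub {f g : ST → F} (hf : MemLp f 2 (stMeasure T))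
    (hg : MemLp g 2 (stMeasure T)) {w : E3 → F} (hw : MemLp w 2 volume) {k : ℝ → ℝ}
    (hk : MemLp k 2 (timeMeasure T)) :
    ∫ t in Ioo 0 T, k t * pairing (fun z => f z - g z) w t
      = (∫ t in Ioo 0 T, k t * pairing f w t) - ∫ t in Ioo 0 T, k t * pairing g w t := by
  have hkw := memLp_tensor hw hk
  rw [integral_mul_pairing (f := fun z => f z - g z) (hf.sub hg) hw hk, integral_mul_pairing hf hw hk,
    integral_mul_pairing hg hw hk, ← integral_sub (integrable_inner hf hkw)
    (integrable_inner hg hkw)]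
  simp_rw [inner_sub_left]

/-- The pairings of a weakly convergent sequence with a fixed field converge strongly, if their
time derivatives are bounded. -/
theorem tendsto_lintegral_pairing_sub (hf : ∀ n, BoundedBy T M (f n) (Df n))
    (hf₀ : BoundedBy T M f₀ Df₀)
    (hweak : ∀ g : ST → F, MemLp g 2 (stMeasure T) →
      Tendsto (fun n => ∫ z, (inner ℝ (f n z) (g z) : ℝ) ∂(stMeasure T)) atTop
        (𝓝 (∫ z, (inner ℝ (f₀ z) (g z) : ℝ) ∂(stMeasure T))))
    {w : E3 → F} (hw : MemLp w 2 volume) (hd : ∀ n, DerivBound T A (pairing (f n) w)) :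
    Tendsto (fun n => ∫⁻ t in Ioo 0 T, ‖pairing (fun z => f n z - f₀ z) w t‖ₑ ^ 2) atTop
      (𝓝 0) := by
  have hlim : ∀ {k : ℝ → ℝ}, MemLp k 2 (timeMeasure T) →
      Tendsto (fun n => ∫ t in Ioo 0 T, k t * pairing (f n) w t) atTop
        (𝓝 (∫ t in Ioo 0 T, k t * pairing f₀ w t)) := by
    intro k hk
    rw [integral_mul_pairing hf₀.memLp hw hk]
    refine (hweak _ (memLp_tensor hw hk)).congr fun n => ?_
    rw [integral_mul_pairing (hf n).memLp hw hk]
  have hwt : eLpNorm w 2 volume ≠ ∞ := hw.2.ne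
  -- One `A` is for the sequence and one for its limit, whose pairing inherits the derivative bound
  -- by weak convergence.
  refine tendsto_lintegral_sq_of_derivBound (A := A + A)
    (M := (M + M) * (eLpNorm w 2 volume).toNNReal) (fun n => ?_) (fun n => ?_) (fun n => ?_) ?_
  · exact aestronglyMeasurable_pairing ((hf n).sub hf₀).meas hw.1
  · have hs := (hf n).sub hf₀
    filter_upwards [hs.bound, memLp_section hs.meas hs.bound] with t h1 h2
    refine (enorm_pairing_le h2.1 hw.1).trans ?_
    rw [ENNReal.coe_mul, ENNReal.coe_toNNReal hwt]
    gcongr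
  · intro ψ hψ hψc hψT
    have hψ' : MemLp (deriv ψ) 2 (timeMeasure T) :=
      memLp_time (hψ.continuous_deriv (by simp)) hψc.deriv
    rw [integral_mul_pairing_sub (hf n).memLp hf₀.memLp hw hψ', ENNReal.coe_add, add_mul]
    refine enorm_sub_le.trans (add_le_add (hd n ψ hψ hψc hψT) ?_)
    exact le_of_tendsto' (hlim hψ').enorm fun n => hd n ψ hψ hψc hψT
  · intro k hk hkc
    have hk2 : MemLp k 2 (timeMeasure T) := memLp_time hk hkc
    have h1 := (hlim hk2).sub_const (∫ t in Ioo 0 T, k t * pairing f₀ w t)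
    rw [sub_self] at h1
    refine h1.congr fun n => ?_
    rw [integral_mul_pairing_sub (hf n).memLp hf₀.memLp hw hk2]

end PairingConvergence

/-! ### Strong convergence of the temperature and of the projected velocity. -/

section Temperature

variable {T : ℝ} {M : ℝ≥0} {e : ℕ → ℝ} {u₀ : ℕ → E3 → E3} {θ₀ p₀ : ℕ → E3 → ℝ}
  {u : ℕ → ST → E3} {Du : ℕ → Fin 3 → ST → E3} {θ : ℕ → ST → ℝ} {Dθ : ℕ → Fin 3 → ST → ℝ}
  {p : ℕ → ST → ℝ} {v : ST → E3} {Dv : Fin 3 → ST → E3} {η : ST → ℝ} {Dη : Fin 3 → ST → ℝ}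

/-- Strong convergence of the temperature. -/
theorem tendsto_temperature
    (hs : ∀ n, IsWeakSolution T (e n) (u₀ n) (θ₀ n) (p₀ n) (u n) (Du n) (θ n) (Dθ n) (p n))
    (hu : ∀ n, BoundedBy T M (u n) (Du n)) (hθ : ∀ n, BoundedBy T M (θ n) (Dθ n))
    (hη : BoundedBy T M η Dη) (hη' : HasWeakGrad T η Dη)
    (hweak : ∀ g : ST → ℝ, MemLp g 2 (stMeasure T) →
      Tendsto (fun n => ∫ z, (inner ℝ (θ n z) (g z) : ℝ) ∂(stMeasure T)) atTop
        (𝓝 (∫ z, (inner ℝ (η z) (g z) : ℝ) ∂(stMeasure T))))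
    {K : Set E3} (hK : IsCompact K) :
    Tendsto (fun n => ∫⁻ t in Ioo 0 T,
      (eLpNorm (fun x => θ n (t, x) - η (t, x)) 2 (volume.restrict K)) ^ 2) atTop (𝓝 0) := by
  have hb := fun n => (hθ n).sub hη
  refine tendsto_lintegral_eLpNorm_restrict (w := fun n t x => θ n (t, x) - η (t, x))
    (M := M + M) (A := (∑ _i : Fin 3, (M + M)) ^ 2) (D := fun n => increment fun z => θ n z - η z)
    (fun n => (memLp_section (hb n).meas (hb n).bound).and (hb n).bound)
    (fun n => .of_forall fun t h => le_rfl) (fun n => aemeasurable_increment (hb n).meas)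
    (fun n h => ?_) (fun k hk hkc y => ?_) hK
  · refine (lintegral_increment_le (hb n).memLp (hb n).grad_memLp
      ((hs n).θ_mem.hasWeakGrad.sub hη' (hθ n).memLp hη.memLp (hθ n).grad_memLp
        hη.grad_memLp) h).trans ?_
    push_cast
    gcongr with i
    simpa using (hb n).grad_bound i
  -- The mollification at `y` is the pairing with the reflected and shifted kernel, a legitimate
  -- test function for the temperature equation.
  · set w : E3 → ℝ := fun x => k (y - x)
    have hw : ContDiff ℝ (⊤ : ℕ∞) w := hk.comp (contDiff_const.sub contDiff_id)
    have hwc : HasCompactSupport w := hkc.comp_homeomorph (Homeomorph.subLeft y)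
    have hw2 : MemLp w 2 volume := hw.continuous.memLp_of_hasCompactSupport hwc
    have he : ∀ n t, mollify k (fun x => θ n (t, x) - η (t, x)) y
        = pairing (fun z => θ n z - η z) w t := by
      intro n t
      rw [mollify_eq_swap, pairing]
      refine integral_congr_ae (.of_forall fun z => ?_)
      simp [w]
    simp_rw [he]
    refine ⟨fun n => aestronglyMeasurable_pairing (hb n).meas hw2.1, ?_⟩
    obtain ⟨C, hC⟩ := hw.continuous.bounded_above_of_compact_support hwc
    have hWt : ∀ x, ‖w x‖ₑ ≤ ENNReal.ofReal C := fun x => by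
      rw [← ofReal_norm]; exact ENNReal.ofReal_le_ofReal (hC x)
    have hpd : ∀ i, eLpNorm (partialDeriv i w) 2 volume ≠ ∞ := fun i =>
      ((continuous_partialDeriv hw i).memLp_of_hasCompactSupport
        (hasCompactSupport_partialDeriv hwc i)).2.ne
    have hA : M * ∑ i, eLpNorm (partialDeriv i w) 2 volume + 6 * ENNReal.ofReal C * M ^ 2 ≠ ∞ := by
      have := ENNReal.sum_ne_top.2 fun i (_ : i ∈ Finset.univ) => hpd i
      finiteness
    exact tendsto_lintegral_pairing_sub hθ hη hweak hw2 fun n =>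
      (hs n).derivBound_temperature (hu n) (hθ n) hw hwc ENNReal.ofReal_ne_top hWt
        (A := (M * ∑ i, eLpNorm (partialDeriv i w) 2 volume
          + 6 * ENNReal.ofReal C * M ^ 2).toNNReal) (ENNReal.coe_toNNReal hA).ge

/-- The pairings of the velocities with a divergence-free field converge strongly. -/
theorem tendsto_velocity_pairing
    (hs : ∀ n, IsWeakSolution T (e n) (u₀ n) (θ₀ n) (p₀ n) (u n) (Du n) (θ n) (Dθ n) (p n))
    (hu : ∀ n, BoundedBy T M (u n) (Du n)) (hv : BoundedBy T M v Dv)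
    (hweak : ∀ g : ST → E3, MemLp g 2 (stMeasure T) →
      Tendsto (fun n => ∫ z, (inner ℝ (u n z) (g z) : ℝ) ∂(stMeasure T)) atTop
        (𝓝 (∫ z, (inner ℝ (v z) (g z) : ℝ) ∂(stMeasure T))))
    {a : Lp E3 2 (volume : Measure E3)} (ha : a ∈ divFree) :
    Tendsto (fun n => ∫⁻ t in Ioo 0 T, ‖pairing (fun z => u n z - v z) a t‖ₑ ^ 2) atTop
      (𝓝 0) := by
  have ham : MemLp a 2 (volume : Measure E3) := Lp.memLp a
  have hb := fun n => (hu n).sub hv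
  rw [ENNReal.tendsto_nhds_zero]
  intro ε hε
  obtain ⟨δ, hδ0, hδ⟩ : ∃ δ : ℝ≥0∞, 0 < δ ∧
      2 * (((M + M : ℝ≥0) * δ) ^ 2 * ENNReal.ofReal T) ≤ ε / 2 := by
    have h1 : Tendsto (fun δ : ℝ≥0∞ => 2 * (((M + M : ℝ≥0) * δ) ^ 2 * ENNReal.ofReal T)) (𝓝[>] 0)
        (𝓝 0) := by
      have h3 := ENNReal.Tendsto.const_mul (a := 2) (ENNReal.Tendsto.mul_const
        (b := ENNReal.ofReal T) (ENNReal.Tendsto.pow (n := 2)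
          (ENNReal.Tendsto.const_mul (a := ((M + M : ℝ≥0) : ℝ≥0∞)) (tendsto_id (α := ℝ≥0∞) (x := 𝓝 0)) (.inr (by simp))))
          (.inr (by simp))) (.inr (by norm_num))
      simp only [mul_zero, ne_eq, OfNat.ofNat_ne_zero, not_false_eq_true, zero_pow,
        zero_mul, id] at h3
      exact h3.mono_left nhdsWithin_le_nhds
    obtain ⟨δ, h3, h4⟩ :=
      ((h1.eventually_le_const (ENNReal.half_pos hε.ne')).and self_mem_nhdsWithin).exists
    exact ⟨δ, h4, h3⟩
  -- The derivative bound is available for mollifications of `a` only. Replacing `a` by one within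
  -- `δ` changes the pairing by at most `(M + M) * δ` at almost every time, uniformly in `n`.
  obtain ⟨k, hk, hkc, hka⟩ := exists_eLpNorm_mollify_sub_le ham hδ0
  have hk2 : MemLp k 2 (volume : Measure E3) := hk.continuous.memLp_of_hasCompactSupport hkc
  have hkL : ∫⁻ x, ‖k x‖ₑ ≠ ∞ := (hk.continuous.integrable_of_hasCompactSupport hkc).2.ne
  have hm : MemLp (mollify k a) 2 volume := ⟨aestronglyMeasurable_mollify hk.continuous ham.1,
    (eLpNorm_mollify_le hk.continuous ham).trans_lt (ENNReal.mul_lt_top hkL.lt_top ham.2)⟩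
  have hA : M * ∑ i, (∫⁻ x, ‖partialDeriv i k x‖ₑ) * eLpNorm a 2 volume
      + 6 * (eLpNorm k 2 volume * eLpNorm a 2 volume) * M ^ 2 ≠ ∞ := by
    have h1 := ham.2.ne
    have h2 := hk2.2.ne
    have := ENNReal.sum_ne_top.2 fun i (_ : i ∈ Finset.univ) =>
      ENNReal.mul_ne_top ((continuous_partialDeriv hk i).integrable_of_hasCompactSupport (μ := volume)
        (hasCompactSupport_partialDeriv hkc i)).2.ne h1
    finiteness
  have hlim := tendsto_lintegral_pairing_sub hu hv hweak hm fun n =>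
    (hs n).derivBound_velocity (hu n) ha hk hkc (A := ENNReal.toNNReal _)
      (ENNReal.coe_toNNReal hA).ge
  have hlim2 := ENNReal.Tendsto.const_mul (a := 2) hlim (.inr (by norm_num))
  rw [mul_zero] at hlim2
  filter_upwards [hlim2.eventually_le_const (ENNReal.half_pos hε.ne')] with n hn
  calc ∫⁻ t in Ioo 0 T, ‖pairing (fun z => u n z - v z) a t‖ₑ ^ 2
      ≤ ∫⁻ t in Ioo 0 T, (2 * ‖pairing (fun z => u n z - v z) (mollify k a) t‖ₑ ^ 2
          + 2 * ((M + M : ℝ≥0) * δ) ^ 2) := by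
        refine lintegral_mono_ae ?_
        filter_upwards [(hb n).bound, memLp_section (hb n).meas (hb n).bound] with t h1 h2
        have e1 : pairing (fun z => u n z - v z) a t
            = pairing (fun z => u n z - v z) (mollify k a) t
              - pairing (fun z => u n z - v z) (mollify k a - a) t := by
          simp only [pairing]
          rw [← integral_sub (integrable_inner h2 hm) (integrable_inner h2 (hm.sub ham))]
          refine integral_congr_ae (.of_forall fun x => ?_)
          simp only [Pi.sub_apply]
          rw [← inner_sub_right, sub_sub_cancel]
        rw [e1]
        refine (pow_le_pow_left₀ zero_le enorm_sub_le 2).trans ((ENNReal_add_sq_le _ _).trans ?_)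
        gcongr
        exact (enorm_pairing_le h2.1 (hm.sub ham).1).trans (mul_le_mul' h1 hka)
    _ = 2 * (∫⁻ t in Ioo 0 T, ‖pairing (fun z => u n z - v z) (mollify k a) t‖ₑ ^ 2)
          + 2 * (((M + M : ℝ≥0) * δ) ^ 2 * ENNReal.ofReal T) := by
        rw [lintegral_add_right _ measurable_const, lintegral_const,
          lintegral_const_mul' _ _ (by norm_num)]
        simp [mul_assoc]
    _ ≤ ε / 2 + ε / 2 := add_le_add hn hδ
    _ = ε := ENNReal.add_halves ε

/-- Linearity of the projection, at the times when both slices are in `L²`; at other times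
`lerayField` takes the default value `0`. -/
theorem lerayField_sub_ae {u v : ST → E3} {t : ℝ}
    (hu : MemLp (fun x : E3 => u (t, x)) 2 volume) (hv : MemLp (fun x : E3 => v (t, x)) 2 volume) :
    (fun x => lerayField u t x - lerayField v t x) =ᵐ[volume]
      leray ((hu.sub hv).toLp fun x : E3 => u (t, x) - v (t, x)) := by
  have e1 : leray ((hu.sub hv).toLp fun x : E3 => u (t, x) - v (t, x))
      = leray (hu.toLp _) - leray (hv.toLp _) := by
    rw [← map_sub]; rfl
  rw [e1, lerayField, lerayField, dif_pos hu, dif_pos hv]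
  exact (Lp.coeFn_sub _ _).symm

theorem eLpNorm_leray_le (a : Lp E3 2 (volume : Measure E3)) :
    eLpNorm (leray a) 2 volume ≤ eLpNorm a 2 volume := by
  rw [← Lp.enorm_def, ← Lp.enorm_def, ← ofReal_norm, ← ofReal_norm]
  exact ENNReal.ofReal_le_ofReal (Submodule.norm_starProjection_apply_le _ _)

/-- Strong convergence of the divergence-free part of the velocity. -/
theorem tendsto_velocity
    (hs : ∀ n, IsWeakSolution T (e n) (u₀ n) (θ₀ n) (p₀ n) (u n) (Du n) (θ n) (Dθ n) (p n))
    (hu : ∀ n, BoundedBy T M (u n) (Du n)) (hv : BoundedBy T M v Dv) (hv' : HasWeakGrad T v Dv)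
    (hweak : ∀ g : ST → E3, MemLp g 2 (stMeasure T) →
      Tendsto (fun n => ∫ z, (inner ℝ (u n z) (g z) : ℝ) ∂(stMeasure T)) atTop
        (𝓝 (∫ z, (inner ℝ (v z) (g z) : ℝ) ∂(stMeasure T))))
    {K : Set E3} (hK : IsCompact K) :
    Tendsto (fun n => ∫⁻ t in Ioo 0 T,
      (eLpNorm (fun x => lerayField (u n) t x - lerayField v t x) 2 (volume.restrict K)) ^ 2)
      atTop (𝓝 0) := by
  have hb := fun n => (hu n).sub hv
  have hsec : ∀ n, ∀ᵐ t ∂(timeMeasure T), ∃ h : MemLp (fun x : E3 => u n (t, x) - v (t, x)) 2 volume,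
      (fun x => lerayField (u n) t x - lerayField v t x) =ᵐ[volume] leray (h.toLp _) := by
    intro n
    filter_upwards [memLp_section (hu n).meas (hu n).bound, memLp_section hv.meas hv.bound]
      with t h1 h2
    exact ⟨h1.sub h2, lerayField_sub_ae h1 h2⟩
  refine tendsto_lintegral_eLpNorm_restrict
    (w := fun n t x => lerayField (u n) t x - lerayField v t x)
    (M := M + M) (A := (∑ _i : Fin 3, (M + M)) ^ 2) (D := fun n => increment fun z => u n z - v z)
    (fun n => ?_) (fun n => ?_) (fun n => aemeasurable_increment (hb n).meas)
    (fun n h => ?_) (fun k hk hkc y => ?_) hK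
  · filter_upwards [hsec n, (hb n).bound] with t ⟨h1, h2⟩ h3
    refine ⟨(memLp_congr_ae h2).2 (Lp.memLp _), ?_⟩
    rw [eLpNorm_congr_ae h2]
    refine (eLpNorm_leray_le _).trans ?_
    rwa [eLpNorm_congr_ae h1.coeFn_toLp]
  -- The increments of the projected difference are dominated by those of `u n - v`, which the
  -- gradient bound controls.
  · filter_upwards [hsec n] with t ⟨h1, h2⟩ h
    exact lintegral_leray_increment_le h1 h2 h
  · refine (lintegral_increment_le (hb n).memLp (hb n).grad_memLp
      ((hs n).u_mem.hasWeakGrad.sub hv' (hu n).memLp hv.memLp (hu n).grad_memLp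
        hv.grad_memLp) h).trans ?_
    push_cast
    gcongr with i
    simpa using (hb n).grad_bound i
  · have hk2 : MemLp (fun x => k (y - x)) 2 volume :=
      memLp_sub_left (hk.continuous.memLp_of_hasCompactSupport hkc) y
    have hc : ∀ i : Fin 3, MemLp (fun x => k (y - x) • (EuclideanSpace.single i 1 : E3)) 2 volume :=
      fun i => ⟨hk2.1.smul_const _, ((ContinuousLinearMap.toSpanSingleton ℝ
        (EuclideanSpace.single i 1 : E3)).comp_memLp' hk2).2⟩
    -- Self-adjointness moves the projector from the velocity to the kernel: the `i`-th coordinate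
    -- of the mollified `P(u n - v)` at `y` is the pairing of `u n - v` with the divergence-free
    -- field `a i`.
    let a : Fin 3 → Lp E3 2 (volume : Measure E3) := fun i => leray ((hc i).toLp _)
    have ha : ∀ i, a i ∈ divFree := fun i => Submodule.starProjection_apply_mem _ _
    have ham : ∀ i, AEStronglyMeasurable (a i) volume := fun i => Lp.aestronglyMeasurable _
    have he : ∀ n, ∀ᵐ t ∂(timeMeasure T),
        mollify k (fun x => lerayField (u n) t x - lerayField v t x) y
          = ∑ i, pairing (fun z => u n z - v z) (a i) t • (EuclideanSpace.single i 1 : E3) := by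
      intro n
      filter_upwards [hsec n] with t ⟨h1, h2⟩
      have hm := (memLp_congr_ae h2).2 (Lp.memLp _)
      have hcoord : ∀ i : Fin 3, pairing (fun z => u n z - v z) (a i) t
          = mollify k (fun x => lerayField (u n) t x - lerayField v t x) y i := by
        intro i
        have e1 : pairing (fun z => u n z - v z) (a i) t = inner ℝ (h1.toLp _) (a i) := by
          rw [L2.inner_def]
          refine integral_congr_ae ?_
          filter_upwards [h1.coeFn_toLp] with x hx
          rw [hx]
        rw [e1, show inner ℝ (h1.toLp _) (a i) = inner ℝ (leray (h1.toLp _)) ((hc i).toLp _) from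
          (Submodule.inner_starProjection_left_eq_right _ _ _).symm, L2.inner_def, mollify_eq_swap]
        have e2 := inner_integral_left (integrable_smul hk2 hm) (EuclideanSpace.single i 1 : E3)
        rw [EuclideanSpace.inner_single_right] at e2
        simp only [one_mul, conj_trivial] at e2
        rw [← e2]
        refine integral_congr_ae ?_
        filter_upwards [h2, (hc i).coeFn_toLp] with x h3 h4
        rw [h4, inner_smul_left, inner_smul_right, h3]
        rfl
      simp_rw [hcoord]
      ext j
      simp [Finset.sum_apply, Pi.single_apply]
    refine ⟨fun n => ?_, ?_⟩
    -- Measurability in time, not evident for a projection taken time by time, is inherited from the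
    -- pairings.
    · refine AEStronglyMeasurable.congr ?_ ((he n).mono fun t ht => ht.symm)
      exact Finset.aestronglyMeasurable_fun_sum _ fun i _ =>
        (aestronglyMeasurable_pairing (hb n).meas (ham i)).smul_const _
    · have hsum := tendsto_finsetSum (Finset.univ : Finset (Fin 3)) fun i _ =>
        tendsto_velocity_pairing hs hu hv hweak (ha i)
      simp only [Finset.sum_const_zero] at hsum
      refine hsum.congr fun n => ?_
      rw [← lintegral_finsetSum' _ fun i _ =>
        (aestronglyMeasurable_pairing (hb n).meas (ham i)).enorm.pow_const 2]
      refine lintegral_congr_ae ?_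
      filter_upwards [he n] with t ht
      rw [ht, ← ofReal_norm, ← ENNReal.ofReal_pow (norm_nonneg _), EuclideanSpace.norm_sq_eq,
        ENNReal.ofReal_sum_of_nonneg fun _ _ => sq_nonneg _]
      refine Finset.sum_congr rfl fun i _ => ?_
      rw [ENNReal.ofReal_pow (norm_nonneg _), ofReal_norm]
      congr 2
      simp [Finset.sum_apply, Pi.single_apply]

end Temperature

/-! ### Weak compactness and existence of limit profiles. -/

section WeakCompactness

/-- A bounded sequence in a separable Hilbert space has a weakly convergent subsequence. -/
theorem exists_subseq_tendsto_inner {H : Type*} [NormedAddCommGroup H] [InnerProductSpace ℝ H]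
    [CompleteSpace H] [SeparableSpace H] {x : ℕ → H} {C : ℝ} (hx : ∀ n, ‖x n‖ ≤ C) :
    ∃ φ : ℕ → ℕ, StrictMono φ ∧ ∃ y : H, ∀ h,
      Tendsto (fun n => (inner ℝ (x (φ n)) h : ℝ)) atTop (𝓝 (inner ℝ y h)) := by
  -- The Riesz isometry carries the sequence to the dual, whose balls are sequentially weak-*
  -- compact by separability; it carries the limit back.
  let L : H → WeakDual ℝ H := fun a => StrongDual.toWeakDual (InnerProductSpace.toDual ℝ H a)
  obtain ⟨y, -, φ, hφ, hy⟩ := WeakDual.isSeqCompact_closedBall (𝕜 := ℝ) (E := H) 0 C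
    (x := fun n => L (x n)) fun n => by
      change InnerProductSpace.toDual ℝ H (x n) ∈ Metric.closedBall 0 C
      simpa using hx n
  refine ⟨φ, hφ, (InnerProductSpace.toDual ℝ H).symm (WeakDual.toStrongDual y), fun h => ?_⟩
  rw [InnerProductSpace.toDual_symm_apply]
  exact ((WeakDual.eval_continuous h).tendsto y).comp hy

/-- A field and its three derivatives need a common subsequence; for a finite family successive
extractions suffice, without a diagonal argument. -/
theorem exists_subseq_tendsto_inner_family {H : Type*} [NormedAddCommGroup H]
    [InnerProductSpace ℝ H] [CompleteSpace H] [SeparableSpace H] {ι : Type*} [Fintype ι]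
    {x : ι → ℕ → H} {C : ℝ} (hx : ∀ i n, ‖x i n‖ ≤ C) :
    ∃ φ : ℕ → ℕ, StrictMono φ ∧ ∃ y : ι → H, ∀ i h,
      Tendsto (fun n => (inner ℝ (x i (φ n)) h : ℝ)) atTop (𝓝 (inner ℝ (y i) h)) := by
  classical
  have key : ∀ s : Finset ι, ∃ φ : ℕ → ℕ, StrictMono φ ∧ ∀ i ∈ s, ∃ y : H, ∀ h,
      Tendsto (fun n => (inner ℝ (x i (φ n)) h : ℝ)) atTop (𝓝 (inner ℝ y h)) := by
    intro s
    induction s using Finset.induction_on with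
    | empty => exact ⟨id, strictMono_id, by simp⟩
    | insert j s _ ih =>
      obtain ⟨φ, hφ, h1⟩ := ih
      obtain ⟨χ, hχ, z, hz⟩ := exists_subseq_tendsto_inner (x := fun n => x j (φ n))
        fun n => hx j (φ n)
      refine ⟨φ ∘ χ, hφ.comp hχ, fun i hi => ?_⟩
      rcases Finset.mem_insert.1 hi with rfl | hi
      · exact ⟨z, hz⟩
      · obtain ⟨y, hy⟩ := h1 i hi
        exact ⟨y, fun h => (hy h).comp hχ.tendsto_atTop⟩
  obtain ⟨φ, hφ, h⟩ := key Finset.univ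
  choose y hy using fun i => h i (Finset.mem_univ i)
  exact ⟨φ, hφ, y, hy⟩

variable {T : ℝ} {M : ℝ≥0} {F : Type*} [NormedAddCommGroup F] [InnerProductSpace ℝ F]
  {fs : ℕ → ST → F} {Dfs : ℕ → Fin 3 → ST → F} {f : ST → F} {Df : Fin 3 → ST → F}

/-- Bounds in `L^∞(0,T;L²)` pass to weak limits in `L²`. -/
theorem ae_eLpNorm_le_of_tendsto (h : ∀ n, BoundedBy T M (fs n) (Dfs n))
    (hf : MemLp f 2 (stMeasure T))
    (hweak : ∀ g : ST → F, MemLp g 2 (stMeasure T) →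
      Tendsto (fun n => ∫ z, (inner ℝ (fs n z) (g z) : ℝ) ∂(stMeasure T)) atTop
        (𝓝 (∫ z, (inner ℝ (f z) (g z) : ℝ) ∂(stMeasure T)))) :
    ∀ᵐ t ∂(timeMeasure T), eLpNorm (fun x : E3 => f (t, x)) 2 volume ≤ M := by
  have hm : AEMeasurable (fun t => ∫⁻ x, ‖f (t, x)‖ₑ ^ 2) (timeMeasure T) := by
    have := hf.1.enorm.pow_const 2
    rw [stMeasure_eq_prod] at this
    exact this.lintegral_prod_right'
  have hle : (fun t => ∫⁻ x, ‖f (t, x)‖ₑ ^ 2) ≤ᵐ[timeMeasure T] fun _ => (M : ℝ≥0∞) ^ 2 := by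
    refine ae_le_of_forall_setLIntegral_le_of_sigmaFinite₀ hm fun s hs _ => ?_
    -- The pointwise bound is tested on an arbitrary measurable set of times `s`: the limit is
    -- paired with its own restriction `ψ f`, an admissible element of `L²`.
    set ψ : ℝ → ℝ := s.indicator fun _ => 1 with hψ
    have hψm : AEStronglyMeasurable ψ (timeMeasure T) :=
      aestronglyMeasurable_const.indicator hs
    have hψ1 : ∀ t, ‖ψ t‖ₑ ^ 2 = s.indicator (fun _ => 1) t := fun t => by
      by_cases ht : t ∈ s <;> simp [hψ, ht]
    have hψ2 : ∀ t, ψ t * ψ t = ψ t := fun t => by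
      by_cases ht : t ∈ s <;> simp [hψ, ht]
    have hgm : AEStronglyMeasurable (fun z : ST => ψ z.1 • f z) (stMeasure T) :=
      (aestronglyMeasurable_fst hψm).smul hf.1
    have hg : MemLp (fun z : ST => ψ z.1 • f z) 2 (stMeasure T) :=
      MemLp.of_le hf hgm (.of_forall fun z => by
        by_cases ht : z.1 ∈ s <;> simp [hψ, ht])
    set N := eLpNorm (fun z : ST => ψ z.1 • f z) 2 (stMeasure T)
    have hN : N ^ 2 = ∫⁻ t in s, ∫⁻ x, ‖f (t, x)‖ₑ ^ 2 ∂volume ∂(timeMeasure T) := by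
      rw [eLpNorm_two_sq, lintegral_slab (hgm.enorm.pow_const 2), ← lintegral_indicator hs]
      refine lintegral_congr fun t => ?_
      by_cases ht : t ∈ s <;> simp [hψ, ht]
    have hψN : eLpNorm ψ 2 (timeMeasure T) ^ 2 = (timeMeasure T) s := by
      rw [eLpNorm_two_sq]
      simp_rw [hψ1]
      rw [lintegral_indicator hs]
      simp
    -- Since `ψ² = ψ`, the indicator can be put on both factors; Cauchy-Schwarz for `fs n` and the
    -- weak limit give the bound. Dividing by `N` leaves `N² ≤ M² |s|`.
    have hNN : N ^ 2 ≤ M * eLpNorm ψ 2 (timeMeasure T) * N := by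
      have e1 : ‖∫ z, (inner ℝ (f z) (ψ z.1 • f z) : ℝ) ∂(stMeasure T)‖ₑ = N ^ 2 := by
        have : ∀ z : ST, (inner ℝ (f z) (ψ z.1 • f z) : ℝ) = ‖ψ z.1 • f z‖ ^ 2 := fun z => by
          rw [← real_inner_self_eq_norm_sq, inner_smul_right, inner_smul_left, inner_smul_right,
            ← mul_assoc]
          simp [hψ2]
        simp_rw [this]
        rw [eLpNorm_two_sq, ← ofReal_norm, Real.norm_of_nonneg (integral_nonneg_of_ae
          (.of_forall fun z => sq_nonneg _)), ofReal_integral_eq_lintegral_ofReal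
          (hg.integrable_norm_pow (by norm_num)) (.of_forall fun z => sq_nonneg _)]
        refine lintegral_congr fun z => ?_
        rw [ENNReal.ofReal_pow (norm_nonneg _), ofReal_norm]
      rw [← e1]
      refine le_of_tendsto' (hweak _ hg).enorm fun n => ?_
      have e2 : ∫ z, (inner ℝ (fs n z) (ψ z.1 • f z) : ℝ) ∂(stMeasure T)
          = ∫ z, (inner ℝ (ψ z.1 • fs n z) (ψ z.1 • f z) : ℝ) ∂(stMeasure T) := by
        refine integral_congr_ae (.of_forall fun z => ?_)
        simp only [inner_smul_right, inner_smul_left, conj_trivial]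
        rw [← mul_assoc, hψ2]
      rw [e2]
      exact (enorm_integral_inner_le ((aestronglyMeasurable_fst hψm).smul (h n).meas) hgm).trans
        (mul_le_mul_left (eLpNorm_smul_time_le (h n).meas (h n).bound hψm) _)
    have hNle : N ≤ M * eLpNorm ψ 2 (timeMeasure T) := by
      rcases eq_or_ne N 0 with h0 | h0
      · rw [h0]; exact zero_le
      · rw [pow_two] at hNN
        exact (ENNReal.mul_le_mul_iff_left h0 hg.2.ne).1 hNN
    rw [← hN, setLIntegral_const, ← hψN, ← mul_pow]
    exact pow_le_pow_left₀ zero_le hNle 2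
  filter_upwards [hle] with t ht
  rw [← eLpNorm_two_sq (f := fun x => f (t, x))] at ht
  exact (ENNReal.pow_le_pow_left_iff two_ne_zero).1 ht

/-- Weak gradients pass to weak limits. -/
theorem HasWeakGrad.of_tendsto [CompleteSpace F]
    (hfs : ∀ n, MemLp (fs n) 2 (stMeasure T)) (hDfs : ∀ n i, MemLp (Dfs n i) 2 (stMeasure T))
    (hw : ∀ n, HasWeakGrad T (fs n) (Dfs n)) (hf : MemLp f 2 (stMeasure T))
    (hDf : ∀ i, MemLp (Df i) 2 (stMeasure T))
    (h : ∀ g : ST → F, MemLp g 2 (stMeasure T) →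
      Tendsto (fun n => ∫ z, (inner ℝ (fs n z) (g z) : ℝ) ∂(stMeasure T)) atTop
        (𝓝 (∫ z, (inner ℝ (f z) (g z) : ℝ) ∂(stMeasure T))))
    (hD : ∀ i, ∀ g : ST → F, MemLp g 2 (stMeasure T) →
      Tendsto (fun n => ∫ z, (inner ℝ (Dfs n i z) (g z) : ℝ) ∂(stMeasure T)) atTop
        (𝓝 (∫ z, (inner ℝ (Df i z) (g z) : ℝ) ∂(stMeasure T)))) :
    HasWeakGrad T f Df := by
  intro i ψ
  have hψ : MemLp ψ 2 (stMeasure T) := memLp_test ψ 2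
  have hψ' : MemLp (spaceDeriv i ψ) 2 (stMeasure T) := memLp_spaceDeriv ψ i 2 _
  refine ext_inner_right ℝ fun c => ?_
  have e : ∀ {a : ST → ℝ} {b : ST → F}, MemLp a 2 (stMeasure T) → MemLp b 2 (stMeasure T) →
      inner ℝ (∫ z, a z • b z ∂(stMeasure T)) c
        = ∫ z, (inner ℝ (b z) (a z • c) : ℝ) ∂(stMeasure T) := by
    intro a b ha hb
    rw [← inner_integral_left (integrable_smul ha hb)]
    refine integral_congr_ae (.of_forall fun z => ?_)
    simp [inner_smul_left, inner_smul_right]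
  have hc : ∀ {a : ST → ℝ}, MemLp a 2 (stMeasure T) → MemLp (fun z => a z • c) 2 (stMeasure T) :=
    fun ha => (ContinuousLinearMap.toSpanSingleton ℝ c).comp_memLp' ha
  rw [inner_neg_left, e hψ' hf, e hψ (hDf i)]
  refine tendsto_nhds_unique (h _ (hc hψ')) ((hD i _ (hc hψ)).neg.congr fun n => ?_)
  rw [← e hψ' (hfs n), ← e hψ (hDfs n i), hw n i ψ, inner_neg_left]

/-- Bounded fields have weakly convergent subsequences. -/
theorem exists_subseq_finiteEnergyField [FiniteDimensional ℝ F]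
    (h : ∀ n, BoundedBy T M (fs n) (Dfs n)) (hw : ∀ n, HasWeakGrad T (fs n) (Dfs n)) :
    ∃ φ : ℕ → ℕ, StrictMono φ ∧ ∃ (f : ST → F) (Df : Fin 3 → ST → F), FiniteEnergyField T f Df ∧
      ∀ g : ST → F, MemLp g 2 (stMeasure T) →
        Tendsto (fun n => ∫ z, (inner ℝ (fs (φ n) z) (g z) : ℝ) ∂(stMeasure T)) atTop
          (𝓝 (∫ z, (inner ℝ (f z) (g z) : ℝ) ∂(stMeasure T))) := by
  have := FiniteDimensional.complete ℝ F
  have := FiniteDimensional.proper ℝ F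
  have : Fact ((2 : ℝ≥0∞) ≠ ∞) := ⟨by norm_num⟩
  have : SecondCountableTopology (Lp F 2 (stMeasure T)) := Lp.SecondCountableTopology
  set C : ℝ≥0 := M * (eLpNorm (fun _ => (1 : ℝ)) 2 (timeMeasure T)).toNNReal + M
  -- The index `none` stands for the field and `some i` for its `i`-th derivative.
  have hmem : ∀ (i : Option (Fin 3)) n,
      MemLp (i.elim (fs n) (Dfs n)) 2 (stMeasure T) := fun i n => by
    cases i with
    | none => exact (h n).memLp
    | some i => exact (h n).grad_memLp i
  obtain ⟨φ, hφ, y, hy⟩ := exists_subseq_tendsto_inner_family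
    (x := fun i n => (hmem i n).toLp _) (C := C) fun i n => by
      rw [Lp.norm_toLp]
      refine ENNReal.toReal_le_coe_of_le_coe ?_
      cases i with
      | none => exact (h n).eLpNorm_le.trans (by exact_mod_cast le_self_add)
      | some i => exact ((h n).grad_bound i).trans (by exact_mod_cast le_add_self)
  have hlim : ∀ i, ∀ g : ST → F, MemLp g 2 (stMeasure T) →
      Tendsto (fun n => ∫ z, (inner ℝ (i.elim (fs (φ n)) (Dfs (φ n)) z) (g z) : ℝ) ∂(stMeasure T))
        atTop (𝓝 (∫ z, (inner ℝ (y i z) (g z) : ℝ) ∂(stMeasure T))) := by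
    intro i g hg
    have h1 := hy i (hg.toLp g)
    have h2 := inner_toLp (Lp.memLp (y i)) hg
    rw [Lp.toLp_coeFn] at h2
    rw [h2] at h1
    exact h1.congr fun n => inner_toLp (hmem i (φ n)) hg
  have hym : ∀ i, MemLp (y i) 2 (stMeasure T) := fun i => Lp.memLp _
  exact ⟨φ, hφ, y none, fun i => y (some i),
    ⟨⟨(hym none).1, M, ae_eLpNorm_le_of_tendsto (fun n => h (φ n)) (hym none) (hlim none)⟩,
      fun i => hym (some i),
      HasWeakGrad.of_tendsto (fun n => (h (φ n)).memLp) (fun n => (h (φ n)).grad_memLp)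
        (fun n => hw (φ n)) (hym none) (fun i => hym (some i)) (hlim none) fun i => hlim (some i)⟩,
    hlim none⟩

end WeakCompactness

end NSF

/-! ### Assembly of the two conclusions. -/

theorem mainTheorem4 (T : ℝ) (hT : 0 < T)
    (u₀ε : ℝ → NSF.E3 → NSF.E3) (θ₀ε p₀ε : ℝ → NSF.E3 → ℝ)
    (u₀ : NSF.E3 → NSF.E3) (θ₀ : NSF.E3 → ℝ)
    (uε : ℝ → NSF.ST → NSF.E3) (Duε : ℝ → Fin 3 → NSF.ST → NSF.E3)
    (θε : ℝ → NSF.ST → ℝ) (Dθε : ℝ → Fin 3 → NSF.ST → ℝ) (pε : ℝ → NSF.ST → ℝ)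
    (hsol : ∀ᶠ ε in 𝓝[>] (0 : ℝ), NSF.IsWeakSolution T ε (u₀ε ε) (θ₀ε ε) (p₀ε ε)
      (uε ε) (Duε ε) (θε ε) (Dθε ε) (pε ε))
    (hID : NSF.InitialDataConv u₀ε θ₀ε p₀ε u₀ θ₀) :
    -- every sequence `ε_k ↓ 0` has a subsequence along which a limit profile exists
    (∀ e : ℕ → ℝ, Tendsto e atTop (𝓝[>] 0) →
      ∃ k : ℕ → ℕ, StrictMono k ∧
        ∃ (u : NSF.ST → NSF.E3) (Du : Fin 3 → NSF.ST → NSF.E3)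
          (θ : NSF.ST → ℝ) (Dθ : Fin 3 → NSF.ST → ℝ),
          NSF.IsLimitProfile T (map (e ∘ k) atTop) uε θε u Du θ Dθ) ∧
    -- along sequences `ε_k ↓ 0`, or for the whole family `ε ↓ 0`, a limit profile is attained
    -- in the following senses
    (∀ l : Filter ℝ, l.IsCountablyGenerated → l ≤ 𝓝[>] 0 →
      ∀ (u : NSF.ST → NSF.E3) (Du : Fin 3 → NSF.ST → NSF.E3)
        (θ : NSF.ST → ℝ) (Dθ : Fin 3 → NSF.ST → ℝ),
        NSF.IsLimitProfile T l uε θε u Du θ Dθ →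
          NSF.TendstoL2L2loc T l (fun ε => NSF.lerayField (uε ε)) (NSF.lerayField u) ∧
          NSF.TendstoL2L2loc T l (fun ε t x => θε ε (t, x)) (fun t x => θ (t, x)) ∧
          (∀ i, NSF.TendstoWeakL2 T l (fun ε => Dθε ε i) (Dθ i)) ∧
          (∀ i, NSF.TendstoWeakL2 T l (fun ε => Duε ε i) (Du i))) := by
  obtain ⟨M, hM⟩ := NSF.exists_uniform_bound hsol hID
  refine ⟨fun e he => ?_, fun l _ hl u Du θ Dθ hlim => ?_⟩
  · obtain ⟨N, hN⟩ := eventually_atTop.1 (he.eventually (hsol.and hM))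
    replace hN : ∀ n, _ := fun n => hN (n + N) le_add_self
    obtain ⟨φ, hφ, u, Du, hu, hφu⟩ := NSF.exists_subseq_finiteEnergyField
      (fs := fun n => uε (e (n + N))) (fun n => (hN n).2.1) fun n => (hN n).1.u_mem.hasWeakGrad
    obtain ⟨χ, hχ, θ, Dθ, hθ, hχθ⟩ := NSF.exists_subseq_finiteEnergyField
      (fs := fun n => θε (e (φ n + N))) (fun n => (hN (φ n)).2.2)
      fun n => (hN (φ n)).1.θ_mem.hasWeakGrad
    -- The velocity is extracted along `φ`, the temperature along a further `χ`, and `N` is the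
    -- offset after which the solutions and bounds are available.
    refine ⟨fun n => φ (χ n) + N, fun m n hmn => Nat.add_lt_add_right (hφ (hχ hmn)) N,
      u, Du, θ, Dθ, hu, hθ, fun ψ => ?_, fun ψ => ?_⟩
    · exact tendsto_map'_iff.2 ((hφu ψ (NSF.memLp_test ψ 2)).comp hχ.tendsto_atTop)
    · exact tendsto_map'_iff.2 (hχθ ψ (NSF.memLp_test ψ 2))
  · have hs := hsol.filter_mono hl
    have hb := hM.filter_mono hl
    have hbu := hb.mono fun _ h => h.1
    have hbθ := hb.mono fun _ h => h.2
    obtain ⟨Mu, hMu⟩ := hlim.u_mem.exists_boundedBy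
    obtain ⟨Mθ, hMθ⟩ := hlim.θ_mem.exists_boundedBy
    have hwu := fun (g : NSF.ST → NSF.E3) (hg : MemLp g 2 (NSF.stMeasure T)) =>
      NSF.tendsto_integral_inner_of_boundedBy hbu hMu.memLp hlim.u_tendsto hg
    have hwθ := fun (g : NSF.ST → ℝ) (hg : MemLp g 2 (NSF.stMeasure T)) =>
      NSF.tendsto_integral_inner_of_boundedBy hbθ hMθ.memLp hlim.θ_tendsto hg
    -- A single constant for the family and for both limits, as the strong convergence lemmas
    -- require.
    set M' := M + Mu + Mθ
    have hle : M ≤ M' ∧ Mu ≤ M' ∧ Mθ ≤ M' :=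
      ⟨le_self_add.trans le_self_add, le_add_self.trans le_self_add, le_add_self⟩
    have hev : ∀ᶠ ε in l, NSF.IsWeakSolution T ε (u₀ε ε) (θ₀ε ε) (p₀ε ε)
        (uε ε) (Duε ε) (θε ε) (Dθε ε) (pε ε) ∧ NSF.BoundedBy T M' (uε ε) (Duε ε) ∧
        NSF.BoundedBy T M' (θε ε) (Dθε ε) := by
      filter_upwards [hs, hbu, hbθ] with ε h1 h2 h3
      exact ⟨h1, h2.mono hle.1, h3.mono hle.1⟩
    -- Since `l` is countably generated, strong convergence may be checked along sequences tending
    -- to `l`. Weak convergence is proved along `l` directly.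
    refine ⟨fun K hK => tendsto_of_seq_tendsto fun e he => ?_,
      fun K hK => tendsto_of_seq_tendsto fun e he => ?_, fun i => ?_, fun i => ?_⟩
    · obtain ⟨N, hN⟩ := eventually_atTop.1 (he.eventually hev)
      replace hN : ∀ n, _ := fun n => hN (n + N) le_add_self
      rw [← tendsto_add_atTop_iff_nat N] at he ⊢
      exact NSF.tendsto_velocity (fun n => (hN n).1) (fun n => (hN n).2.1) (hMu.mono hle.2.1)
        hlim.u_mem.hasWeakGrad (fun g hg => (hwu g hg).comp he) hK
    · obtain ⟨N, hN⟩ := eventually_atTop.1 (he.eventually hev)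
      replace hN : ∀ n, _ := fun n => hN (n + N) le_add_self
      rw [← tendsto_add_atTop_iff_nat N] at he ⊢
      exact NSF.tendsto_temperature (fun n => (hN n).1) (fun n => (hN n).2.1)
        (fun n => (hN n).2.2) (hMθ.mono hle.2.2) hlim.θ_mem.hasWeakGrad
        (fun g hg => (hwθ g hg).comp he) hK
    · exact ⟨hbθ.mono fun _ h => h.grad_memLp i, hMθ.grad_memLp i, fun g hg =>
        NSF.tendsto_integral_inner_grad hbθ (hs.mono fun _ h => h.θ_mem.hasWeakGrad) hMθ.memLp
          hMθ.grad_memLp hlim.θ_mem.hasWeakGrad hlim.θ_tendsto i hg⟩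
    · exact ⟨hbu.mono fun _ h => h.grad_memLp i, hMu.grad_memLp i, fun g hg =>
        NSF.tendsto_integral_inner_grad hbu (hs.mono fun _ h => h.u_mem.hasWeakGrad) hMu.memLp
          hMu.grad_memLp hlim.u_mem.hasWeakGrad hlim.u_tendsto i hg⟩
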